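/- For complex $x$ put $(x)_n=x(x+1)\cdots(x+n-1)$ for integers $n\ge 0$, and $x_s=(x)_s=\Gamma(x+s)/\Gamma(x)$ for complex $s$. Let $G=\sum_{n\ge0}(-1)^n/(2n+1)^2$ be Catalan's constant. For complex $a\notin\{-1,-2,-3,\dots\}$ the series $$f(a)=\sum_{n=0}^\infty \frac{(-1)^n}{2^{2n}}\,\frac{(a+\frac12)_n^5}{(a+1)_n^5}\,\bigl[20(n+a)^2+8(n+a)+1\bigr],\qquad g(a)=\sum_{n=0}^\infty \frac{1}{2^{2n}}\,\frac{(a+\frac12)_n^3}{(a+1)_n^3}\,\bigl[6(n+a)+1\bigr]$$ converge absolutely, and the following hold, all series on the right-hand sides being absolutely convergent. 1. If $\operatorname{Re}a>0$, then $$f(a)=8a\sum_{n=0}^\infty\frac{(\frac12)_n^4}{(a+1)_n^4}\,(4n+2a+1).$$ 2. If $a\notin\{-1,-2,\dots\}$ and $\cos\pi a\ne0$, then $$f(a)=\frac2\pi\cdot\frac1{\cos\pi a}\cdot\frac{1_a^2}{(\frac12)_a^2}\,g(a)+\frac{32a^3}{2a-1}\sum_{n=0}^\infty\frac{(\frac12)_n^2\,(a+\frac12)_n}{(a+1)_n^2\,(\frac32-a)_n}.$$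 3. If $a\notin\{-1,-2,\dots\}$, $\cos\pi a\neq0$ and $\operatorname{Re}a<\frac12$, then $$f(a)=\frac8{\pi^2}\cdot\frac{4^a}{\cos^3\pi a}\cdot\frac{1_a^5}{(\frac12)_a^5}+\frac{32}\pi\cdot\frac1{\cos\pi a}\cdot\frac{1_a^2}{(\frac12)_a^2}\cdot\frac{a^2}{2a-1}\sum_{n=0}^\infty\frac{(\frac12)_n\,(a+\frac12)_n}{(a+1)_n\,(\frac32-a)_n}+\frac{32a^3}{2a-1}\sum_{n=0}^\infty\frac{(\frac12)_n^2\,(a+\frac12)_n}{(a+1)_n^2\,(\frac32-a)_n}.$$ Moreover $f(\tfrac12)=7\zeta(3)$; $$\lim_{a\to0}\left[\frac{f(a)}{a^3}-\frac2\pi\cdot\frac1{\cos\pi a}\cdot\frac{1_a^2}{(\frac12)_a^2}\cdot\frac{g(a)}{a^3}\right]=-32\sum_{n=0}^\infty\frac{\binom{2n}n^2}{16^n(2n+1)}=-\frac{128\,G}{\pi};$$ and $f$ is analytic at $0$ with $$f(0)=\frac8{\pi^2},\qquad f'(0)=\frac{96}{\pi^2}\ln2,\qquad f''(0)=\frac{64}{3\pi^2}\bigl(54\ln^22-\pi^2\bigr).$$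 -/

import Mathlib

open Filter Topology

noncomputable section

/-- The rising factorial `(x)_n = x (x+1) ⋯ (x+n-1)` for a natural number `n`. -/
def rise (x : ℂ) (n : ℕ) : ℂ := (ascPochhammer ℂ n).eval x

/-- The rising factorial `(x)_s = Γ(x+s)/Γ(x)` for a complex index `s`. -/
def riseC (x s : ℂ) : ℂ := Complex.Gamma (x + s) / Complex.Gamma x

/-- Catalan's constant `1 - 1/3^2 + 1/5^2 - ⋯`. -/
def catalanConst : ℝ := ∑' n : ℕ, (-1 : ℝ) ^ n / (2 * (n : ℝ) + 1) ^ 2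

/-- The `n`-th term of the series `f(a)`. -/
def fTerm (a : ℂ) (n : ℕ) : ℂ :=
  (-1) ^ n / 2 ^ (2 * n) * (rise (a + 1 / 2) n ^ 5 / rise (a + 1) n ^ 5)
    * (20 * (n + a) ^ 2 + 8 * (n + a) + 1)

/-- The `n`-th term of the series `g(a)`. -/
def gTerm (a : ℂ) (n : ℕ) : ℂ :=
  1 / 2 ^ (2 * n) * (rise (a + 1 / 2) n ^ 3 / rise (a + 1) n ^ 3) * (6 * (n + a) + 1)

def fSeries (a : ℂ) : ℂ := ∑' n : ℕ, fTerm a n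

def gSeries (a : ℂ) : ℂ := ∑' n : ℕ, gTerm a n

/-- The term `(1/2)_n^4 / (a+1)_n^4 (4n+2a+1)`. -/
def uTerm (a : ℂ) (n : ℕ) : ℂ :=
  rise (1 / 2) n ^ 4 / rise (a + 1) n ^ 4 * (4 * n + 2 * a + 1)

/-- The term `(1/2)_n^2 (a+1/2)_n / ((a+1)_n^2 (3/2-a)_n)`. -/
def vTerm (a : ℂ) (n : ℕ) : ℂ :=
  rise (1 / 2) n ^ 2 * rise (a + 1 / 2) n / (rise (a + 1) n ^ 2 * rise (3 / 2 - a) n)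

/-- The term `(1/2)_n (a+1/2)_n / ((a+1)_n (3/2-a)_n)`. -/
def wTerm (a : ℂ) (n : ℕ) : ℂ :=
  rise (1 / 2) n * rise (a + 1 / 2) n / (rise (a + 1) n * rise (3 / 2 - a) n)

/-- The factor `(2/π) (1/cos πa) (1)_a^2 / (1/2)_a^2`. -/
def gFactor (a : ℂ) : ℂ :=
  2 / (Real.pi : ℂ) * (1 / Complex.cos (Real.pi * a)) * (riseC 1 a ^ 2 / riseC (1 / 2) a ^ 2)

/-- The term `C(2n,n)^2 / (16^n (2n+1))`. -/
def cTerm (n : ℕ) : ℝ :=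
  ((2 * n).choose n : ℝ) ^ 2 / (16 ^ n * (2 * (n : ℝ) + 1))

end

noncomputable section

/-! Dropping the first term of the series shows that
$f(a)=20a^2+8a+1-\frac14\bigl(\frac{a+1/2}{a+1}\bigr)^5f(a+1)$ (`fSeries_rec`), and $g$ satisfies a
similar recurrence with cubes (`gSeries_rec`). Each series on a right-hand side obeys a matching
recurrence, proved by telescoping with an explicit rational certificate (`tsum_uTerm_rec`,
`tsum_vTerm_rec`, `wSum_rec`).

For the first two identities the difference $d$ of the two sides solves the homogeneous recurrence,
so $|d(a+N)|\le\frac14|d(a+N+1)|$ once $\operatorname{Re}(a+N)\ge-\frac34$. A solution that is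
$O(3^N)$ along $a+N$ must therefore vanish (`eq_zero_of_fSeries_rec`), and what remains is to bound
both sides at $a+N$. In the second identity the certificate does not tend to $0$: its limit is
$-(6a+1)$ times `gFactor`, and the term in $g$ compensates exactly for this.

The third identity is the second with $g$ evaluated in closed form (`gSeries_eq`). Shifting to the
right is impossible here, because the series of `wTerm` needs $\operatorname{Re}a<\frac12$. Instead
`gDefect`, the difference of $g$ and that series, is multiplied by an inverse solution of the
homogeneous recurrence. The product is 1-periodic and extends to an entire function, and it is
$o(e^{2\pi|\operatorname{Im}a|})$. In the variable $q=e^{2\pi ia}$ it is $o(1/|q|)$ at $0$ and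
$o(|q|)$ at infinity, hence constant (`isConst_of_periodic`). The constant is read off at
$a=-\frac12$, where `gDefect` has a simple zero against a simple pole of the weight.

Of the special values, $7\zeta(3)$ is the first identity at $a=\frac12$. The limit at $0$ is the
second identity divided by $a^3$, together with an evaluation of the central binomial sum by
telescoping in $n$ and alternation in an auxiliary parameter $M$ (`tsum_cTerm`). The derivatives at
$0$ come from the third identity by second-order Taylor arithmetic (`HasJet`). The Gamma quotients
are handled there by the duplication and reflection formulas, so no individual digamma value is
needed. -/

lemma rise_zero (x : ℂ) : rise x 0 = 1 := by simp [rise]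

lemma rise_succ (x : ℂ) (n : ℕ) : rise x (n + 1) = rise x n * (x + n) := by
  simp [rise, ascPochhammer_succ_eval]

lemma rise_succ' (x : ℂ) (n : ℕ) : rise x (n + 1) = x * rise (x + 1) n := by
  induction n with
  | zero => simp [rise_succ, rise_zero]
  | succ n ih => rw [rise_succ, ih, rise_succ (x + 1)]; push_cast; ring

lemma rise_ne_zero {x : ℂ} (hx : ∀ j : ℕ, x + j ≠ 0) (n : ℕ) : rise x n ≠ 0 := by
  induction n with
  | zero => simp [rise_zero]
  | succ n ih => rw [rise_succ]; exact mul_ne_zero ih (hx n)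

lemma rise_add_one {x : ℂ} (hx : x ≠ 0) (n : ℕ) : rise (x + 1) n = rise x n * (x + n) / x := by
  rw [← rise_succ, rise_succ']; field_simp

lemma differentiable_rise (n : ℕ) : Differentiable ℂ (fun x => rise x n) :=
  Polynomial.differentiable _

/-! ### Growth of quotients of rising factorials -/

lemma exists_le_norm_add_nat {y : ℂ} (hy : ∀ j : ℕ, y + j ≠ 0) :
    ∃ δ > 0, ∀ j : ℕ, δ ≤ ‖y + j‖ := by
  obtain ⟨J, hJ⟩ := exists_nat_ge (‖y‖ + 1)
  have hne : (Finset.range (J + 1)).Nonempty := ⟨0, by simp⟩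
  obtain ⟨i, -, hi⟩ := Finset.exists_min_image (Finset.range (J + 1)) (fun j : ℕ => ‖y + j‖) hne
  refine ⟨min 1 ‖y + i‖, lt_min one_pos (norm_pos_iff.2 (hy i)), fun j => ?_⟩
  by_cases hj : j ≤ J
  · exact (min_le_right _ _).trans (hi j (by simp; omega))
  · refine (min_le_left _ _).trans ?_
    have h1 : (J : ℝ) ≤ j := by exact_mod_cast (by omega : J ≤ j)
    have h2 : ‖(j : ℂ)‖ ≤ ‖y + j‖ + ‖y‖ := by
      simpa using norm_sub_le (y + j) y
    rw [Complex.norm_natCast] at h2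
    linarith

lemma eventually_one_sub_le_rpow {p κ : ℝ} (h : p < κ) :
    ∀ᶠ t in 𝓝[>] (0 : ℝ), 1 - κ * t ≤ (1 - t) ^ p := by
  have hd : HasDerivAt (fun t : ℝ => (1 - t) ^ p) (-p) 0 := by
    have := (((hasDerivAt_id (0 : ℝ)).const_sub 1).rpow_const (p := p) (Or.inl (by simp)))
    simpa using this
  have := (hasDerivAt_iff_isLittleO.1 hd).bound (sub_pos.2 h)
  filter_upwards [nhdsWithin_le_nhds this, self_mem_nhdsWithin] with t ht ht0
  have ht0' : 0 < t := ht0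
  simp only [sub_zero, Real.one_rpow, smul_eq_mul, Real.norm_eq_abs, abs_of_pos ht0'] at ht
  have := (abs_le.1 ht).1
  nlinarith

/-- To first order $|x+j|^2/|y+j|^2$ is $1-2\operatorname{Re}(y-x)/j$, with an error $O(1/j^2)$
uniform for $x,y$ in the ball. An exponent $\kappa$ strictly between $\tau$ and $\sigma$ absorbs
both this error and the error of $1-2\kappa t\le(1-t)^{2\tau}$. The bound is given in powers of
$(j+1)/(j+2)$ because these telescope when multiplied. -/
lemma eventually_norm_add_nat_le (R σ τ : ℝ) (h : τ < σ) :
    ∀ᶠ j : ℕ in atTop, ∀ x y : ℂ, ‖x‖ ≤ R → ‖y‖ ≤ R → σ ≤ (y - x).re →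
      ‖x + j‖ ≤ (((j : ℝ) + 1) / (j + 2)) ^ τ * ‖y + j‖ := by
  set κ := (σ + τ) / 2 with hκ
  have h1 : Tendsto (fun j : ℕ => 1 / ((j : ℝ) + 2)) atTop (𝓝[>] 0) := by
    refine tendsto_nhdsWithin_iff.2 ⟨?_, Eventually.of_forall fun j => ?_⟩
    · exact tendsto_const_nhds.div_atTop (tendsto_natCast_atTop_atTop.atTop_add tendsto_const_nhds)
    · have : (0 : ℝ) < 1 / ((j : ℝ) + 2) := by positivity
      exact this
  have h2 := h1.eventually (eventually_one_sub_le_rpow (p := 2 * τ) (κ := 2 * κ) (by linarith))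
  -- Beyond this index the gain $2(\sigma-\kappa)j$ exceeds all the bounded error terms collected
  -- below.
  obtain ⟨J, hJ⟩ := exists_nat_ge ((12 * |κ| + 2 * |κ| * (R ^ 2 + 2 * R) + R ^ 2) / (2 * (σ - κ)))
  filter_upwards [h2, eventually_ge_atTop J] with j hj hjJ x y hx hy hxy
  have hR : 0 ≤ R := (norm_nonneg x).trans hx
  have hj0 : (0 : ℝ) < (j : ℝ) + 2 := by positivity
  have e1 : (1 - 1 / ((j : ℝ) + 2)) = (((j : ℝ) + 1) / (j + 2)) := by field_simp; ring
  rw [e1] at hj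
  have hb : (0 : ℝ) ≤ ((j : ℝ) + 1) / (j + 2) := by positivity
  have hsq : ((((j : ℝ) + 1) / (j + 2)) ^ τ) ^ 2 = (((j : ℝ) + 1) / (j + 2)) ^ (2 * τ) := by
    rw [mul_comm, Real.rpow_mul hb]; norm_cast
  refine (pow_le_pow_iff_left₀ (norm_nonneg _) (by positivity) two_ne_zero).1 ?_
  rw [mul_pow, hsq]
  refine le_trans ?_ (mul_le_mul_of_nonneg_right hj (sq_nonneg _))
  have hJ' : (12 * |κ| + 2 * |κ| * (R ^ 2 + 2 * R) + R ^ 2) ≤ (j : ℝ) * (2 * (σ - κ)) := by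
    rw [← div_le_iff₀ (by linarith)]
    exact hJ.trans (by exact_mod_cast hjJ)
  have nx : ‖x + j‖ ^ 2 = ‖x‖ ^ 2 + 2 * j * x.re + (j : ℝ) ^ 2 := by
    rw [Complex.sq_norm, Complex.sq_norm, Complex.normSq_apply, Complex.normSq_apply]; simp; ring
  have ny : ‖y + j‖ ^ 2 = ‖y‖ ^ 2 + 2 * j * y.re + (j : ℝ) ^ 2 := by
    rw [Complex.sq_norm, Complex.sq_norm, Complex.normSq_apply, Complex.normSq_apply]; simp; ring
  rw [nx]
  have key : 2 * κ * (1 / ((j : ℝ) + 2)) * ‖y + j‖ ^ 2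
      ≤ 2 * κ * j + (12 * |κ| + 2 * |κ| * (R ^ 2 + 2 * R)) := by
    have e : 2 * κ * (1 / ((j : ℝ) + 2)) * ‖y + j‖ ^ 2
        = 2 * κ * j + 2 * κ * ((‖y‖ ^ 2 + 2 * j * y.re - 2 * j) / (j + 2)) := by
      rw [ny]; field_simp; ring
    rw [e]
    have : |(‖y‖ ^ 2 + 2 * j * y.re - 2 * j) / ((j : ℝ) + 2)| ≤ R ^ 2 + 2 * R + 2 := by
      rw [abs_div, abs_of_pos hj0, div_le_iff₀ hj0]
      have a1 := abs_le.1 ((Complex.abs_re_le_norm y).trans hy)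
      have a2 : ‖y‖ ^ 2 ≤ R ^ 2 := by gcongr
      have a3 : (0 : ℝ) ≤ j := by positivity
      have a4 : (j : ℝ) * y.re ≤ j * R := by gcongr; exact a1.2
      have a5 : (j : ℝ) * (-R) ≤ j * y.re := by gcongr; exact a1.1
      have a6 : 0 ≤ R ^ 2 * j := by positivity
      rw [abs_le]
      constructor <;> nlinarith [sq_nonneg ‖y‖]
    have h3 : 2 * κ * ((‖y‖ ^ 2 + 2 * j * y.re - 2 * j) / (j + 2))
        ≤ |2 * κ| * (R ^ 2 + 2 * R + 2) := by
      refine (le_abs_self _).trans ?_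
      rw [abs_mul]; gcongr
    rw [abs_mul, abs_two] at h3
    nlinarith [abs_nonneg κ]
  have hre : (j : ℝ) * σ ≤ j * (y.re - x.re) := by
    gcongr; simpa using hxy
  have : ‖x‖ ^ 2 ≤ R ^ 2 := by gcongr
  nlinarith [sq_nonneg ‖y‖]

/-- Uniform growth of quotients of rising factorials. -/
lemma exists_norm_rise_le (R δ σ τ : ℝ) (hδ : 0 < δ) (h : τ < σ) :
    ∃ C > 0, ∀ x y : ℂ, ‖x‖ ≤ R → ‖y‖ ≤ R → σ ≤ (y - x).re → (∀ j : ℕ, δ ≤ ‖y + j‖) →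
      ∀ n, ‖rise x n‖ ≤ C * ((n : ℝ) + 1) ^ (-τ) * ‖rise y n‖ := by
  obtain ⟨J, hJ⟩ := eventually_atTop.1 (eventually_norm_add_nat_le R σ τ h)
  -- `M` pays for each of the first `J` factors, where only the crude bounds $|x+n|\le|R|+J$ and
  -- $|y+n|\ge\delta$ are available. The maximum with 1 makes $M^{\min(n,J)}\le M^J$.
  set M := max 1 (((|R| + J) / δ) * 2 ^ |τ|) with hM
  have hM1 : 1 ≤ M := le_max_left _ _
  have hM0 : 0 < M := by linarith
  refine ⟨M ^ J, by positivity, fun x y hx hy hxy hyj n => ?_⟩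
  suffices H : ‖rise x n‖ ≤ M ^ (min n J) * ((n : ℝ) + 1) ^ (-τ) * ‖rise y n‖ by
    refine H.trans ?_
    gcongr
    exact min_le_right _ _
  induction n with
  | zero => simp [rise_zero]
  | succ n ih =>
    have step : ‖x + n‖ ≤ (if n < J then M else 1) * (((n : ℝ) + 1) / (n + 2)) ^ τ * ‖y + n‖ := by
      split_ifs with hn
      · have b1 : ‖x + n‖ ≤ |R| + J := by
          refine (norm_add_le _ _).trans ?_
          rw [Complex.norm_natCast]
          have : (n : ℝ) ≤ J := by exact_mod_cast hn.le
          linarith [le_abs_self R]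
        have b2 : (2 : ℝ) ^ (-|τ|) ≤ (((n : ℝ) + 1) / (n + 2)) ^ τ := by
          have c1 : (1 / 2 : ℝ) ≤ ((n : ℝ) + 1) / (n + 2) := by
            rw [div_le_div_iff₀ (by norm_num) (by positivity)]; nlinarith [n.cast_nonneg (α := ℝ)]
          have c2 : ((n : ℝ) + 1) / (n + 2) ≤ 1 := by
            rw [div_le_one (by positivity)]; linarith
          calc (2 : ℝ) ^ (-|τ|) = (1 / 2) ^ |τ| := by
                rw [Real.rpow_neg (by norm_num), one_div, Real.inv_rpow (by norm_num)]
            _ ≤ (((n : ℝ) + 1) / (n + 2)) ^ |τ| := by gcongr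
            _ ≤ _ := Real.rpow_le_rpow_of_exponent_ge (by positivity) c2 (le_abs_self τ)
        have b3 : (2 : ℝ) ^ |τ| * 2 ^ (-|τ|) = 1 := by
          rw [← Real.rpow_add (by norm_num)]; simp
        calc ‖x + n‖ ≤ |R| + J := b1
          _ = ((|R| + J) / δ * 2 ^ |τ|) * 2 ^ (-|τ|) * δ := by
              rw [mul_assoc (_ / _), b3]; field_simp
          _ ≤ M * (((n : ℝ) + 1) / (n + 2)) ^ τ * ‖y + n‖ := by
              gcongr
              · exact le_max_right _ _
              · exact hyj n
      · rw [one_mul]; exact hJ n (by omega) x y hx hy hxy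
    rw [rise_succ, rise_succ, norm_mul, norm_mul]
    refine (mul_le_mul ih step (norm_nonneg _) (by positivity)).trans (le_of_eq ?_)
    have e1 : M ^ (min n J) * (if n < J then M else 1) = M ^ (min (n + 1) J) := by
      split_ifs with hn
      · rw [← pow_succ]; congr 1; omega
      · rw [mul_one]; congr 1; omega
    have e2 : ((n : ℝ) + 1) ^ (-τ) * (((n : ℝ) + 1) / (n + 2)) ^ τ = (((n + 1 : ℕ) : ℝ) + 1) ^ (-τ) := by
      rw [Real.div_rpow (by positivity) (by positivity), Real.rpow_neg (by positivity),
        Real.rpow_neg (by positivity)]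
      push_cast
      rw [show (n : ℝ) + 1 + 1 = n + 2 by ring]
      have : ((n : ℝ) + 1) ^ τ ≠ 0 := (Real.rpow_pos_of_pos (by positivity) _).ne'
      field_simp
    rw [← e1, ← e2]; ring

/-! ### Contracting sequences and telescoping sums -/

lemma summable_nat_add_one_rpow {p : ℝ} (hp : p < -1) :
    Summable (fun n : ℕ => ((n : ℝ) + 1) ^ p) := by
  have := (summable_nat_add_iff 1).2 (Real.summable_nat_rpow.2 hp)
  simpa using this

/-- Iterating the contraction $m$ times leaves at most $4^{-m}C\,3^{N_0+m}$, which tends to $0$. -/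
lemma eq_zero_of_contracting {e : ℕ → ℂ} {N₀ : ℕ} {C : ℝ}
    (h1 : ∀ N ≥ N₀, ‖e N‖ ≤ 1 / 4 * ‖e (N + 1)‖) (h2 : ∀ N ≥ N₀, ‖e N‖ ≤ C * 3 ^ N) :
    e N₀ = 0 := by
  have h3 : ∀ m, ‖e N₀‖ ≤ (1 / 4) ^ m * ‖e (N₀ + m)‖ := by
    intro m
    induction m with
    | zero => simp
    | succ m ih =>
      refine ih.trans ?_
      rw [pow_succ, mul_assoc]
      gcongr
      exact h1 _ (by omega)
  have h4 : ∀ m : ℕ, ‖e N₀‖ ≤ C * 3 ^ N₀ * (3 / 4) ^ m := by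
    intro m
    refine (h3 m).trans ?_
    calc _ ≤ (1 / 4 : ℝ) ^ m * (C * 3 ^ (N₀ + m)) := by gcongr; exact h2 _ (by omega)
      _ = _ := by rw [pow_add, div_pow, div_pow]; ring
  have h5 : Tendsto (fun m : ℕ => C * 3 ^ N₀ * (3 / 4 : ℝ) ^ m) atTop (𝓝 (C * 3 ^ N₀ * 0)) :=
    (tendsto_pow_atTop_nhds_zero_of_lt_one (by norm_num) (by norm_num)).const_mul _
  rw [mul_zero] at h5
  exact norm_le_zero_iff.1 (ge_of_tendsto' h5 h4)

lemma exists_pow_le_mul_pow (K : ℝ) (hK : 0 ≤ K) (k : ℕ) {r : ℝ} (hr : 1 < r) :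
    ∃ C > 0, ∀ N : ℕ, ((N : ℝ) + K) ^ k ≤ C * r ^ N := by
  have h := tendsto_pow_const_mul_const_pow_of_abs_lt_one k (r := 1 / r) (by
    rw [abs_of_pos (by positivity), div_lt_one (by linarith)]; exact hr)
  obtain ⟨C, hC⟩ := h.bddAbove_range
  have hC0 : 0 ≤ C := le_trans (by positivity) (hC ⟨0, rfl⟩)
  refine ⟨(1 + K) ^ k * (C + 1), by positivity, fun N => ?_⟩
  have h1 : ((N : ℝ) + K) ^ k ≤ (1 + K) ^ k * (max 1 (N : ℝ)) ^ k := by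
    rw [← mul_pow]
    gcongr
    have := le_max_left 1 (N : ℝ)
    have := le_max_right 1 (N : ℝ)
    nlinarith
  refine h1.trans ?_
  rw [mul_assoc]
  gcongr
  rcases Nat.eq_zero_or_pos N with rfl | hN
  · simp; linarith
  · have h1N : (1 : ℝ) ≤ N := by exact_mod_cast hN
    rw [max_eq_right h1N]
    have := hC ⟨N, rfl⟩
    simp only [one_div, inv_pow] at this
    rw [← div_eq_mul_inv, div_le_iff₀ (by positivity)] at this
    refine this.trans ?_
    gcongr
    linarith

lemma tsum_eq_of_telescoping {t R : ℕ → ℂ} {l : ℂ} (ht : Summable t)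
    (h : ∀ n, t n = R (n + 1) - R n) (hR : Tendsto R atTop (𝓝 l)) : ∑' n, t n = l - R 0 := by
  have h1 : ∀ n, ∑ i ∈ Finset.range n, t i = R n - R 0 := fun n => by
    rw [← Finset.sum_range_sub]; exact Finset.sum_congr rfl fun i _ => h i
  have h2 := ht.hasSum.tendsto_sum_nat
  simp_rw [h1] at h2
  exact tendsto_nhds_unique h2 (hR.sub_const _)

/-! ### The series f and g: convergence, bounds, recurrences -/

lemma add_one_add_nat_ne_zero {a : ℂ} (ha : ∀ m : ℕ, a ≠ -((m : ℂ) + 1)) (j : ℕ) :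
    a + 1 + j ≠ 0 := fun h => ha j (by linear_combination h)

lemma ne_neg_of_re {a : ℂ} (ha : -1 < a.re) (m : ℕ) : a ≠ -((m : ℂ) + 1) := by
  rintro rfl
  have : (0 : ℝ) ≤ m := m.cast_nonneg
  simp at ha
  linarith

lemma ne_neg_add_one {a : ℂ} (ha : ∀ m : ℕ, a ≠ -((m : ℂ) + 1)) (m : ℕ) :
    a + 1 ≠ -((m : ℂ) + 1) := fun h => ha (m + 1) (by push_cast; linear_combination h)

lemma norm_add_nat_le_of_re {x y : ℂ} (h : x.im = y.im) {j : ℕ} (h0 : x.re ≤ y.re)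
    (h1 : 0 ≤ x.re + y.re + 2 * j) : ‖x + j‖ ≤ ‖y + j‖ := by
  refine (pow_le_pow_iff_left₀ (norm_nonneg _) (norm_nonneg _) two_ne_zero).1 ?_
  rw [Complex.sq_norm, Complex.sq_norm, Complex.normSq_apply, Complex.normSq_apply]
  simp [h]
  nlinarith

lemma norm_rise_le_norm_rise {x y : ℂ} (h : ∀ j : ℕ, ‖x + j‖ ≤ ‖y + j‖) (n : ℕ) :
    ‖rise x n‖ ≤ ‖rise y n‖ := by
  induction n with
  | zero => simp [rise_zero]
  | succ n ih => rw [rise_succ, rise_succ, norm_mul, norm_mul]; gcongr; exact h n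

/-- The point $a+\frac12+j$ is no farther from $0$ than $a+1+j$ exactly when
$2\operatorname{Re}a+\frac32+2j\ge0$, which is where $-\frac34$ comes from. The constant 1,
independent of $a$, makes the bounds at $a+N$ uniform in $N$; it is written out to fit the shape
expected by `norm_fTerm_le` and `norm_gTerm_le`. -/
lemma norm_rise_half_le {a : ℂ} (ha : -(3 / 4) ≤ a.re) (n : ℕ) :
    ‖rise (a + 1 / 2) n‖ ≤ 1 * ‖rise (a + 1) n‖ := by
  rw [one_mul]
  refine norm_rise_le_norm_rise (fun j => norm_add_nat_le_of_re (by simp) (by simp; norm_num) ?_) n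
  have : (0 : ℝ) ≤ j := j.cast_nonneg
  simp
  linarith

lemma exists_norm_rise_half_le {a : ℂ} (ha : ∀ m : ℕ, a ≠ -((m : ℂ) + 1)) :
    ∃ C ≥ 0, ∀ n, ‖rise (a + 1 / 2) n‖ ≤ C * ‖rise (a + 1) n‖ := by
  obtain ⟨δ, hδ, h⟩ := exists_le_norm_add_nat (add_one_add_nat_ne_zero ha)
  obtain ⟨C, hC, H⟩ := exists_norm_rise_le (‖a‖ + 1) δ (1 / 2) 0 hδ (by norm_num)
  refine ⟨C, hC.le, fun n => ?_⟩
  have := H (a + 1 / 2) (a + 1) ((norm_add_le _ _).trans (by norm_num))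
    ((norm_add_le _ _).trans (by norm_num)) (by norm_num) h n
  simpa using this

lemma norm_fTerm_le {a : ℂ} {C : ℝ} (hC : 0 ≤ C)
    (h : ∀ n, ‖rise (a + 1 / 2) n‖ ≤ C * ‖rise (a + 1) n‖) (n : ℕ) :
    ‖fTerm a n‖ ≤ C ^ 5 * (29 * (1 + ‖a‖) ^ 2) * (((n : ℝ) + 1) ^ 2 * (1 / 4) ^ n) := by
  have h1 : ‖rise (a + 1 / 2) n ^ 5 / rise (a + 1) n ^ 5‖ ≤ C ^ 5 := by
    rw [← div_pow, norm_pow, norm_div]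
    gcongr
    exact div_le_of_le_mul₀ (norm_nonneg _) hC (h n)
  have h2 : ‖(-1 : ℂ) ^ n / 2 ^ (2 * n)‖ = (1 / 4) ^ n := by
    rw [pow_mul, norm_div, norm_pow, norm_pow, div_pow]; norm_num
  have h3 : ‖(n : ℂ) + a‖ ≤ (1 + ‖a‖) * (n + 1) := by
    refine (norm_add_le _ _).trans ?_
    rw [Complex.norm_natCast]
    nlinarith [norm_nonneg a, n.cast_nonneg (α := ℝ), mul_nonneg (norm_nonneg a) (n.cast_nonneg (α := ℝ))]
  have h4 : 1 ≤ (1 + ‖a‖) * ((n : ℝ) + 1) := by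
    nlinarith [norm_nonneg a, n.cast_nonneg (α := ℝ), mul_nonneg (norm_nonneg a) (n.cast_nonneg (α := ℝ))]
  -- Here $29=20+8+1$, all three terms being compared with $X^2$ for an $X\ge1$.
  have h5 : ‖20 * ((n : ℂ) + a) ^ 2 + 8 * (n + a) + 1‖ ≤ 29 * ((1 + ‖a‖) * (n + 1)) ^ 2 := by
    set X := (1 + ‖a‖) * ((n : ℝ) + 1)
    calc _ ≤ 20 * ‖(n : ℂ) + a‖ ^ 2 + 8 * ‖(n : ℂ) + a‖ + 1 := by
          refine (norm_add_le _ _).trans ?_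
          rw [norm_one]
          gcongr
          refine (norm_add_le _ _).trans ?_
          rw [norm_mul, norm_mul, norm_pow]; norm_num
      _ ≤ 20 * X ^ 2 + 8 * X + 1 := by gcongr
      _ ≤ 29 * X ^ 2 := by nlinarith
  rw [fTerm, norm_mul, norm_mul, h2]
  calc _ ≤ (1 / 4) ^ n * C ^ 5 * (29 * ((1 + ‖a‖) * (n + 1)) ^ 2) := by gcongr
    _ = _ := by ring

lemma norm_gTerm_le {a : ℂ} {C : ℝ} (hC : 0 ≤ C)
    (h : ∀ n, ‖rise (a + 1 / 2) n‖ ≤ C * ‖rise (a + 1) n‖) (n : ℕ) :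
    ‖gTerm a n‖ ≤ C ^ 3 * (7 * (1 + ‖a‖)) * (((n : ℝ) + 1) ^ 2 * (1 / 4) ^ n) := by
  have h1 : ‖rise (a + 1 / 2) n ^ 3 / rise (a + 1) n ^ 3‖ ≤ C ^ 3 := by
    rw [← div_pow, norm_pow, norm_div]
    gcongr
    exact div_le_of_le_mul₀ (norm_nonneg _) hC (h n)
  have h2 : ‖(1 : ℂ) / 2 ^ (2 * n)‖ = (1 / 4) ^ n := by
    rw [pow_mul, norm_div, norm_pow, div_pow]; norm_num
  have h5 : ‖6 * ((n : ℂ) + a) + 1‖ ≤ 7 * (1 + ‖a‖) * ((n : ℝ) + 1) ^ 2 := by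
    calc _ ≤ 6 * (n + ‖a‖) + 1 := by
          refine (norm_add_le _ _).trans ?_
          rw [norm_one, norm_mul]
          gcongr
          · norm_num
          · refine (norm_add_le _ _).trans ?_
            rw [Complex.norm_natCast]
      _ ≤ _ := by
        have := norm_nonneg a
        have : (0 : ℝ) ≤ n := n.cast_nonneg
        nlinarith [mul_nonneg (norm_nonneg a) (n.cast_nonneg (α := ℝ)),
          mul_nonneg (norm_nonneg a) (sq_nonneg (n : ℝ))]
  rw [gTerm, norm_mul, norm_mul, h2]
  calc _ ≤ (1 / 4) ^ n * C ^ 3 * (7 * (1 + ‖a‖) * ((n : ℝ) + 1) ^ 2) := by gcongr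
    _ = _ := by ring

lemma summable_sq_mul_geometric :
    Summable (fun n : ℕ => ((n : ℝ) + 1) ^ 2 * (1 / 4 : ℝ) ^ n) := by
  have h := (summable_nat_add_iff 1).2 (summable_pow_mul_geometric_of_norm_lt_one 2
    (r := (1 / 4 : ℝ)) (by norm_num))
  refine (h.mul_left 4).congr fun n => ?_
  push_cast
  ring

lemma summable_fTerm {a : ℂ} (ha : ∀ m : ℕ, a ≠ -((m : ℂ) + 1)) : Summable (fTerm a) := by
  obtain ⟨C, hC, h⟩ := exists_norm_rise_half_le ha
  exact .of_norm_bounded (summable_sq_mul_geometric.mul_left _) (norm_fTerm_le hC h)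

lemma summable_gTerm {a : ℂ} (ha : ∀ m : ℕ, a ≠ -((m : ℂ) + 1)) : Summable (gTerm a) := by
  obtain ⟨C, hC, h⟩ := exists_norm_rise_half_le ha
  exact .of_norm_bounded (summable_sq_mul_geometric.mul_left _) (norm_gTerm_le hC h)

lemma exists_norm_fSeries_le :
    ∃ K ≥ 0, ∀ a : ℂ, -(3 / 4) ≤ a.re → ‖fSeries a‖ ≤ K * (1 + ‖a‖) ^ 2 := by
  refine ⟨29 * ∑' n : ℕ, ((n : ℝ) + 1) ^ 2 * (1 / 4 : ℝ) ^ n, by positivity, fun a ha => ?_⟩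
  refine (tsum_of_norm_bounded (summable_sq_mul_geometric.mul_left _).hasSum
    (norm_fTerm_le zero_le_one (norm_rise_half_le ha))).trans (le_of_eq ?_)
  rw [tsum_mul_left]
  ring

lemma norm_gSeries_le {a : ℂ} {C : ℝ} (hC : 0 ≤ C)
    (h : ∀ n, ‖rise (a + 1 / 2) n‖ ≤ C * ‖rise (a + 1) n‖) :
    ‖gSeries a‖ ≤ C ^ 3 * (7 * ∑' n : ℕ, ((n : ℝ) + 1) ^ 2 * (1 / 4 : ℝ) ^ n) * (1 + ‖a‖) := by
  refine (tsum_of_norm_bounded (summable_sq_mul_geometric.mul_left _).hasSum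
    (norm_gTerm_le hC h)).trans (le_of_eq ?_)
  rw [tsum_mul_left]
  ring

lemma fTerm_succ (a : ℂ) (n : ℕ) :
    fTerm a (n + 1) = -(1 / 4) * ((a + 1 / 2) / (a + 1)) ^ 5 * fTerm (a + 1) n := by
  rw [fTerm, fTerm, rise_succ', rise_succ', mul_pow, mul_pow, mul_div_mul_comm, ← div_pow,
    show a + 1 / 2 + 1 = a + 1 + 1 / 2 by ring]
  push_cast
  rw [show 2 * (n + 1) = 2 * n + 2 by ring, pow_add, pow_succ (-1 : ℂ)]
  ring

lemma gTerm_succ (a : ℂ) (n : ℕ) :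
    gTerm a (n + 1) = 1 / 4 * ((a + 1 / 2) / (a + 1)) ^ 3 * gTerm (a + 1) n := by
  rw [gTerm, gTerm, rise_succ', rise_succ', mul_pow, mul_pow, mul_div_mul_comm, ← div_pow,
    show a + 1 / 2 + 1 = a + 1 + 1 / 2 by ring]
  push_cast
  rw [show 2 * (n + 1) = 2 * n + 2 by ring, pow_add]
  ring

/-- Since $n$ and $a$ enter the polynomial factor only through $n+a$, the series without its first
term is a multiple of the series at $a+1$. -/
lemma fSeries_rec {a : ℂ} (ha : ∀ m : ℕ, a ≠ -((m : ℂ) + 1)) :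
    fSeries a = 20 * a ^ 2 + 8 * a + 1
      - 1 / 4 * ((a + 1 / 2) / (a + 1)) ^ 5 * fSeries (a + 1) := by
  rw [fSeries, (summable_fTerm ha).tsum_eq_zero_add]
  simp_rw [fTerm_succ]
  rw [tsum_mul_left, ← fSeries]
  simp [fTerm, rise_zero]
  ring

lemma gSeries_rec {a : ℂ} (ha : ∀ m : ℕ, a ≠ -((m : ℂ) + 1)) :
    gSeries a = 6 * a + 1 + 1 / 4 * ((a + 1 / 2) / (a + 1)) ^ 3 * gSeries (a + 1) := by
  rw [gSeries, (summable_gTerm ha).tsum_eq_zero_add]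
  simp_rw [gTerm_succ]
  rw [tsum_mul_left, ← gSeries]
  simp [gTerm, rise_zero]

lemma norm_half_ratio_le {a : ℂ} (ha : -(3 / 4) ≤ a.re) : ‖(a + 1 / 2) / (a + 1)‖ ≤ 1 := by
  rw [norm_div]
  refine div_le_one_of_le₀ ?_ (norm_nonneg _)
  have := norm_rise_half_le ha 1
  simpa [rise_succ, rise_zero] using this

/-- A solution of the homogeneous recurrence of `fSeries` that grows slower than `4 ^ N` vanishes. -/
lemma eq_zero_of_fSeries_rec {d : ℂ → ℂ} {a : ℂ}
    (hd : ∀ N : ℕ, d (a + N) = -(1 / 4) * ((a + N + 1 / 2) / (a + N + 1)) ^ 5 * d (a + N + 1))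
    {C : ℝ} (hC : ∀ᶠ N : ℕ in atTop, ‖d (a + N)‖ ≤ C * 3 ^ N) : d a = 0 := by
  -- From `N₁` on, the real part is at least $-\frac34$, so the fifth power in the recurrence has
  -- norm at most 1 and the contraction factor is $\frac14$.
  obtain ⟨N₁, hN₁⟩ := exists_nat_ge (-(3 / 4) - a.re)
  obtain ⟨N₂, hN₂⟩ := eventually_atTop.1 hC
  set N₀ := max N₁ N₂
  have h0 : d (a + N₀) = 0 := by
    refine eq_zero_of_contracting (e := fun N : ℕ => d (a + N)) (N₀ := N₀) (C := C)
      (fun N hN => ?_) (fun N hN => hN₂ N (le_trans (le_max_right _ _) hN))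
    have h1 : (N₁ : ℝ) ≤ N := by exact_mod_cast (le_max_left _ _).trans hN
    have h2 := norm_half_ratio_le (a := a + N) (by simp; linarith)
    rw [hd N, norm_mul, norm_mul, norm_pow]
    push_cast
    rw [← add_assoc]
    have h3 : ‖(a + N + 1 / 2) / (a + N + 1)‖ ^ 5 ≤ 1 := pow_le_one₀ (norm_nonneg _) h2
    have h4 : ‖(-(1 / 4) : ℂ)‖ = 1 / 4 := by norm_num
    rw [h4]
    gcongr
    linarith
  -- The recurrence carries the zero back from $a+N_0$ to $a$, whatever the size of the finitely
  -- many factors on the way.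
  have h5 : ∀ m ≤ N₀, d (a + (N₀ - m : ℕ)) = 0 := by
    intro m
    induction m with
    | zero => intro _; simpa using h0
    | succ m ih =>
      intro hm
      rw [hd, show a + ((N₀ - (m + 1) : ℕ) : ℂ) + 1 = a + ((N₀ - m : ℕ) : ℂ) by
        rw [show N₀ - m = N₀ - (m + 1) + 1 by omega]; push_cast; ring, ih (by omega), mul_zero]
  simpa using h5 N₀ le_rfl

/-! ### The first identity and the value at 1/2 -/

lemma norm_half_div_rise_pow_le {a : ℂ} {C τ : ℝ} (hC : 0 < C)
    (h : ∀ n : ℕ, ‖rise (1 / 2) n‖ ≤ C * ((n : ℝ) + 1) ^ (-τ) * ‖rise (a + 1) n‖) (n : ℕ) :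
    ‖rise (1 / 2) n ^ 4 / rise (a + 1) n ^ 4‖ ≤ C ^ 4 * ((n : ℝ) + 1) ^ (-(4 * τ)) := by
  rw [← div_pow, norm_pow, norm_div]
  have e : ((n : ℝ) + 1) ^ (-(4 * τ)) = (((n : ℝ) + 1) ^ (-τ)) ^ 4 := by
    rw [← Real.rpow_natCast, ← Real.rpow_mul (by positivity)]
    congr 1; push_cast; ring
  rw [e, ← mul_pow]
  gcongr
  exact div_le_of_le_mul₀ (norm_nonneg _) (by positivity) (h n)

lemma norm_uTerm_le {a : ℂ} {C τ : ℝ} (hC : 0 < C)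
    (h : ∀ n : ℕ, ‖rise (1 / 2) n‖ ≤ C * ((n : ℝ) + 1) ^ (-τ) * ‖rise (a + 1) n‖) (n : ℕ) :
    ‖uTerm a n‖ ≤ C ^ 4 * (5 + 2 * ‖a‖) * ((n : ℝ) + 1) ^ (1 - 4 * τ) := by
  have h2 : ‖4 * (n : ℂ) + 2 * a + 1‖ ≤ (5 + 2 * ‖a‖) * (n + 1) := by
    refine (norm_add_le _ _).trans ?_
    have := norm_add_le (4 * (n : ℂ)) (2 * a)
    rw [norm_mul, norm_mul, Complex.norm_natCast] at this
    norm_num at this ⊢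
    have := norm_nonneg a
    nlinarith [mul_nonneg (norm_nonneg a) (n.cast_nonneg (α := ℝ))]
  rw [uTerm, norm_mul]
  have e : ((n : ℝ) + 1) ^ (1 - 4 * τ) = ((n : ℝ) + 1) ^ (-(4 * τ)) * (n + 1) := by
    rw [sub_eq_neg_add, Real.rpow_add (by positivity), Real.rpow_one]
  calc _ ≤ C ^ 4 * ((n : ℝ) + 1) ^ (-(4 * τ)) * ((5 + 2 * ‖a‖) * (n + 1)) := by
        gcongr
        exact norm_half_div_rise_pow_le hC h n
    _ = _ := by rw [e]; ring

/-- The true decay exponent is $\frac12+\operatorname{Re}a$. Half of $\operatorname{Re}a$ is given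
away to have a strict gap, and fourth powers still decay like $n^{-2-2\operatorname{Re}a}$, enough
to sum against a linear factor. -/
lemma exists_norm_rise_one_half_le {a : ℂ} (ha : 0 < a.re) :
    ∃ C > 0, ∀ n : ℕ,
      ‖rise (1 / 2) n‖ ≤ C * ((n : ℝ) + 1) ^ (-(1 / 2 + a.re / 2)) * ‖rise (a + 1) n‖ := by
  obtain ⟨δ, hδ, h⟩ := exists_le_norm_add_nat
    (add_one_add_nat_ne_zero (ne_neg_of_re (a := a) (by linarith)))
  obtain ⟨C, hC, H⟩ := exists_norm_rise_le (‖a‖ + 1) δ (1 / 2 + a.re) (1 / 2 + a.re / 2) hδ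
    (by linarith)
  refine ⟨C, hC, fun n => H _ _ ?_ ((norm_add_le _ _).trans (by norm_num)) ?_ h n⟩
  · norm_num; linarith [norm_nonneg a]
  · norm_num; linarith

lemma summable_uTerm {a : ℂ} (ha : 0 < a.re) : Summable (uTerm a) := by
  obtain ⟨C, hC, h⟩ := exists_norm_rise_one_half_le ha
  exact .of_norm_bounded ((summable_nat_add_one_rpow (by linarith)).mul_left _) (norm_uTerm_le hC h)

lemma tendsto_nat_add_one_rpow_neg {p : ℝ} (hp : p < 0) :
    Tendsto (fun n : ℕ => ((n : ℝ) + 1) ^ p) atTop (𝓝 0) := by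
  have := (tendsto_rpow_neg_atTop (y := -p) (by linarith)).comp
    (tendsto_natCast_atTop_atTop.atTop_add (tendsto_const_nhds (x := (1 : ℝ))) :
      Tendsto (fun n : ℕ => (n : ℝ) + 1) atTop atTop)
  simpa [Function.comp_def] using this

lemma tsum_uTerm_rec {a : ℂ} (ha : 0 < a.re) :
    8 * a * ∑' n, uTerm a n = 20 * a ^ 2 + 8 * a + 1
      - 1 / 4 * ((a + 1 / 2) / (a + 1)) ^ 5 * (8 * (a + 1) * ∑' n, uTerm (a + 1) n) := by
  have hs := summable_uTerm ha
  have hs' := summable_uTerm (a := a + 1) (by simp; linarith)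
  have hne := add_one_add_nat_ne_zero (ne_neg_of_re (a := a) (by linarith))
  have ha1 : a + 1 ≠ 0 := by simpa using hne 0
  -- The telescoping certificate: its value at $n=0$ supplies the inhomogeneous term of the
  -- recurrence, and the quadratic factor is beaten by the decay $n^{-2-2\operatorname{Re}a}$.
  set R : ℕ → ℂ := fun n => rise (1 / 2) n ^ 4 / rise (a + 1) n ^ 4 *
    -(20 * a ^ 2 + 8 * a + 1 + 24 * n * a + 8 * n ^ 2 + 4 * n) with hR
  have hR0 : Tendsto R atTop (𝓝 0) := by
    obtain ⟨C, hC, h⟩ := exists_norm_rise_one_half_le ha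
    refine squeeze_zero_norm (a := fun n : ℕ => C ^ 4 * (20 * ‖a‖ ^ 2 + 8 * ‖a‖ + 1 + 24 * ‖a‖ + 12)
      * ((n : ℝ) + 1) ^ (-(2 * a.re))) (fun n => ?_) ?_
    · simp only [hR, norm_mul, norm_neg]
      have e : ((n : ℝ) + 1) ^ (-(2 * a.re))
          = ((n : ℝ) + 1) ^ (-(4 * (1 / 2 + a.re / 2))) * (n + 1) ^ 2 := by
        rw [← Real.rpow_natCast, ← Real.rpow_add (by positivity)]
        congr 1; push_cast; ring
      have hb : ‖20 * a ^ 2 + 8 * a + 1 + 24 * n * a + 8 * n ^ 2 + 4 * n‖ ≤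
          (20 * ‖a‖ ^ 2 + 8 * ‖a‖ + 1 + 24 * ‖a‖ + 12) * ((n : ℝ) + 1) ^ 2 := by
        have : ‖20 * a ^ 2 + 8 * a + 1 + 24 * n * a + 8 * n ^ 2 + 4 * n‖ ≤
            20 * ‖a‖ ^ 2 + 8 * ‖a‖ + 1 + 24 * n * ‖a‖ + 8 * n ^ 2 + 4 * n := by
          refine (norm_add_le_of_le (norm_add_le_of_le (norm_add_le_of_le
            (norm_add_le_of_le (norm_add_le_of_le le_rfl le_rfl) le_rfl) le_rfl) le_rfl)
            le_rfl).trans ?_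
          simp
        refine this.trans ?_
        have h1 : (0 : ℝ) ≤ n := n.cast_nonneg
        have h2 := norm_nonneg a
        have h3 : (1 : ℝ) ≤ ((n : ℝ) + 1) ^ 2 := by nlinarith
        have h4 : (n : ℝ) ≤ ((n : ℝ) + 1) ^ 2 := by nlinarith
        have h5 : (n : ℝ) ^ 2 ≤ ((n : ℝ) + 1) ^ 2 := by nlinarith
        linarith [mul_nonneg h2 (sub_nonneg.2 h3), mul_nonneg (sq_nonneg ‖a‖) (sub_nonneg.2 h3),
          mul_nonneg h2 (sub_nonneg.2 h4)]
      rw [e]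
      calc _ ≤ C ^ 4 * ((n : ℝ) + 1) ^ (-(4 * (1 / 2 + a.re / 2))) *
            ((20 * ‖a‖ ^ 2 + 8 * ‖a‖ + 1 + 24 * ‖a‖ + 12) * ((n : ℝ) + 1) ^ 2) := by
            gcongr
            exact norm_half_div_rise_pow_le hC h n
        _ = _ := by ring
    · simpa using (tendsto_nat_add_one_rpow_neg (p := -(2 * a.re)) (by linarith)).const_mul
        (C ^ 4 * (20 * ‖a‖ ^ 2 + 8 * ‖a‖ + 1 + 24 * ‖a‖ + 12))
  have key := tsum_eq_of_telescoping (t := fun n => 8 * a * uTerm a n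
      + 1 / 4 * ((a + 1 / 2) / (a + 1)) ^ 5 * (8 * (a + 1) * uTerm (a + 1) n))
    ((hs.mul_left _).add ((hs'.mul_left _).mul_left _)) (fun n => ?_) hR0
  · rw [Summable.tsum_add (hs.mul_left _) ((hs'.mul_left _).mul_left _), tsum_mul_left,
      tsum_mul_left, tsum_mul_left] at key
    have : R 0 = -(20 * a ^ 2 + 8 * a + 1) := by simp [hR, rise_zero]
    rw [this] at key
    linear_combination key
  · have h1 := rise_ne_zero hne n
    have h2 := hne n
    simp only [hR, uTerm, rise_succ, rise_add_one ha1]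
    push_cast
    field_simp
    ring

lemma fSeries_eq_tsum_uTerm {a : ℂ} (ha : 0 < a.re) :
    fSeries a = 8 * a * ∑' n, uTerm a n := by
  rw [← sub_eq_zero]
  obtain ⟨C, hC, h⟩ := exists_norm_rise_one_half_le ha
  obtain ⟨K, hK, hf⟩ := exists_norm_fSeries_le
  set S := ∑' n : ℕ, ((n : ℝ) + 1) ^ (1 - 4 * (1 / 2 + a.re / 2))
  have hS : 0 ≤ S := by positivity
  have hN : ∀ N : ℕ, 0 < (a + N).re := fun N => by
    have : (0 : ℝ) ≤ N := N.cast_nonneg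
    simp; linarith
  obtain ⟨P, hP, hPN⟩ := exists_pow_le_mul_pow (3 + ‖a‖) (by positivity) 2 (r := 3) (by norm_num)
  refine eq_zero_of_fSeries_rec (d := fun z => fSeries z - 8 * z * ∑' n, uTerm z n)
    (C := (K + 16 * (C ^ 4 * S)) * P) (fun N => ?_) (Eventually.of_forall fun N => ?_)
  · rw [fSeries_rec (ne_neg_of_re (by linarith [hN N])), tsum_uTerm_rec (hN N)]
    ring
  · have hu : ‖∑' n, uTerm (a + N) n‖ ≤ C ^ 4 * (5 + 2 * ‖a + N‖) * S := by
      refine (tsum_of_norm_bounded ((summable_nat_add_one_rpow (by linarith)).mul_left _).hasSum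
        (norm_uTerm_le hC (τ := 1 / 2 + a.re / 2) fun n => (h n).trans ?_)).trans (le_of_eq ?_)
      · gcongr
        refine norm_rise_le_norm_rise (fun j => norm_add_nat_le_of_re (by simp) (by simp) ?_) n
        have := hN N
        have : (0 : ℝ) ≤ j := j.cast_nonneg
        simp at *; linarith
      · rw [tsum_mul_left]
    set X := (N : ℝ) + (3 + ‖a‖) with hX
    have hz : ‖a + N‖ ≤ N + ‖a‖ := by
      refine (norm_add_le _ _).trans ?_
      rw [Complex.norm_natCast, add_comm]
    have hX3 : 3 ≤ X := by have := norm_nonneg a; have : (0:ℝ) ≤ N := N.cast_nonneg; linarith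
    calc _ ≤ ‖fSeries (a + N)‖ + 8 * ‖a + N‖ * ‖∑' n, uTerm (a + N) n‖ := by
          refine (norm_sub_le _ _).trans ?_
          rw [norm_mul, norm_mul]; norm_num
      _ ≤ K * (1 + ‖a + N‖) ^ 2 + 8 * ‖a + N‖ * (C ^ 4 * (5 + 2 * ‖a + N‖) * S) := by
          gcongr
          exact hf _ (by linarith [hN N])
      _ ≤ K * X ^ 2 + 8 * X * (C ^ 4 * (2 * X) * S) := by
          gcongr <;> linarith
      _ = (K + 16 * (C ^ 4 * S)) * X ^ 2 := by ring
      _ ≤ _ := by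
          rw [mul_assoc _ P]
          gcongr
          exact hPN N

/-- At $a=\frac12$ the quotient $(\frac12)_n/(\frac32)_n$ collapses to $1/(2n+1)$, so the first
identity becomes $8\sum(2n+1)^{-3}$; the odd terms make up $\frac78\zeta(3)$. -/
lemma fSeries_half : fSeries (1 / 2) = 7 * riemannZeta 3 := by
  have hr : ∀ n : ℕ, rise (1 / 2) n / rise (1 / 2 + 1) n = 1 / (2 * n + 1) := fun n => by
    rw [rise_add_one (by norm_num)]
    have h1 : rise (1 / 2) n ≠ 0 := rise_ne_zero (fun j => by
      have : (1 / 2 : ℂ) + j = ((1 / 2 + j : ℝ) : ℂ) := by push_cast; ring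
      rw [this]; exact_mod_cast (by positivity : (1 / 2 + j : ℝ) ≠ 0)) n
    have h2 : (2 * (n : ℂ) + 1) ≠ 0 := by exact_mod_cast (by positivity : 2 * n + 1 ≠ 0)
    have h3 : (1 + (n : ℂ) * 2) ≠ 0 := by rwa [add_comm, mul_comm]
    have h4 : (1 / 2 : ℂ) + n = (2 * n + 1) / 2 := by ring
    rw [h4]
    field_simp
  have hu : ∀ n : ℕ, uTerm (1 / 2) n = 2 * (1 / ((2 * n + 1 : ℕ) : ℂ) ^ 3) := fun n => by
    rw [uTerm, ← div_pow, hr]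
    have h2 : (2 * (n : ℂ) + 1) ≠ 0 := by exact_mod_cast (by positivity : 2 * n + 1 ≠ 0)
    push_cast
    field_simp
    ring
  have hz : riemannZeta 3 = ∑' n : ℕ, 1 / (n : ℂ) ^ 3 := by
    exact_mod_cast zeta_nat_eq_tsum_of_gt_one (k := 3) (by norm_num)
  have hsum : Summable fun n : ℕ => 1 / (n : ℂ) ^ 3 := by
    have := (Real.summable_one_div_nat_pow (p := 3)).2 (by norm_num)
    simpa using (Complex.summable_ofReal (f := fun n : ℕ => 1 / (n : ℝ) ^ 3)).2 this
  have heo := tsum_even_add_odd (f := fun n : ℕ => 1 / (n : ℂ) ^ 3)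
    (hsum.comp_injective (fun x y h => by simpa using h))
    (hsum.comp_injective (fun x y h => by simpa using h))
  have he : ∀ n : ℕ, 1 / ((2 * n : ℕ) : ℂ) ^ 3 = 1 / 8 * (1 / (n : ℂ) ^ 3) := fun n => by
    push_cast; rw [mul_pow, one_div_mul_one_div]; norm_num
  rw [fSeries_eq_tsum_uTerm (by norm_num)]
  simp_rw [hu]
  simp_rw [he] at heo
  rw [tsum_mul_left, ← hz] at heo
  rw [tsum_mul_left]
  linear_combination 8 * heo

/-! ### Gamma function limits and the second identity -/

lemma rise_eq_prod (x : ℂ) (n : ℕ) : rise x n = ∏ j ∈ Finset.range n, (x + j) := by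
  induction n with
  | zero => simp [rise_zero]
  | succ n ih => rw [rise_succ, Finset.prod_range_succ, ih]

lemma inv_GammaSeq (x : ℂ) (n : ℕ) :
    (Complex.GammaSeq x n)⁻¹ = rise x (n + 1) / ((n : ℂ) ^ x * n.factorial) := by
  rw [Complex.GammaSeq, inv_div, rise_eq_prod]

lemma tendsto_rise_div {x : ℂ} (hx : ∀ j : ℕ, x + j ≠ 0) :
    Tendsto (fun n : ℕ => rise x (n + 1) / ((n : ℂ) ^ x * n.factorial)) atTop
      (𝓝 (Complex.Gamma x)⁻¹) := by
  simp_rw [← inv_GammaSeq]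
  exact (Complex.GammaSeq_tendsto_Gamma x).inv₀
    (Complex.Gamma_ne_zero fun m h => hx m (by rw [h]; ring))

lemma half_add_nat_ne_zero {a : ℂ} (ha : Complex.cos (Real.pi * a) ≠ 0) (j : ℕ) :
    a + 1 / 2 + j ≠ 0 := fun h => ha <| Complex.cos_eq_zero_iff.2 ⟨-(j + 1), by
  rw [show a = -1 / 2 - j by linear_combination h]; push_cast; ring⟩

lemma half_sub_add_nat_ne_zero {a : ℂ} (ha : Complex.cos (Real.pi * a) ≠ 0) (j : ℕ) :
    1 / 2 - a + j ≠ 0 := fun h => ha <| Complex.cos_eq_zero_iff.2 ⟨j, by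
  rw [show a = 1 / 2 + j by linear_combination -h]; push_cast; ring⟩

lemma three_half_sub_add_nat_ne_zero {a : ℂ} (ha : Complex.cos (Real.pi * a) ≠ 0) (j : ℕ) :
    3 / 2 - a + j ≠ 0 := fun h => half_sub_add_nat_ne_zero ha (j + 1) (by
  push_cast; linear_combination h)

lemma two_mul_sub_one_ne_zero {a : ℂ} (ha : Complex.cos (Real.pi * a) ≠ 0) : 2 * a - 1 ≠ 0 :=
  fun h => half_sub_add_nat_ne_zero ha 0 (by push_cast; linear_combination -h / 2)

lemma cos_pi_mul_add_one (a : ℂ) :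
    Complex.cos (Real.pi * (a + 1)) = -Complex.cos (Real.pi * a) := by
  rw [mul_add, mul_one, Complex.cos_add_pi]

lemma cos_pi_mul_add_nat_ne_zero {a : ℂ} (ha : Complex.cos (Real.pi * a) ≠ 0) (N : ℕ) :
    Complex.cos (Real.pi * (a + N)) ≠ 0 := by
  induction N with
  | zero => simpa using ha
  | succ N ih =>
    rw [Nat.cast_succ, ← add_assoc, cos_pi_mul_add_one]
    exact neg_ne_zero.2 ih

lemma ne_neg_add_nat {a : ℂ} (ha : ∀ m : ℕ, a ≠ -((m : ℂ) + 1)) (N m : ℕ) :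
    a + N ≠ -((m : ℂ) + 1) := fun h => ha (m + N) (by push_cast; linear_combination h)

lemma Gamma_one_half_sq : Complex.Gamma (1 / 2) ^ 2 = Real.pi := by
  have h := Complex.Gamma_one_half_eq
  rw [h, ← Complex.cpow_nat_mul]
  norm_num

lemma Gamma_half_add_mul_Gamma_half_sub (a : ℂ) :
    Complex.Gamma (a + 1 / 2) * Complex.Gamma (1 / 2 - a)
      = Real.pi / Complex.cos (Real.pi * a) := by
  have h := Complex.Gamma_mul_Gamma_one_sub (a + 1 / 2)
  rw [show 1 - (a + 1 / 2) = 1 / 2 - a by ring, mul_add,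
    show (Real.pi : ℂ) * (1 / 2) = Real.pi / 2 by ring, Complex.sin_add_pi_div_two] at h
  exact h

lemma gFactor_eq (a : ℂ) : gFactor a =
    2 / Complex.cos (Real.pi * a) * (Complex.Gamma (a + 1) / Complex.Gamma (a + 1 / 2)) ^ 2 := by
  have hpi : (Real.pi : ℂ) ≠ 0 := by exact_mod_cast Real.pi_ne_zero
  rw [gFactor, riseC, riseC, Complex.Gamma_one, add_comm 1 a, add_comm (1 / 2) a, ← div_pow,
    div_one, div_div_eq_mul_div, div_pow, mul_pow, Gamma_one_half_sq]
  field_simp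

lemma gFactor_add_one {a : ℂ} (ha : a + 1 ≠ 0) (hc : Complex.cos (Real.pi * a) ≠ 0) :
    gFactor (a + 1) = -((a + 1) / (a + 1 / 2)) ^ 2 * gFactor a := by
  have h1 : a + 1 / 2 ≠ 0 := by simpa using half_add_nat_ne_zero hc 0
  rw [gFactor_eq, gFactor_eq, cos_pi_mul_add_one, Complex.Gamma_add_one _ ha,
    show a + 1 + 1 / 2 = a + 1 / 2 + 1 by ring, Complex.Gamma_add_one _ h1, mul_div_mul_comm,
    mul_pow, div_neg]
  ring

/-- Euler's limit for each rising factorial gives decay of order $n^{-2}$ with a quotient of Gamma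
values as coefficient, and the reflection formula rewrites that quotient through `gFactor`. This is
how the factor of $g$ enters the second identity. -/
lemma tendsto_sq_mul_vTerm {a : ℂ} (ha : ∀ m : ℕ, a ≠ -((m : ℂ) + 1))
    (hc : Complex.cos (Real.pi * a) ≠ 0) :
    Tendsto (fun n : ℕ => (n : ℂ) ^ 2 * vTerm a (n + 1)) atTop
      (𝓝 ((1 / 2 - a) / 2 * gFactor a)) := by
  have h0 : ∀ j : ℕ, (1 / 2 : ℂ) + j ≠ 0 := fun j => by
    have : (1 / 2 : ℂ) + j = ((1 / 2 + j : ℝ) : ℂ) := by push_cast; ring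
    rw [this]; exact_mod_cast (by positivity : (1 / 2 + j : ℝ) ≠ 0)
  have hG : ∀ {x : ℂ}, (∀ j : ℕ, x + j ≠ 0) → Complex.Gamma x ≠ 0 := fun {x} hx =>
    Complex.Gamma_ne_zero fun m h => hx m (by rw [h]; ring)
  have t1 := tendsto_rise_div h0
  have t2 := tendsto_rise_div (half_add_nat_ne_zero hc)
  have t3 := tendsto_rise_div (add_one_add_nat_ne_zero ha)
  have t4 := tendsto_rise_div (three_half_sub_add_nat_ne_zero hc)
  have t := ((t1.pow 2).mul t2).div ((t3.pow 2).mul t4) (mul_ne_zero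
    (pow_ne_zero _ (inv_ne_zero (hG (add_one_add_nat_ne_zero ha))))
    (inv_ne_zero (hG (three_half_sub_add_nat_ne_zero hc))))
  have hpi : (Real.pi : ℂ) ≠ 0 := by exact_mod_cast Real.pi_ne_zero
  have e : (1 / 2 - a) / 2 * gFactor a = (Complex.Gamma (1 / 2))⁻¹ ^ 2 *
      (Complex.Gamma (a + 1 / 2))⁻¹ / ((Complex.Gamma (a + 1))⁻¹ ^ 2 *
        (Complex.Gamma (3 / 2 - a))⁻¹) := by
    have g1 : 1 / 2 - a ≠ 0 := by simpa using half_sub_add_nat_ne_zero hc 0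
    have g2 := hG (half_add_nat_ne_zero hc)
    have g3 := Gamma_half_add_mul_Gamma_half_sub a
    have g4 := hG (add_one_add_nat_ne_zero ha)
    have g5 := hG (half_sub_add_nat_ne_zero hc)
    have g6 : Complex.Gamma (1 / 2 - a) =
        Real.pi / Complex.cos (Real.pi * a) / Complex.Gamma (a + 1 / 2) := by
      exact eq_div_of_mul_eq g2 (by rw [mul_comm]; exact g3)
    rw [show (3 / 2 : ℂ) - a = 1 / 2 - a + 1 by ring, Complex.Gamma_add_one _ g1, gFactor_eq,
      inv_pow, Gamma_one_half_sq, g6]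
    field_simp
  rw [e]
  refine t.congr' ?_
  filter_upwards [eventually_ge_atTop 1] with n hn
  have hn0 : (n : ℂ) ≠ 0 := by exact_mod_cast (by omega : n ≠ 0)
  have hp : ∀ x : ℂ, (n : ℂ) ^ x ≠ 0 := fun x => by simp [Complex.cpow_eq_zero_iff, hn0]
  have hf : (n.factorial : ℂ) ≠ 0 := by exact_mod_cast n.factorial_ne_zero
  have r1 := rise_ne_zero (add_one_add_nat_ne_zero ha) (n + 1)
  have r2 := rise_ne_zero (three_half_sub_add_nat_ne_zero hc) (n + 1)
  have key : ((n : ℂ) ^ (a + 1)) ^ 2 * (n : ℂ) ^ (3 / 2 - a)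
      = (n : ℂ) ^ 2 * (((n : ℂ) ^ (1 / 2 : ℂ)) ^ 2 * (n : ℂ) ^ (a + 1 / 2)) := by
    rw [← Complex.cpow_nat_mul, ← Complex.cpow_nat_mul, ← Complex.cpow_natCast (n : ℂ) 2,
      ← Complex.cpow_add _ _ hn0, ← Complex.cpow_add _ _ hn0, ← Complex.cpow_add _ _ hn0]
    congr 1; push_cast; ring
  simp only [Pi.div_apply, vTerm]
  have p1 := hp (1 / 2)
  have p2 := hp (a + 1 / 2)
  have p3 := hp (a + 1)
  have p4 := hp (3 / 2 - a)
  generalize (n : ℂ) ^ (1 / 2 : ℂ) = q1 at *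
  generalize (n : ℂ) ^ (a + 1 / 2) = q2 at *
  generalize (n : ℂ) ^ (a + 1) = q3 at *
  generalize (n : ℂ) ^ (3 / 2 - a) = q4 at *
  generalize rise (1 / 2) (n + 1) = s1
  generalize rise (a + 1 / 2) (n + 1) = s2
  generalize rise (a + 1) (n + 1) = s3 at *
  generalize rise (3 / 2 - a) (n + 1) = s4 at *
  field_simp
  linear_combination s1 ^ 2 * s2 * key

lemma summable_vTerm {a : ℂ} (ha : ∀ m : ℕ, a ≠ -((m : ℂ) + 1))
    (hc : Complex.cos (Real.pi * a) ≠ 0) : Summable (vTerm a) := by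
  rw [← summable_nat_add_iff 1]
  have h : (fun n : ℕ => vTerm a (n + 1)) =O[atTop] fun n : ℕ => ((n : ℝ) ^ 2)⁻¹ := by
    have h1 := (tendsto_sq_mul_vTerm ha hc).isBigO_one ℝ
    have h2 : (fun n : ℕ => ((n : ℂ) ^ 2)⁻¹) =O[atTop] fun n : ℕ => ((n : ℝ) ^ 2)⁻¹ :=
      .of_norm_le fun n => by simp
    refine ((h2.mul h1).congr' ?_ (Eventually.of_forall fun n => mul_one _))
    filter_upwards [eventually_ge_atTop 1] with n hn
    have hn0 : (n : ℂ) ≠ 0 := by exact_mod_cast (by omega : n ≠ 0)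
    field_simp
  exact summable_of_isBigO_nat (Real.summable_nat_pow_inv.2 (by norm_num)) h

lemma tsum_vTerm_rec {a : ℂ} (ha : ∀ m : ℕ, a ≠ -((m : ℂ) + 1))
    (hc : Complex.cos (Real.pi * a) ≠ 0) :
    32 * a ^ 3 / (2 * a - 1) * ∑' n, vTerm a n = 20 * a ^ 2 + 8 * a + 1
      - (6 * a + 1) * gFactor a - 1 / 4 * ((a + 1 / 2) / (a + 1)) ^ 5 *
        (32 * (a + 1) ^ 3 / (2 * (a + 1) - 1) * ∑' n, vTerm (a + 1) n) := by
  have hc' : Complex.cos (Real.pi * (a + 1)) ≠ 0 := by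
    simpa using cos_pi_mul_add_nat_ne_zero hc 1
  have hs := summable_vTerm ha hc
  have hs' := summable_vTerm (ne_neg_add_one ha) hc'
  have hne := add_one_add_nat_ne_zero ha
  have ha1 : a + 1 ≠ 0 := by simpa using hne 0
  have h21 := two_mul_sub_one_ne_zero hc
  have hh : a + 1 / 2 ≠ 0 := by simpa using half_add_nat_ne_zero hc 0
  have hm : 1 / 2 - a ≠ 0 := by simpa using half_sub_add_nat_ne_zero hc 0
  have hm' : 1 - 2 * a ≠ 0 := fun h => h21 (by linear_combination -h)
  have h2a : 2 * a + 1 ≠ 0 := fun h => hh (by linear_combination h / 2)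
  -- This certificate is of order $n^2$ times a term of order $n^{-2}$, so it contributes at
  -- infinity as well as at $n=0$.
  set R : ℕ → ℂ := fun n => vTerm a n * (n + 1 / 2 - a) *
    ((4 * (6 * a + 1) * n + 2 * (20 * a ^ 2 + 8 * a + 1)) / (2 * a - 1)) with hR
  have hRl : Tendsto R atTop (𝓝 (-(6 * a + 1) * gFactor a)) := by
    rw [← tendsto_add_atTop_iff_nat 1]
    have hi : Tendsto (fun n : ℕ => ((n : ℂ))⁻¹) atTop (𝓝 0) := tendsto_inv_atTop_nhds_zero_nat
    have h1 : Tendsto (fun n : ℕ => (1 + (3 / 2 - a) * (n : ℂ)⁻¹) *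
        ((4 * (6 * a + 1) + (4 * (6 * a + 1) + 2 * (20 * a ^ 2 + 8 * a + 1)) * (n : ℂ)⁻¹)
          / (2 * a - 1))) atTop
        (𝓝 ((1 + (3 / 2 - a) * 0) *
        ((4 * (6 * a + 1) + (4 * (6 * a + 1) + 2 * (20 * a ^ 2 + 8 * a + 1)) * 0)
          / (2 * a - 1)))) :=
      ((hi.const_mul _).const_add _).mul (((hi.const_mul _).const_add _).div_const _)
    have h2 := (tendsto_sq_mul_vTerm ha hc).mul h1
    have e : (1 / 2 - a) / 2 * gFactor a * ((1 + (3 / 2 - a) * 0) *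
        ((4 * (6 * a + 1) + (4 * (6 * a + 1) + 2 * (20 * a ^ 2 + 8 * a + 1)) * 0)
          / (2 * a - 1))) = -(6 * a + 1) * gFactor a := by
      field_simp
      ring
    rw [e] at h2
    refine h2.congr' ?_
    filter_upwards [eventually_ge_atTop 1] with n hn
    have hn0 : (n : ℂ) ≠ 0 := by exact_mod_cast (by omega : n ≠ 0)
    simp only [hR]
    push_cast
    field_simp
    ring
  have key := tsum_eq_of_telescoping (t := fun n => 32 * a ^ 3 / (2 * a - 1) * vTerm a n
      + 1 / 4 * ((a + 1 / 2) / (a + 1)) ^ 5 *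
        (32 * (a + 1) ^ 3 / (2 * (a + 1) - 1) * vTerm (a + 1) n))
    ((hs.mul_left _).add ((hs'.mul_left _).mul_left _)) (fun n => ?_) hRl
  · rw [Summable.tsum_add (hs.mul_left _) ((hs'.mul_left _).mul_left _), tsum_mul_left,
      tsum_mul_left, tsum_mul_left] at key
    have : R 0 = -(20 * a ^ 2 + 8 * a + 1) := by
      simp only [hR, vTerm, rise_zero]
      field_simp
      push_cast
      ring
    rw [this] at key
    linear_combination key
  · have r1 := rise_ne_zero hne n
    have r2 := hne n
    have r3 := rise_ne_zero (three_half_sub_add_nat_ne_zero hc) n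
    have r4 := three_half_sub_add_nat_ne_zero hc n
    have r5 := half_sub_add_nat_ne_zero hc n
    have e1 : rise (a + 1 + 1 / 2) n = rise (a + 1 / 2) n * (a + 1 / 2 + n) / (a + 1 / 2) := by
      rw [show a + 1 + 1 / 2 = a + 1 / 2 + 1 by ring, rise_add_one hh]
    have e2 : rise (3 / 2 - (a + 1)) n = rise (3 / 2 - a) n * (1 / 2 - a) / (1 / 2 - a + n) := by
      have := rise_add_one hm n
      rw [show (1 / 2 : ℂ) - a + 1 = 3 / 2 - a by ring] at this
      rw [this, show (3 / 2 : ℂ) - (a + 1) = 1 / 2 - a by ring, div_mul_cancel₀ _ hm,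
        mul_div_cancel_right₀ _ r5]
    simp only [hR, vTerm, rise_succ, rise_add_one ha1, e1, e2]
    have r6 : 3 - a * 2 + 2 * n ≠ 0 := fun h => r4 (by linear_combination h / 2)
    have r7 : 1 - a * 2 + 2 * n ≠ 0 := fun h => r5 (by linear_combination h / 2)
    have r8 : 1 - a * 2 ≠ 0 := fun h => hm (by linear_combination h / 2)
    have r9 : a * 2 + 1 ≠ 0 := fun h => hh (by linear_combination h / 2)
    generalize rise (1 / 2) n = s1
    generalize rise (a + 1 / 2) n = s2
    have e7 : 2 * (a + 1) - 1 = a * 2 + 1 := by ring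
    have e8 : 2 * a - 1 = -(1 - a * 2) := by ring
    rw [e7, e8]
    generalize rise (a + 1) n = s3 at *
    generalize rise (3 / 2 - a) n = s4 at *
    push_cast
    field_simp
    ring

/-- A sequence that first decreases and then increases never exceeds the larger of its initial value
and its limit; `Q` marks the indices from which it increases. -/
lemma le_max_of_antitone_then_monotone {P : ℕ → ℝ} {Q : ℕ → Prop} {l : ℝ} (h0 : P 0 ≤ 1)
    (hQ : ∀ m n, m ≤ n → Q m → Q n) (h1 : ∀ n, Q n → P n ≤ P (n + 1))
    (h2 : ∀ n, ¬ Q n → P (n + 1) ≤ P n) (hl : Tendsto P atTop (𝓝 l)) (n : ℕ) :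
    P n ≤ max 1 l := by
  by_cases hn : Q n
  · refine le_trans (ge_of_tendsto hl ?_) (le_max_right _ _)
    filter_upwards [eventually_ge_atTop n] with m hm
    induction m, hm using Nat.le_induction with
    | base => exact le_rfl
    | succ m hm ih => exact ih.trans (h1 m (hQ n m hm hn))
  · refine le_trans ?_ (le_max_left _ _)
    have : ∀ m ≤ n, P m ≤ 1 := by
      intro m
      induction m with
      | zero => exact fun _ => h0
      | succ m ih => exact fun hm => (h2 m fun h => hn (hQ m n (by omega) h)).trans (ih (by omega))
    exact this n le_rfl

lemma exists_eventually_le_geometric {e : ℕ → ℝ} {r : ℝ} (hr : 0 < r)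
    (h : ∀ᶠ N in atTop, e (N + 1) ≤ r * e N) : ∃ C ≥ 0, ∀ᶠ N in atTop, e N ≤ C * r ^ N := by
  obtain ⟨N₀, hN₀⟩ := eventually_atTop.1 h
  refine ⟨|e N₀| / r ^ N₀, by positivity, ?_⟩
  filter_upwards [eventually_ge_atTop N₀] with N hN
  induction N, hN using Nat.le_induction with
  | base => rw [div_mul_cancel₀ _ (by positivity)]; exact le_abs_self _
  | succ N hN ih =>
    refine (hN₀ N hN).trans ((mul_le_mul_of_nonneg_left ih hr.le).trans (le_of_eq ?_))
    rw [pow_succ]; ring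

lemma tendsto_norm_add_nat (a : ℂ) : Tendsto (fun N : ℕ => ‖a + N‖) atTop atTop := by
  refine tendsto_atTop_mono (fun N => ?_)
    (tendsto_atTop_add_const_right atTop (-‖a‖) tendsto_natCast_atTop_atTop)
  have := norm_sub_le (a + N) a
  rw [add_sub_cancel_left, Complex.norm_natCast] at this
  linarith

lemma five_quarters_add_nat_ne_zero (j : ℕ) : (5 / 4 : ℂ) + j ≠ 0 := by
  have : (5 / 4 : ℂ) + j = ((5 / 4 + j : ℝ) : ℂ) := by push_cast; ring
  rw [this]; exact_mod_cast (by positivity : (5 / 4 + j : ℝ) ≠ 0)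

/-- The numbers $A+1+n$ and $\frac32-A+n$ have mean $c=\frac54+n$ and product $c^2-W$ with
$W=(A-\frac14)^2$. Consecutive quotients $|c^2|/|c^2-W|$ are at least 1 iff
$|W|^2\le2c^2\operatorname{Re}W$, a condition that persists as $c$ grows because
$\operatorname{Re}W\ge0$. So the sequence decreases and then increases, and its limit is a Gamma
quotient. Unlike `exists_norm_rise_le`, this does not confine $A$ to a bounded set. -/
lemma norm_wellPoised_le {A : ℂ} (hA : ∀ m : ℕ, A ≠ -((m : ℂ) + 1))
    (hc : Complex.cos (Real.pi * A) ≠ 0) (hB : 0 ≤ ((A - 1 / 4) ^ 2).re) (n : ℕ) :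
    ‖rise (5 / 4) n ^ 2 / (rise (A + 1) n * rise (3 / 2 - A) n)‖ ≤
      max 1 ‖Complex.Gamma (A + 1) * Complex.Gamma (3 / 2 - A) / Complex.Gamma (5 / 4) ^ 2‖ := by
  set W := (A - 1 / 4) ^ 2 with hW
  have hG : ∀ {x : ℂ}, (∀ j : ℕ, x + j ≠ 0) → Complex.Gamma x ≠ 0 := fun {x} hx =>
    Complex.Gamma_ne_zero fun m h => hx m (by rw [h]; ring)
  set P : ℕ → ℝ := fun n => ‖rise (5 / 4) n ^ 2 / (rise (A + 1) n * rise (3 / 2 - A) n)‖ with hP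
  have hP1 : ∀ n, P (n + 1) = P n * (‖((5 / 4 + n : ℝ) : ℂ) ^ 2‖ / ‖((5 / 4 + n : ℝ) : ℂ) ^ 2 - W‖) :=
      fun n => by
    simp only [hP]
    rw [← norm_div, ← norm_mul]
    congr 1
    have r1 := add_one_add_nat_ne_zero hA n
    have r2 := three_half_sub_add_nat_ne_zero hc n
    have e : ((5 / 4 + n : ℝ) : ℂ) ^ 2 - W = (A + 1 + n) * (3 / 2 - A + n) := by
      rw [hW]; push_cast; ring
    rw [e]
    simp only [rise_succ]
    push_cast
    rw [div_mul_div_comm]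
    congr 1 <;> ring
  have hn2 : ∀ n : ℕ, ‖((5 / 4 + n : ℝ) : ℂ) ^ 2 - W‖ ^ 2
      = ‖((5 / 4 + n : ℝ) : ℂ) ^ 2‖ ^ 2 + (‖W‖ ^ 2 - 2 * (5 / 4 + n) ^ 2 * W.re) := fun n => by
    rw [← Complex.ofReal_pow]
    rw [Complex.sq_norm, Complex.sq_norm, Complex.sq_norm, Complex.normSq_apply,
      Complex.normSq_apply, Complex.normSq_apply, Complex.sub_re, Complex.sub_im,
      Complex.ofReal_re, Complex.ofReal_im]
    ring
  have hpos : ∀ n : ℕ, 0 < ‖((5 / 4 + n : ℝ) : ℂ) ^ 2 - W‖ := fun n => by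
    have e : ((5 / 4 + n : ℝ) : ℂ) ^ 2 - W = (A + 1 + n) * (3 / 2 - A + n) := by
      rw [hW]; push_cast; ring
    rw [e]
    exact norm_pos_iff.2 (mul_ne_zero (add_one_add_nat_ne_zero hA n)
      (three_half_sub_add_nat_ne_zero hc n))
  refine le_max_of_antitone_then_monotone (P := P)
    (Q := fun n : ℕ => ‖W‖ ^ 2 ≤ 2 * (5 / 4 + n) ^ 2 * W.re) ?_ ?_ ?_ ?_ ?_ n
  · simp [hP, rise_zero]
  · intro m n hmn h
    refine h.trans ?_
    gcongr
  · intro n h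
    rw [hP1]
    refine le_mul_of_one_le_right (norm_nonneg _) ((one_le_div (hpos n)).2 ?_)
    refine (pow_le_pow_iff_left₀ (norm_nonneg _) (norm_nonneg _) two_ne_zero).1 ?_
    rw [hn2]; linarith
  · intro n h
    rw [hP1]
    refine mul_le_of_le_one_right (norm_nonneg _) ((div_le_one (hpos n)).2 ?_)
    refine (pow_le_pow_iff_left₀ (norm_nonneg _) (norm_nonneg _) two_ne_zero).1 ?_
    rw [hn2]; linarith
  · rw [← tendsto_add_atTop_iff_nat 1]
    have t0 := tendsto_rise_div five_quarters_add_nat_ne_zero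
    have t1 := tendsto_rise_div (add_one_add_nat_ne_zero hA)
    have t2 := tendsto_rise_div (three_half_sub_add_nat_ne_zero hc)
    have g1 := hG (add_one_add_nat_ne_zero hA)
    have g2 := hG (three_half_sub_add_nat_ne_zero hc)
    have t := ((t0.pow 2).div (t1.mul t2) (mul_ne_zero (inv_ne_zero g1) (inv_ne_zero g2))).norm
    rw [show (Complex.Gamma (5 / 4))⁻¹ ^ 2 / ((Complex.Gamma (A + 1))⁻¹ *
      (Complex.Gamma (3 / 2 - A))⁻¹) = Complex.Gamma (A + 1) * Complex.Gamma (3 / 2 - A) /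
        Complex.Gamma (5 / 4) ^ 2 by rw [← mul_inv, inv_pow, div_inv_eq_mul]; ring] at t
    refine t.congr' ?_
    filter_upwards [eventually_ge_atTop 1] with n hn
    have hn0 : (n : ℂ) ≠ 0 := by exact_mod_cast (by omega : n ≠ 0)
    have hp : ∀ x : ℂ, (n : ℂ) ^ x ≠ 0 := fun x => by simp [Complex.cpow_eq_zero_iff, hn0]
    have hf : (n.factorial : ℂ) ≠ 0 := by exact_mod_cast n.factorial_ne_zero
    have key : (n : ℂ) ^ (A + 1) * (n : ℂ) ^ (3 / 2 - A) = ((n : ℂ) ^ (5 / 4 : ℂ)) ^ 2 := by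
      rw [← Complex.cpow_nat_mul, ← Complex.cpow_add _ _ hn0]
      congr 1; push_cast; ring
    have p0 := hp (5 / 4)
    simp only [hP, Pi.div_apply]
    rw [div_pow, div_mul_div_comm, mul_pow, mul_mul_mul_comm ((n : ℂ) ^ (A + 1)), key]
    congr 1
    field_simp

lemma exists_norm_tsum_vTerm_le : ∃ S ≥ 0, ∀ A : ℂ, (∀ m : ℕ, A ≠ -((m : ℂ) + 1)) →
    Complex.cos (Real.pi * A) ≠ 0 → 0 ≤ ((A - 1 / 4) ^ 2).re → -(3 / 4) ≤ A.re →
    ‖∑' n, vTerm A n‖ ≤ S * max 1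
      ‖Complex.Gamma (A + 1) * Complex.Gamma (3 / 2 - A) / Complex.Gamma (5 / 4) ^ 2‖ := by
  -- The gap is $\frac54-\frac12=\frac34$; the exponent $\frac7{10}$ lies below it and its double
  -- exceeds 1, so the squares are summable.
  obtain ⟨C, hC, H⟩ := exists_norm_rise_le 2 1 (3 / 4) (7 / 10) one_pos (by norm_num)
  have hH : ∀ n, ‖rise (1 / 2) n / rise (5 / 4) n‖ ≤ C * ((n : ℝ) + 1) ^ (-(7 / 10 : ℝ)) := fun n => by
    rw [norm_div]
    refine div_le_of_le_mul₀ (norm_nonneg _) (by positivity) (H _ _ (by norm_num) (by norm_num)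
      (by norm_num) (fun j => ?_) n)
    have : (5 / 4 : ℂ) + j = ((5 / 4 + j : ℝ) : ℂ) := by push_cast; ring
    rw [this, Complex.norm_real, Real.norm_eq_abs, abs_of_nonneg (by positivity)]
    have : (0 : ℝ) ≤ j := j.cast_nonneg
    linarith
  refine ⟨C ^ 2 * ∑' n : ℕ, ((n : ℝ) + 1) ^ (-(7 / 5 : ℝ)), by positivity,
    fun A hA hc hB hre => ?_⟩
  set M := max 1
      ‖Complex.Gamma (A + 1) * Complex.Gamma (3 / 2 - A) / Complex.Gamma (5 / 4) ^ 2‖ with hM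
  refine (tsum_of_norm_bounded
    ((summable_nat_add_one_rpow (p := -(7 / 5)) (by norm_num)).mul_left (C ^ 2 * M)).hasSum
    fun n => ?_).trans (le_of_eq ?_)
  · have e : vTerm A n = (rise (1 / 2) n / rise (5 / 4) n) ^ 2 *
        (rise (5 / 4) n ^ 2 / (rise (A + 1) n * rise (3 / 2 - A) n)) *
        (rise (A + 1 / 2) n / rise (A + 1) n) := by
      have := rise_ne_zero five_quarters_add_nat_ne_zero n
      have := rise_ne_zero (add_one_add_nat_ne_zero hA) n
      have := rise_ne_zero (three_half_sub_add_nat_ne_zero hc) n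
      rw [vTerm]
      generalize rise (5 / 4) n = s0 at *
      generalize rise (1 / 2) n = s1 at *
      generalize rise (A + 1 / 2) n = s2 at *
      generalize rise (A + 1) n = s3 at *
      generalize rise (3 / 2 - A) n = s4 at *
      field_simp
    have h1 : ‖rise (A + 1 / 2) n / rise (A + 1) n‖ ≤ 1 := by
      rw [norm_div]
      exact div_le_of_le_mul₀ (norm_nonneg _) zero_le_one (norm_rise_half_le hre n)
    have h2 : ((n : ℝ) + 1) ^ (-(7 / 5 : ℝ)) = (((n : ℝ) + 1) ^ (-(7 / 10 : ℝ))) ^ 2 := by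
      rw [← Real.rpow_natCast, ← Real.rpow_mul (by positivity)]; norm_num
    rw [e, norm_mul, norm_mul, norm_pow, h2]
    calc _ ≤ (C * ((n : ℝ) + 1) ^ (-(7 / 10 : ℝ))) ^ 2 * M * 1 := by
          gcongr
          · exact hH n
          · exact norm_wellPoised_le hA hc hB n
      _ = _ := by ring
  · rw [tsum_mul_left]; ring

/-- Along $a+N$ the Gamma quotient bounding the series of `vTerm` and the factor `gFactor` both have
consecutive ratios tending to 1 in norm, so they are $O((3/2)^N)$. The remaining factors are
polynomial of degree at most 3, hence $O(2^N)$. Together this gives the admissible growth $3^N$. -/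
lemma fSeries_eq_gSeries_add {a : ℂ} (ha : ∀ m : ℕ, a ≠ -((m : ℂ) + 1))
    (hc : Complex.cos (Real.pi * a) ≠ 0) :
    fSeries a = gFactor a * gSeries a + 32 * a ^ 3 / (2 * a - 1) * ∑' n, vTerm a n := by
  rw [← sub_eq_zero]
  set Λ : ℂ → ℂ := fun A =>
    Complex.Gamma (A + 1) * Complex.Gamma (3 / 2 - A) / Complex.Gamma (5 / 4) ^ 2 with hΛ
  obtain ⟨K, hK, hf⟩ := exists_norm_fSeries_le
  obtain ⟨S, hS, hv⟩ := exists_norm_tsum_vTerm_le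
  set K' := 7 * ∑' n : ℕ, ((n : ℝ) + 1) ^ 2 * (1 / 4 : ℝ) ^ n with hK'
  have hK'0 : 0 ≤ K' := by positivity
  have hg : ∀ A : ℂ, -(3 / 4) ≤ A.re → ‖gSeries A‖ ≤ K' * (1 + ‖A‖) := fun A hA => by
    have := norm_gSeries_le zero_le_one (norm_rise_half_le hA)
    simpa [hK'] using this
  obtain ⟨P, hP, hPN⟩ := exists_pow_le_mul_pow (3 + ‖a‖) (by positivity) 3 (r := 2) (by norm_num)
  have hlarge : ∀ (c : ℂ) (K : ℝ), ∀ᶠ N : ℕ in atTop, K ≤ ‖a + c + N‖ := fun c K =>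
    (tendsto_norm_add_nat (a + c)).eventually_ge_atTop K
  obtain ⟨C₁, hC₁, h₁⟩ := exists_eventually_le_geometric (e := fun N : ℕ => ‖Λ (a + N)‖)
    (r := 3 / 2) (by norm_num) (by
      filter_upwards [hlarge (-1 / 2) 3] with N hN
      have q1 : a + N + 1 ≠ 0 := by
        have := add_one_add_nat_ne_zero ha N
        rwa [add_right_comm]
      have q2 : 1 / 2 - (a + N) ≠ 0 := by
        simpa using half_sub_add_nat_ne_zero (cos_pi_mul_add_nat_ne_zero hc N) 0
      have e : Λ (a + (N + 1 : ℕ)) = (a + N + 1) / (1 / 2 - (a + N)) * Λ (a + N) := by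
        simp only [hΛ]
        rw [show (3 / 2 : ℂ) - (a + N) = 1 / 2 - (a + N) + 1 by ring, Complex.Gamma_add_one _ q2,
          show (3 / 2 : ℂ) - (a + (N + 1 : ℕ)) = 1 / 2 - (a + N) by push_cast; ring,
          show a + ((N + 1 : ℕ) : ℂ) + 1 = a + N + 1 + 1 by push_cast; ring,
          Complex.Gamma_add_one _ q1]
        generalize 1 / 2 - (a + (N : ℂ)) = x at *
        field_simp
      rw [e, norm_mul]
      gcongr
      have q3 : ‖1 / 2 - (a + N)‖ = ‖a + -1 / 2 + N‖ := by
        rw [← norm_neg]; congr 1; ring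
      rw [norm_div, div_le_iff₀ (norm_pos_iff.2 q2), q3]
      have := norm_add_le (a + -1 / 2 + N) (3 / 2)
      rw [show a + -1 / 2 + N + 3 / 2 = a + N + 1 by ring] at this
      norm_num at this hN ⊢
      linarith)
  obtain ⟨C₂, hC₂, h₂⟩ := exists_eventually_le_geometric (e := fun N : ℕ => ‖gFactor (a + N)‖)
    (r := 3 / 2) (by norm_num) (by
      filter_upwards [hlarge (1 / 2) 3] with N hN
      have q1 : a + N + 1 ≠ 0 := by
        have := add_one_add_nat_ne_zero ha N
        rwa [add_right_comm]
      have q2 : a + N + 1 / 2 ≠ 0 := by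
        simpa using half_add_nat_ne_zero (cos_pi_mul_add_nat_ne_zero hc N) 0
      rw [Nat.cast_succ, ← add_assoc, gFactor_add_one q1 (cos_pi_mul_add_nat_ne_zero hc N),
        norm_mul, norm_neg, norm_pow]
      gcongr
      have : ‖(a + N + 1) / (a + N + 1 / 2)‖ ≤ 6 / 5 := by
        rw [norm_div, div_le_iff₀ (norm_pos_iff.2 q2)]
        have := norm_add_le (a + N + 1 / 2) (1 / 2)
        rw [show a + N + 1 / 2 + 1 / 2 = a + N + 1 by ring] at this
        rw [add_right_comm] at hN
        norm_num at this hN ⊢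
        linarith
      calc _ ≤ (6 / 5 : ℝ) ^ 2 := by gcongr
        _ ≤ _ := by norm_num)
  refine eq_zero_of_fSeries_rec
    (d := fun z => fSeries z - (gFactor z * gSeries z + 32 * z ^ 3 / (2 * z - 1) * ∑' n, vTerm z n))
    (C := (K + K' * C₂ + 32 * S * (1 + C₁)) * P) (fun N => ?_) ?_
  · have hN := ne_neg_add_nat ha N
    have hcN := cos_pi_mul_add_nat_ne_zero hc N
    have q1 : a + N + 1 ≠ 0 := by simpa using add_one_add_nat_ne_zero hN 0
    have q2 : a + N + 1 / 2 ≠ 0 := by simpa using half_add_nat_ne_zero hcN 0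
    -- The shift of `gFactor` removes two of the five powers and flips the sign, which turns the
    -- recurrence of $f$ into that of $g$.
    have e : ((a + N + 1 / 2) / (a + N + 1)) ^ 5 * gFactor (a + N + 1) =
        -((a + N + 1 / 2) / (a + N + 1)) ^ 3 * gFactor (a + N) := by
      rw [gFactor_add_one q1 hcN]
      generalize a + N + 1 / 2 = x at *
      generalize a + N + 1 = y at *
      field_simp
    rw [fSeries_rec hN, tsum_vTerm_rec hN hcN, gSeries_rec hN]
    linear_combination -1 / 4 * gSeries (a + N + 1) * e
  · have hre : Tendsto (fun N : ℕ => (N : ℝ)) atTop atTop := tendsto_natCast_atTop_atTop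
    filter_upwards [h₁, h₂, hlarge (-1 / 2) 1, hre.eventually_ge_atTop (1 / 4 + |a.im| - a.re)]
      with N e₁ e₂ e₃ e₄
    have hN := ne_neg_add_nat ha N
    have hcN := cos_pi_mul_add_nat_ne_zero hc N
    have hr : -(3 / 4) ≤ (a + N).re := by
      have := abs_nonneg a.im
      simp; linarith
    -- The square has nonnegative real part once the real part of $a+N-\frac14$ dominates the fixed
    -- imaginary part.
    have hB : 0 ≤ ((a + N - 1 / 4) ^ 2).re := by
      have h1 : |a.im| ≤ |a.re + N - 1 / 4| := le_trans (by linarith) (le_abs_self _)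
      have h2 := sq_le_sq.2 h1
      rw [pow_two, Complex.mul_re]
      simp
      nlinarith
    set X := (N : ℝ) + (3 + ‖a‖) with hX
    have hz : ‖a + N‖ ≤ N + ‖a‖ := by
      refine (norm_add_le _ _).trans ?_
      rw [Complex.norm_natCast, add_comm]
    have hX3 : 3 ≤ X := by have := norm_nonneg a; have : (0:ℝ) ≤ N := N.cast_nonneg; linarith
    have h21 : 1 ≤ ‖2 * (a + N) - 1‖ := by
      rw [show 2 * (a + N) - 1 = 2 * (a + -1 / 2 + N) by ring, norm_mul]
      norm_num at e₃ ⊢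
      linarith
    have hq : ‖32 * (a + N) ^ 3 / (2 * (a + N) - 1)‖ ≤ 32 * X ^ 3 := by
      rw [norm_div, norm_mul, norm_pow]
      refine (div_le_self (by positivity) h21).trans ?_
      norm_num
      gcongr
      linarith
    have hone : (1 : ℝ) ≤ (3 / 2) ^ N := one_le_pow₀ (by norm_num)
    have hV : ‖∑' n, vTerm (a + N) n‖ ≤ S * ((1 + C₁) * (3 / 2) ^ N) := by
      refine (hv _ hN hcN hB hr).trans ?_
      gcongr
      refine max_le ?_ (e₁.trans ?_)
      · nlinarith
      · gcongr; linarith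
    have hG : ‖gSeries (a + N)‖ ≤ K' * X := (hg _ hr).trans (by gcongr; linarith)
    have hF : ‖fSeries (a + N)‖ ≤ K * X ^ 2 := (hf _ hr).trans (by gcongr; linarith)
    calc _ ≤ ‖fSeries (a + N)‖ + (‖gFactor (a + N)‖ * ‖gSeries (a + N)‖
          + ‖32 * (a + N) ^ 3 / (2 * (a + N) - 1)‖ * ‖∑' n, vTerm (a + N) n‖) := by
          refine (norm_sub_le _ _).trans ?_
          gcongr
          refine (norm_add_le _ _).trans ?_
          rw [norm_mul, norm_mul]
      _ ≤ K * X ^ 2 + (C₂ * (3 / 2) ^ N * (K' * X)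
          + 32 * X ^ 3 * (S * ((1 + C₁) * (3 / 2) ^ N))) := by gcongr
      _ ≤ K * (X ^ 3 * (3 / 2) ^ N) + (C₂ * (3 / 2) ^ N * (K' * X ^ 3)
          + 32 * X ^ 3 * (S * ((1 + C₁) * (3 / 2) ^ N))) := by
          have x1 : X ≤ X ^ 3 := le_self_pow₀ (by linarith) (by norm_num)
          have x2 : X ^ 2 ≤ X ^ 3 := pow_le_pow_right₀ (by linarith) (by norm_num)
          have x3 : X ^ 3 ≤ X ^ 3 * (3 / 2) ^ N := le_mul_of_one_le_right (by positivity) hone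
          gcongr
          linarith
      _ = (K + K' * C₂ + 32 * S * (1 + C₁)) * (X ^ 3 * (3 / 2) ^ N) := by ring
      _ ≤ (K + K' * C₂ + 32 * S * (1 + C₁)) * (P * 2 ^ N * (3 / 2) ^ N) := by
          gcongr
          exact hPN N
      _ = _ := by
          rw [mul_assoc P, ← mul_pow]; norm_num; ring

/-! ### The series of `wTerm` and its recurrence -/

lemma three_half_sub_add_nat_ne_zero_of_re {a : ℂ} (ha : a.re < 3 / 2) (j : ℕ) :
    3 / 2 - a + j ≠ 0 := fun h => by
  have := congrArg Complex.re h
  have : (0 : ℝ) ≤ j := j.cast_nonneg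
  simp at *
  linarith

/-- The quotient $(\frac12)_n/(\frac32-a)_n$ contributes the exponent $1-\rho$ and
$(a+\frac12)_n/(a+1)_n$ contributes $\frac12$; the slack is split evenly between them. The constant
depends on the region only, as termwise holomorphy requires. -/
lemma exists_norm_wTerm_le (R δ ρ τ : ℝ) (hδ : 0 < δ) (hρ : ρ < 3 / 2) (hτ : τ < 3 / 2 - ρ) :
    ∃ C > 0, ∀ a : ℂ, ‖a‖ ≤ R → a.re ≤ ρ → (∀ j : ℕ, δ ≤ ‖a + 1 + j‖) →
      ∀ n, ‖wTerm a n‖ ≤ C * ((n : ℝ) + 1) ^ (-τ) := by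
  set ε := 3 / 2 - ρ - τ with hε
  obtain ⟨C₁, hC₁, H₁⟩ := exists_norm_rise_le (|R| + 2) (3 / 2 - ρ) (1 - ρ) (1 - ρ - ε / 2)
    (by linarith) (by linarith)
  obtain ⟨C₂, hC₂, H₂⟩ := exists_norm_rise_le (|R| + 2) δ (1 / 2) (1 / 2 - ε / 2) hδ (by linarith)
  refine ⟨C₁ * C₂, by positivity, fun a haR haρ haδ n => ?_⟩
  have hR : ‖a‖ ≤ |R| := haR.trans (le_abs_self R)
  have h1 : ‖rise (1 / 2) n / rise (3 / 2 - a) n‖ ≤ C₁ * ((n : ℝ) + 1) ^ (-(1 - ρ - ε / 2)) := by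
    rw [norm_div]
    refine div_le_of_le_mul₀ (norm_nonneg _) (by positivity) (H₁ _ _ ?_ ?_ ?_ (fun j => ?_) n)
    · norm_num; linarith [abs_nonneg R]
    · refine (norm_sub_le _ _).trans ?_
      norm_num; linarith
    · norm_num; linarith
    · refine le_trans ?_ (Complex.re_le_norm _)
      have : (0 : ℝ) ≤ j := j.cast_nonneg
      norm_num; linarith
  have h2 : ‖rise (a + 1 / 2) n / rise (a + 1) n‖ ≤ C₂ * ((n : ℝ) + 1) ^ (-(1 / 2 - ε / 2)) := by
    rw [norm_div]
    refine div_le_of_le_mul₀ (norm_nonneg _) (by positivity) (H₂ _ _ ?_ ?_ ?_ haδ n)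
    · refine (norm_add_le _ _).trans ?_
      norm_num; linarith
    · refine (norm_add_le _ _).trans ?_
      norm_num; linarith
    · norm_num
  have e : wTerm a n =
      (rise (1 / 2) n / rise (3 / 2 - a) n) * (rise (a + 1 / 2) n / rise (a + 1) n) := by
    rw [wTerm, div_mul_div_comm, mul_comm (rise (a + 1) n)]
  have e2 : ((n : ℝ) + 1) ^ (-τ)
      = ((n : ℝ) + 1) ^ (-(1 - ρ - ε / 2)) * ((n : ℝ) + 1) ^ (-(1 / 2 - ε / 2)) := by
    rw [← Real.rpow_add (by positivity)]
    congr 1; rw [hε]; ring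
  rw [e, norm_mul, e2]
  refine (mul_le_mul h1 h2 (norm_nonneg _) (by positivity)).trans (le_of_eq ?_)
  ring

lemma summable_wTerm {a : ℂ} (ha : ∀ m : ℕ, a ≠ -((m : ℂ) + 1)) (hre : a.re < 1 / 2) :
    Summable (wTerm a) := by
  obtain ⟨δ, hδ, h⟩ := exists_le_norm_add_nat (add_one_add_nat_ne_zero ha)
  obtain ⟨C, hC, H⟩ := exists_norm_wTerm_le ‖a‖ δ a.re (1 + (1 / 2 - a.re) / 2) hδ (by linarith)
    (by linarith)
  exact .of_norm_bounded ((summable_nat_add_one_rpow (by linarith)).mul_left C)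
    (H a le_rfl le_rfl h)

/-- The function `16 a² / (2a - 1) · ∑ wTerm a n`. -/
def wSum (a : ℂ) : ℂ := 16 * a ^ 2 / (2 * a - 1) * ∑' n, wTerm a n

lemma wSum_rec {a : ℂ} (ha : ∀ m : ℕ, a ≠ -((m : ℂ) + 1)) (hre : a.re < -(1 / 2)) :
    wSum a = 6 * a + 1 + 1 / 4 * ((a + 1 / 2) / (a + 1)) ^ 3 * wSum (a + 1) := by
  have hs := summable_wTerm ha (by linarith)
  have hs' := summable_wTerm (ne_neg_add_one ha) (by norm_num; linarith)
  have hne := add_one_add_nat_ne_zero ha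
  have ha1 : a + 1 ≠ 0 := by simpa using hne 0
  have hn3 := fun j => three_half_sub_add_nat_ne_zero_of_re (a := a) (by linarith) j
  have hmj : ∀ j : ℕ, 1 / 2 - a + j ≠ 0 := fun j h => by
    have := congrArg Complex.re h
    have : (0 : ℝ) ≤ j := j.cast_nonneg
    simp at *
    linarith
  have hm : 1 / 2 - a ≠ 0 := by simpa using hmj 0
  have hh : a + 1 / 2 ≠ 0 := fun h => by
    have := congrArg Complex.re h
    simp at this
    linarith
  -- The same half-plane $\operatorname{Re}a<-\frac12$ makes the series at $a+1$ converge and makes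
  -- this certificate vanish at infinity: the terms decay faster than $n^{-2}$.
  set R : ℕ → ℂ := fun n => wTerm a n * (n + 1 / 2 - a) * ((4 * n + 12 * a + 2) / (2 * a - 1))
    with hR
  have r8 : 1 - a * 2 ≠ 0 := fun h => hm (by linear_combination h / 2)
  have r9 : a * 2 + 1 ≠ 0 := fun h => hh (by linear_combination h / 2)
  have h21 : 2 * a - 1 ≠ 0 := fun h => r8 (by linear_combination -h)
  have hRl : Tendsto R atTop (𝓝 0) := by
    obtain ⟨δ, hδ, h⟩ := exists_le_norm_add_nat hne
    obtain ⟨C, hC, H⟩ := exists_norm_wTerm_le ‖a‖ δ a.re (2 + (-(1 / 2) - a.re) / 2) hδ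
      (by linarith) (by linarith)
    refine squeeze_zero_norm (a := fun n : ℕ => C * (2 + ‖a‖) * ((6 + 12 * ‖a‖) / ‖2 * a - 1‖)
      * ((n : ℝ) + 1) ^ (-((-(1 / 2) - a.re) / 2))) (fun n => ?_) ?_
    · have e : ((n : ℝ) + 1) ^ (-((-(1 / 2) - a.re) / 2))
          = ((n : ℝ) + 1) ^ (-(2 + (-(1 / 2) - a.re) / 2)) * (n + 1) ^ 2 := by
        rw [← Real.rpow_natCast, ← Real.rpow_add (by positivity)]
        congr 1; push_cast; ring
      have hn : (0 : ℝ) ≤ n := n.cast_nonneg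
      have hna := norm_nonneg a
      have b1 : ‖(n : ℂ) + 1 / 2 - a‖ ≤ (2 + ‖a‖) * (n + 1) := by
        refine (norm_sub_le _ _).trans ?_
        have := norm_add_le (n : ℂ) (1 / 2)
        rw [Complex.norm_natCast] at this
        norm_num at this ⊢
        nlinarith
      have b2 : ‖4 * (n : ℂ) + 12 * a + 2‖ ≤ (6 + 12 * ‖a‖) * (n + 1) := by
        refine (norm_add_le _ _).trans ?_
        have := norm_add_le (4 * (n : ℂ)) (12 * a)
        rw [norm_mul, norm_mul, Complex.norm_natCast] at this
        norm_num at this ⊢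
        nlinarith
      simp only [hR, norm_mul, norm_div]
      rw [e]
      calc _ ≤ C * ((n : ℝ) + 1) ^ (-(2 + (-(1 / 2) - a.re) / 2)) * ((2 + ‖a‖) * (n + 1)) *
            ((6 + 12 * ‖a‖) * (n + 1) / ‖2 * a - 1‖) := by
            gcongr
            exact H a le_rfl le_rfl h n
        _ = _ := by ring
    · simpa using (tendsto_nat_add_one_rpow_neg (p := -((-(1 / 2) - a.re) / 2))
        (by linarith)).const_mul (C * (2 + ‖a‖) * ((6 + 12 * ‖a‖) / ‖2 * a - 1‖))
  have key := tsum_eq_of_telescoping (t := fun n => 16 * a ^ 2 / (2 * a - 1) * wTerm a n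
      - 1 / 4 * ((a + 1 / 2) / (a + 1)) ^ 3 *
        (16 * (a + 1) ^ 2 / (2 * (a + 1) - 1) * wTerm (a + 1) n))
    ((hs.mul_left _).sub ((hs'.mul_left _).mul_left _)) (fun n => ?_) hRl
  · rw [Summable.tsum_sub (hs.mul_left _) ((hs'.mul_left _).mul_left _), tsum_mul_left,
      tsum_mul_left, tsum_mul_left, ← wSum, ← wSum] at key
    have : R 0 = -(6 * a + 1) := by
      simp only [hR, wTerm, rise_zero]
      field_simp
      push_cast
      ring
    rw [this] at key
    linear_combination key
  · have r1 := rise_ne_zero hne n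
    have r2 := hne n
    have r3 := rise_ne_zero hn3 n
    have r4 := hn3 n
    have r5 := hmj n
    have e1 : rise (a + 1 + 1 / 2) n = rise (a + 1 / 2) n * (a + 1 / 2 + n) / (a + 1 / 2) := by
      rw [show a + 1 + 1 / 2 = a + 1 / 2 + 1 by ring, rise_add_one hh]
    have e2 : rise (3 / 2 - (a + 1)) n = rise (3 / 2 - a) n * (1 / 2 - a) / (1 / 2 - a + n) := by
      have := rise_add_one hm n
      rw [show (1 / 2 : ℂ) - a + 1 = 3 / 2 - a by ring] at this
      rw [this, show (3 / 2 : ℂ) - (a + 1) = 1 / 2 - a by ring, div_mul_cancel₀ _ hm,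
        mul_div_cancel_right₀ _ r5]
    simp only [hR, wTerm, rise_succ, rise_add_one ha1, e1, e2]
    have r6 : 3 - a * 2 + 2 * n ≠ 0 := fun h => r4 (by linear_combination h / 2)
    have r7 : 1 - a * 2 + 2 * n ≠ 0 := fun h => r5 (by linear_combination h / 2)
    generalize rise (1 / 2) n = s1
    generalize rise (a + 1 / 2) n = s2
    have e7 : 2 * (a + 1) - 1 = a * 2 + 1 := by ring
    have e8 : 2 * a - 1 = -(1 - a * 2) := by ring
    rw [e7, e8]
    generalize rise (a + 1) n = s3 at *
    generalize rise (3 / 2 - a) n = s4 at *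
    push_cast
    field_simp
    ring

/-! ### Holomorphy in a and first-order behaviour at -1/2 -/

lemma differentiableAt_gTerm {a : ℂ} (ha : ∀ m : ℕ, a ≠ -((m : ℂ) + 1)) (n : ℕ) :
    DifferentiableAt ℂ (fun a => gTerm a n) a := by
  have h1 := rise_ne_zero (add_one_add_nat_ne_zero ha) n
  have h2 : DifferentiableAt ℂ (fun a => rise (a + 1) n) a :=
    (differentiable_rise n).differentiableAt.comp a (by fun_prop)
  have h3 : DifferentiableAt ℂ (fun a => rise (a + 1 / 2) n) a :=
    (differentiable_rise n).differentiableAt.comp a (by fun_prop)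
  unfold gTerm
  exact ((((h3.pow 3).div (h2.pow 3) (pow_ne_zero _ h1))).const_mul _).mul (by fun_prop)

lemma differentiableAt_wTerm {a : ℂ} (ha : ∀ m : ℕ, a ≠ -((m : ℂ) + 1)) (hre : a.re < 3 / 2)
    (n : ℕ) : DifferentiableAt ℂ (fun a => wTerm a n) a := by
  have h1 := rise_ne_zero (add_one_add_nat_ne_zero ha) n
  have h1' := rise_ne_zero (three_half_sub_add_nat_ne_zero_of_re hre) n
  have h2 : DifferentiableAt ℂ (fun a => rise (a + 1) n) a :=
    (differentiable_rise n).differentiableAt.comp a (by fun_prop)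
  have h3 : DifferentiableAt ℂ (fun a => rise (a + 1 / 2) n) a :=
    (differentiable_rise n).differentiableAt.comp a (by fun_prop)
  have h4 : DifferentiableAt ℂ (fun a => rise (3 / 2 - a) n) a :=
    (differentiable_rise n).differentiableAt.comp a (by fun_prop)
  unfold wTerm
  exact (h3.const_mul _).div (h2.mul h4) (mul_ne_zero h1 h1')

/-- The open region on which the series are dominated uniformly. -/
def boundedStrip (R δ ρ : ℝ) : Set ℂ := {a | ‖a‖ < R ∧ -1 + δ < a.re ∧ a.re < ρ - δ}

lemma isOpen_boundedStrip (R δ ρ : ℝ) : IsOpen (boundedStrip R δ ρ) :=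
  (isOpen_lt continuous_norm continuous_const).inter
    ((isOpen_lt continuous_const Complex.continuous_re).inter
      (isOpen_lt Complex.continuous_re continuous_const))

lemma exists_mem_boundedStrip {a : ℂ} {ρ : ℝ} (h1 : -1 < a.re) (h2 : a.re < ρ) :
    ∃ R δ, 0 < δ ∧ a ∈ boundedStrip R δ ρ := by
  refine ⟨‖a‖ + 1, min (a.re + 1) (ρ - a.re) / 2, ?_, ?_, ?_, ?_⟩
  · have : 0 < min (a.re + 1) (ρ - a.re) := lt_min (by linarith) (by linarith)
    linarith
  · linarith
  · have := min_le_left (a.re + 1) (ρ - a.re)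
    linarith
  · have := min_le_right (a.re + 1) (ρ - a.re)
    linarith

lemma le_norm_of_mem_boundedStrip {R δ ρ : ℝ} {a : ℂ} (ha : a ∈ boundedStrip R δ ρ) (j : ℕ) :
    δ ≤ ‖a + 1 + j‖ := by
  refine le_trans ?_ (Complex.re_le_norm _)
  have : (0 : ℝ) ≤ j := j.cast_nonneg
  have := ha.2.1
  simp; linarith

lemma exists_norm_rise_half_le_boundedStrip (R δ ρ : ℝ) (hδ : 0 < δ) : ∃ C > 0,
    ∀ a ∈ boundedStrip R δ ρ, ∀ n, ‖rise (a + 1 / 2) n‖ ≤ C * ‖rise (a + 1) n‖ := by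
  obtain ⟨C, hC, H⟩ := exists_norm_rise_le (R + 1) δ (1 / 2) 0 hδ (by norm_num)
  refine ⟨C, hC, fun a ha n => ?_⟩
  have := H (a + 1 / 2) (a + 1) ((norm_add_le _ _).trans (by norm_num; linarith [ha.1]))
    ((norm_add_le _ _).trans (by norm_num; linarith [ha.1])) (by norm_num)
    (le_norm_of_mem_boundedStrip ha) n
  simpa using this

lemma differentiableAt_gSeries {a : ℂ} (h1 : -1 < a.re) :
    DifferentiableAt ℂ gSeries a := by
  obtain ⟨R, δ, hδ, ha⟩ := exists_mem_boundedStrip h1 (lt_add_one a.re)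
  obtain ⟨C, hC, H⟩ := exists_norm_rise_half_le_boundedStrip R δ (a.re + 1) hδ
  have hU := isOpen_boundedStrip R δ (a.re + 1)
  refine (Complex.differentiableOn_tsum_of_summable_norm (F := fun n a => gTerm a n)
    (summable_sq_mul_geometric.mul_left (C ^ 3 * (7 * (1 + R)))) (fun n z hz => ?_) hU
    (fun n z hz => ?_)).differentiableAt (hU.mem_nhds ha)
  · exact (differentiableAt_gTerm (ne_neg_of_re (by linarith [hz.2.1])) n).differentiableWithinAt
  · refine (norm_gTerm_le hC.le (H z hz) n).trans ?_
    gcongr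
    exact hz.1.le

lemma exists_norm_wTerm_le_boundedStrip (R δ : ℝ) (hδ : 0 < δ) : ∃ u : ℕ → ℝ, Summable u ∧
    ∀ n, ∀ a ∈ boundedStrip R δ (1 / 2), ‖wTerm a n‖ ≤ u n := by
  obtain ⟨C, hC, H⟩ := exists_norm_wTerm_le R δ (1 / 2 - δ) (1 + δ / 2) hδ (by linarith)
    (by linarith)
  exact ⟨_, (summable_nat_add_one_rpow (p := -(1 + δ / 2)) (by linarith)).mul_left C,
    fun n a ha => H a ha.1.le ha.2.2.le (le_norm_of_mem_boundedStrip ha) n⟩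

lemma differentiableAt_tsum_wTerm {a : ℂ} (h1 : -1 < a.re) (h2 : a.re < 1 / 2) :
    DifferentiableAt ℂ (fun a => ∑' n, wTerm a n) a := by
  obtain ⟨R, δ, hδ, ha⟩ := exists_mem_boundedStrip h1 h2
  obtain ⟨u, hu, H⟩ := exists_norm_wTerm_le_boundedStrip R δ hδ
  have hU := isOpen_boundedStrip R δ (1 / 2)
  refine (Complex.differentiableOn_tsum_of_summable_norm (F := fun n a => wTerm a n)
    hu (fun n z hz => ?_) hU H).differentiableAt (hU.mem_nhds ha)
  exact (differentiableAt_wTerm (ne_neg_of_re (by linarith [hz.2.1])) (by linarith [hz.2.2])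
    n).differentiableWithinAt

lemma rise_one (n : ℕ) : rise 1 n = n.factorial := by
  induction n with
  | zero => simp [rise_zero]
  | succ n ih => rw [rise_succ, ih, Nat.factorial_succ]; push_cast; ring

lemma wTerm_neg_half_succ (n : ℕ) : wTerm (-1 / 2) (n + 1) = 0 := by
  rw [wTerm, show (-1 / 2 : ℂ) + 1 / 2 = 0 by norm_num, rise_succ' 0]
  simp

lemma tsum_wTerm_neg_half : ∑' n, wTerm (-1 / 2) n = 1 := by
  rw [tsum_eq_single 0]
  · simp [wTerm, rise_zero]
  · intro n hn
    obtain ⟨m, rfl⟩ := Nat.exists_eq_succ_of_ne_zero hn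
    exact wTerm_neg_half_succ m

/-- Splitting $(a+\frac12)_{n+1}=(a+\frac12)(a+\frac32)_n$ isolates the simple zero, so the
derivative is the cofactor at $-\frac12$, namely $n!/(n+2)!$. -/
lemma hasDerivAt_wTerm_succ (n : ℕ) :
    HasDerivAt (fun a => wTerm a (n + 1)) (1 / (((n : ℂ) + 1) * (n + 2))) (-1 / 2) := by
  have hre : (-1 / 2 : ℂ).re = -1 / 2 := by norm_num
  have ha : ∀ m : ℕ, (-1 / 2 : ℂ) ≠ -((m : ℂ) + 1) := ne_neg_of_re (by rw [hre]; norm_num)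
  have h1 := rise_ne_zero (add_one_add_nat_ne_zero ha) (n + 1)
  have h1' := rise_ne_zero (three_half_sub_add_nat_ne_zero_of_re (a := -1 / 2)
    (by rw [hre]; norm_num)) (n + 1)
  have h2 : DifferentiableAt ℂ (fun a => rise (a + 1) (n + 1)) (-1 / 2) :=
    (differentiable_rise _).differentiableAt.comp _ (by fun_prop)
  have h3 : DifferentiableAt ℂ (fun a => rise (a + 1 / 2 + 1) n) (-1 / 2) :=
    (differentiable_rise n).differentiableAt.comp _ (by fun_prop)
  have h4 : DifferentiableAt ℂ (fun a => rise (3 / 2 - a) (n + 1)) (-1 / 2) :=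
    (differentiable_rise _).differentiableAt.comp _ (by fun_prop)
  have h5 := ((h3.const_mul (rise (1 / 2) (n + 1))).div (h2.mul h4) (mul_ne_zero h1 h1')).hasDerivAt
  have h6 := ((hasDerivAt_id (-1 / 2 : ℂ)).add_const (1 / 2)).mul h5
  have e : (fun a => wTerm a (n + 1)) = fun a => (a + 1 / 2) *
      (rise (1 / 2) (n + 1) * rise (a + 1 / 2 + 1) n / (rise (a + 1) (n + 1) * rise (3 / 2 - a) (n + 1))) := by
    funext a
    rw [wTerm, rise_succ' (a + 1 / 2)]
    ring
  rw [e]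
  refine h6.congr_deriv ?_
  have r2 : rise 2 (n + 1) = n.factorial * (n + 1) * (n + 2) := by
    have := rise_succ' 1 (n + 1)
    rw [rise_one, one_mul, show (1 : ℂ) + 1 = 2 by norm_num] at this
    rw [← this, Nat.factorial_succ, Nat.factorial_succ]
    push_cast; ring
  have e1 : (-1 / 2 : ℂ) + 1 / 2 = 0 := by norm_num
  have e2 : (-1 / 2 : ℂ) + 1 = 1 / 2 := by norm_num
  have e3 : (3 / 2 : ℂ) - (-1 / 2) = 2 := by norm_num
  rw [e2] at h1
  simp only [id, Pi.div_apply, Pi.mul_apply]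
  rw [e1, e2, e3, r2, zero_add, rise_one]
  have hf : (n.factorial : ℂ) ≠ 0 := by exact_mod_cast n.factorial_ne_zero
  have hn1 : (n : ℂ) + 1 ≠ 0 := by exact_mod_cast (by omega : n + 1 ≠ 0)
  have hn2 : (n : ℂ) + 2 ≠ 0 := by exact_mod_cast (by omega : n + 2 ≠ 0)
  generalize rise (1 / 2) (n + 1) = s at *
  field_simp
  ring

lemma hasDerivAt_tsum_wTerm : HasDerivAt (fun a => ∑' n, wTerm a n) 1 (-1 / 2) := by
  have hre : (-1 / 2 : ℂ).re = -1 / 2 := by norm_num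
  have ha1 : -1 < (-1 / 2 : ℂ).re := by rw [hre]; norm_num
  have ha2 : (-1 / 2 : ℂ).re < 1 / 2 := by rw [hre]; norm_num
  obtain ⟨R, δ, hδ, ha⟩ := exists_mem_boundedStrip ha1 ha2
  obtain ⟨u, hu, H⟩ := exists_norm_wTerm_le_boundedStrip R δ hδ
  have hU := isOpen_boundedStrip R δ (1 / 2)
  have hS := Complex.hasSum_deriv_of_summable_norm (F := fun n a => wTerm a n) hu
    (fun n z hz => (differentiableAt_wTerm (ne_neg_of_re (by linarith [hz.2.1]))
      (by linarith [hz.2.2]) n).differentiableWithinAt) hU H ha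
  refine (differentiableAt_tsum_wTerm ha1 ha2).hasDerivAt.congr_deriv ?_
  have h0 : deriv (fun a => wTerm a 0) (-1 / 2) = 0 := by simp [wTerm, rise_zero]
  rw [← hS.tsum_eq, hS.summable.tsum_eq_zero_add, h0, zero_add]
  have hs1 := (summable_nat_add_iff 1).2 hS.summable
  simp_rw [fun n => (hasDerivAt_wTerm_succ n).deriv] at hs1 ⊢
  have hl : Tendsto (fun n : ℕ => -(1 / ((n : ℂ) + 1))) atTop (𝓝 0) := by
    simpa using (tendsto_one_div_add_atTop_nhds_zero_nat (𝕜 := ℂ)).neg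
  rw [tsum_eq_of_telescoping hs1 (fun n => ?_) hl]
  · simp
  · have hn1 : (n : ℂ) + 1 ≠ 0 := by exact_mod_cast (by omega : n + 1 ≠ 0)
    have hn2 : (n : ℂ) + 2 ≠ 0 := by exact_mod_cast (by omega : n + 2 ≠ 0)
    push_cast
    rw [show (n : ℂ) + 1 + 1 = n + 2 by ring]
    field_simp
    ring

/-! ### The defect of g near -1/2 -/

/-- The difference between `gSeries` and the `wTerm` series. -/
def gDefect (a : ℂ) : ℂ := gSeries a - wSum a

lemma gDefect_rec {a : ℂ} (ha : ∀ m : ℕ, a ≠ -((m : ℂ) + 1)) (hre : a.re < -(1 / 2)) :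
    gDefect a = 1 / 4 * ((a + 1 / 2) / (a + 1)) ^ 3 * gDefect (a + 1) := by
  rw [gDefect, gDefect, gSeries_rec ha, wSum_rec ha hre]; ring

lemma differentiableAt_wSum {a : ℂ} (h1 : -1 < a.re) (h2 : a.re < 1 / 2) :
    DifferentiableAt ℂ wSum a := by
  have h : 2 * a - 1 ≠ 0 := fun h => by
    have := congrArg Complex.re h
    simp at this
    linarith
  have h3 : DifferentiableAt ℂ (fun a : ℂ => 16 * a ^ 2 / (2 * a - 1)) a :=
    DifferentiableAt.div (by fun_prop) (by fun_prop) h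
  exact h3.mul (differentiableAt_tsum_wTerm h1 h2)

lemma differentiableAt_gDefect {a : ℂ} (h1 : -1 < a.re) (h2 : a.re < 1 / 2) :
    DifferentiableAt ℂ gDefect a :=
  (differentiableAt_gSeries h1).sub (differentiableAt_wSum h1 h2)

lemma gDefect_neg_half : gDefect (-1 / 2) = 0 := by
  have hre : (-1 / 2 : ℂ).re = -1 / 2 := by norm_num
  rw [gDefect, wSum, gSeries_rec (ne_neg_of_re (by rw [hre]; norm_num)), tsum_wTerm_neg_half]
  norm_num

/-- In the recurrence of $g$ the cubed factor has a triple zero at $-\frac12$, so only $6a+1$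
contributes to the derivative of $g$. The nonzero result fixes the constant in the evaluation of
$g$. -/
lemma hasDerivAt_gDefect : HasDerivAt gDefect 2 (-1 / 2) := by
  have hre : (-1 / 2 : ℂ).re = -1 / 2 := by norm_num
  have hg : HasDerivAt gSeries 6 (-1 / 2) := by
    have h1 : DifferentiableAt ℂ (fun a => gSeries (a + 1)) (-1 / 2) := by
      have q : DifferentiableAt ℂ gSeries (-1 / 2 + 1) := differentiableAt_gSeries (by norm_num)
      exact (q.hasDerivAt.comp_add_const (-1 / 2) 1).differentiableAt
    have h2 : HasDerivAt (fun a : ℂ => 6 * a + 1) 6 (-1 / 2) := by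
      simpa using ((hasDerivAt_id (-1 / 2 : ℂ)).const_mul 6).add_const 1
    have h3 : HasDerivAt (fun a : ℂ => ((a + 1 / 2) / (a + 1)) ^ 3) 0 (-1 / 2) := by
      have n1 : DifferentiableAt ℂ (fun a : ℂ => (a + 1 / 2) / (a + 1)) (-1 / 2) :=
        DifferentiableAt.div (by fun_prop) (by fun_prop) (by norm_num)
      refine (n1.hasDerivAt.pow 3).congr_deriv ?_
      norm_num
    have h4 := h2.add ((h3.const_mul (1 / 4)).mul h1.hasDerivAt)
    have h5 : gSeries =ᶠ[𝓝 (-1 / 2)] fun a => 6 * a + 1 + 1 / 4 * ((a + 1 / 2) / (a + 1)) ^ 3 *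
        gSeries (a + 1) := by
      filter_upwards [(isOpen_lt continuous_const Complex.continuous_re).mem_nhds
        (show (-1 : ℝ) < (-1 / 2 : ℂ).re by rw [hre]; norm_num)] with a ha
      exact gSeries_rec (ne_neg_of_re ha)
    refine (h4.congr_of_eventuallyEq h5).congr_deriv ?_
    norm_num
  have hw : HasDerivAt wSum 4 (-1 / 2) := by
    have h1 : HasDerivAt (fun a : ℂ => 16 * a ^ 2 / (2 * a - 1)) 6 (-1 / 2) := by
      have n1 : HasDerivAt (fun a : ℂ => 16 * a ^ 2) (16 * (2 * (-1 / 2))) (-1 / 2) := by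
        simpa using (hasDerivAt_pow 2 (-1 / 2 : ℂ)).const_mul 16
      have n2 : HasDerivAt (fun a : ℂ => 2 * a - 1) 2 (-1 / 2) := by
        simpa using ((hasDerivAt_id (-1 / 2 : ℂ)).const_mul 2).sub_const 1
      refine (n1.div n2 (by norm_num)).congr_deriv ?_
      norm_num
    refine (h1.mul hasDerivAt_tsum_wTerm).congr_deriv ?_
    rw [tsum_wTerm_neg_half]
    norm_num
  exact (hg.sub hw).congr_deriv (by norm_num)

/-! ### Liouville-type theorems -/

lemma isConst_of_differentiable_isLittleO {F : ℂ → ℂ} (hF : Differentiable ℂ F)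
    (h : ∀ ε > 0, ∃ R, ∀ q : ℂ, R ≤ ‖q‖ → ‖F q‖ ≤ ε * ‖q‖) (x y : ℂ) : F x = F y := by
  refine is_const_of_deriv_eq_zero hF (fun c => ?_) x y
  refine norm_le_zero_iff.1 (le_of_forall_pos_le_add fun ε hε => ?_)
  rw [zero_add]
  obtain ⟨R, hR⟩ := h (ε / 2) (by positivity)
  -- The circle of radius `r` about `c` stays where the hypothesis applies, and $|z|\le r+|c|\le2r$
  -- on it, which accounts for $\varepsilon/2$. Cauchy's estimate then bounds the derivative at `c`
  -- by $\varepsilon$.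
  set r := max (R + ‖c‖) (‖c‖ + 1) with hr
  have hr1 : R + ‖c‖ ≤ r := le_max_left _ _
  have hr2 : ‖c‖ + 1 ≤ r := le_max_right _ _
  have hr0 : 0 < r := by linarith [norm_nonneg c]
  refine (Complex.norm_deriv_le_of_forall_mem_sphere_norm_le hr0 hF.diffContOnCl
    (C := ε * r) fun z hz => ?_).trans (le_of_eq (by field_simp))
  have hz' : ‖z - c‖ = r := by simpa [dist_eq_norm] using hz
  have h1 : ‖z‖ ≤ r + ‖c‖ := by
    have := norm_add_le (z - c) c
    rwa [sub_add_cancel, hz'] at this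
  have h2 : R ≤ ‖z‖ := by
    have := norm_sub_le z c
    linarith
  refine (hR z h2).trans ?_
  nlinarith

/-- A periodic entire function of exponential type less than its frequency is constant. -/
lemma isConst_of_periodic {φ : ℂ → ℂ} (hφ : Differentiable ℂ φ) (hp : Function.Periodic φ 1)
    (h : ∀ ε > 0, ∃ Y, ∀ z : ℂ, Y ≤ |z.im| → ‖φ z‖ ≤ ε * Real.exp (2 * Real.pi * |z.im|))
    (x y : ℂ) : φ x = φ y := by
  have hp' : Function.Periodic φ ((1 : ℝ) : ℂ) := by simpa using hp
  -- `F` is the function of $q=e^{2\pi iz}$ with $F(q)=\varphi(z)$.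
  set F := Function.Periodic.cuspFunction 1 φ with hF
  have hFq : ∀ z, F (Function.Periodic.qParam 1 z) = φ z := fun z =>
    Function.Periodic.eq_cuspFunction one_ne_zero hp' z
  have hF0 : ∀ q : ℂ, q ≠ 0 → F q = φ (Function.Periodic.invQParam 1 q) := fun q hq =>
    Function.Periodic.cuspFunction_eq_of_nonzero 1 φ hq
  have hpi := Real.pi_pos
  have him : ∀ q : ℂ, (Function.Periodic.invQParam 1 q).im = -1 / (2 * Real.pi) * Real.log ‖q‖ :=
    fun q => Function.Periodic.im_invQParam 1 q
  have hd : ∀ q : ℂ, q ≠ 0 → DifferentiableAt ℂ F q := fun q hq => by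
    rw [← Function.Periodic.qParam_right_inv one_ne_zero hq]
    exact Function.Periodic.differentiableAt_cuspFunction one_ne_zero hp' (hφ _)
  have hexp : ∀ q : ℂ, q ≠ 0 → Real.exp (2 * Real.pi * |(Function.Periodic.invQParam 1 q).im|)
      = Real.exp |Real.log ‖q‖| := fun q hq => by
    rw [him, abs_mul, abs_div, abs_of_pos (by positivity : 0 < 2 * Real.pi)]
    congr 1
    rw [abs_neg, abs_one]
    field_simp
  have hlarge : ∀ Y : ℝ, ∀ q : ℂ, q ≠ 0 → 2 * Real.pi * Y ≤ |Real.log ‖q‖| →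
      Y ≤ |(Function.Periodic.invQParam 1 q).im| := fun Y q hq hY => by
    rw [him, abs_mul, abs_div, abs_of_pos (by positivity : 0 < 2 * Real.pi), abs_neg, abs_one,
      div_mul_eq_mul_div, one_mul, le_div_iff₀ (by positivity)]
    linarith
  -- As $q\to0$ the growth hypothesis reads $F(q)=o(1/|q|)$, so the singularity is removable;
  -- `cuspFunction` already takes the limit as its value at $0$.
  have hzero : DifferentiableAt ℂ F 0 := by
    have ho : (fun z => (φ ∘ Function.Periodic.invQParam 1) z
        - (φ ∘ Function.Periodic.invQParam 1) 0) =o[𝓝[≠] (0 : ℂ)] fun z => (z - 0)⁻¹ := by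
      have hc : (fun _ : ℂ => (φ ∘ Function.Periodic.invQParam 1) 0) =o[𝓝[≠] (0 : ℂ)]
          fun z => (z - 0)⁻¹ := by
        refine Asymptotics.isLittleO_const_left.2 (Or.inr ?_)
        simp only [sub_zero]
        exact tendsto_norm_cobounded_atTop.comp tendsto_inv₀_nhdsNE_zero
      refine Asymptotics.IsLittleO.sub ?_ hc
      rw [Asymptotics.isLittleO_iff]
      intro ε hε
      obtain ⟨Y, hY⟩ := h ε hε
      have hr : 0 < Real.exp (-|2 * Real.pi * Y|) := Real.exp_pos _
      filter_upwards [nhdsWithin_le_nhds (Metric.ball_mem_nhds (0 : ℂ) (lt_min one_pos hr)),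
        self_mem_nhdsWithin] with q hq hq0
      have hq0' : q ≠ 0 := hq0
      rw [mem_ball_zero_iff, lt_min_iff] at hq
      have hqp : 0 < ‖q‖ := norm_pos_iff.2 hq0'
      have hlog : Real.log ‖q‖ ≤ -|2 * Real.pi * Y| := by
        rw [Real.log_le_iff_le_exp hqp]; exact hq.2.le
      have hlog0 : Real.log ‖q‖ ≤ 0 := hlog.trans (neg_nonpos.2 (abs_nonneg _))
      refine (hY _ (hlarge Y q hq0' ?_)).trans (le_of_eq ?_)
      · rw [abs_of_nonpos hlog0]
        linarith [le_abs_self (2 * Real.pi * Y)]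
      · rw [hexp q hq0', abs_of_nonpos hlog0, Real.exp_neg, Real.exp_log hqp, sub_zero, norm_inv]
    have hD : DifferentiableOn ℂ (φ ∘ Function.Periodic.invQParam 1) (Set.univ \ {0}) := by
      intro q hq
      have hq0 : q ≠ 0 := hq.2
      refine ((hd q hq0).congr_of_eventuallyEq ?_).differentiableWithinAt
      filter_upwards [isOpen_ne.mem_nhds hq0] with z hz
      exact (hF0 z hz).symm
    exact (Complex.differentiableOn_update_limUnder_of_isLittleO univ_mem hD ho).differentiableAt
      univ_mem
  have hdiff : Differentiable ℂ F := fun q => by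
    by_cases hq : q = 0
    · rw [hq]; exact hzero
    · exact hd q hq
  have hconst := isConst_of_differentiable_isLittleO hdiff (fun ε hε => by
    obtain ⟨Y, hY⟩ := h ε hε
    refine ⟨Real.exp |2 * Real.pi * Y|, fun q hq => ?_⟩
    have hqp : 0 < ‖q‖ := (Real.exp_pos _).trans_le hq
    have hq0 : q ≠ 0 := norm_pos_iff.1 hqp
    have hlog : |2 * Real.pi * Y| ≤ Real.log ‖q‖ := by
      rwa [Real.le_log_iff_exp_le hqp]
    have hlog0 : 0 ≤ Real.log ‖q‖ := (abs_nonneg _).trans hlog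
    rw [hF0 q hq0]
    refine (hY _ (hlarge Y q hq0 ?_)).trans (le_of_eq ?_)
    · rw [abs_of_nonneg hlog0]
      linarith [le_abs_self (2 * Real.pi * Y)]
    · rw [hexp q hq0, abs_of_nonneg hlog0, Real.exp_log hqp])
  rw [← hFq x, ← hFq y]
  exact hconst _ _

/-! ### The periodic product and its entire continuation -/

lemma add_nat_ne_zero_of_im {s : ℂ} (h : 1 ≤ |s.im|) (j : ℕ) : s + j ≠ 0 := fun h0 => by
  have := congrArg Complex.im h0
  simp at this
  rw [this] at h
  norm_num at h

/-- Bound for quotients of Gamma values on vertical strips. -/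
lemma exists_norm_Gamma_ratio_le : ∃ M > 0, ∀ s : ℂ, 1 ≤ |s.im| → -1 ≤ s.re →
    ‖Complex.Gamma s / Complex.Gamma (s + 1 / 2)‖ ^ 2 ≤ M / ‖s‖ := by
  set S := ∑' n : ℕ, (9 / 4 : ℝ) * (1 / ((n : ℝ) + 1) ^ 2) with hS
  have hsum : Summable fun n : ℕ => (9 / 4 : ℝ) * (1 / ((n : ℝ) + 1) ^ 2) := by
    have := ((summable_nat_add_iff 1).2 (Real.summable_one_div_nat_pow (p := 2).2
      (by norm_num))).mul_left (9 / 4 : ℝ)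
    simpa using this
  refine ⟨Real.exp S, Real.exp_pos _, fun s him hre => ?_⟩
  have h0 := add_nat_ne_zero_of_im him
  have h1 : ∀ j : ℕ, s + 1 + j ≠ 0 := add_nat_ne_zero_of_im (by simpa using him)
  have h2 : ∀ j : ℕ, s + 1 / 2 + j ≠ 0 := add_nat_ne_zero_of_im (by simpa using him)
  have hG : ∀ {x : ℂ}, (∀ j : ℕ, x + j ≠ 0) → Complex.Gamma x ≠ 0 := fun {x} hx =>
    Complex.Gamma_ne_zero fun m h => hx m (by rw [h]; ring)
  -- Twice the lower bound 1 from the imaginary part plus the lower bound $j-1$ from the real part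
  -- gives $j+1$.
  have hlow : ∀ j : ℕ, ((j : ℝ) + 1) / 3 ≤ ‖s + j‖ ∧ ((j : ℝ) + 1) / 3 ≤ ‖s + 1 + j‖ := fun j => by
    have b1 : 1 ≤ ‖s + j‖ := by
      have := Complex.abs_im_le_norm (s + j)
      simp at this; linarith
    have b2 : (j : ℝ) - 1 ≤ ‖s + j‖ := by
      have := Complex.re_le_norm (s + j)
      simp at this; linarith
    have b3 : 1 ≤ ‖s + 1 + j‖ := by
      have := Complex.abs_im_le_norm (s + 1 + j)
      simp at this; linarith
    have b4 : (j : ℝ) - 1 ≤ ‖s + 1 + j‖ := by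
      have := Complex.re_le_norm (s + 1 + j)
      simp at this; linarith
    constructor <;> linarith
  -- The product $(s+j)(s+1+j)$ differs from the square of its midpoint by $\frac14$ only, so the
  -- infinite product is bounded uniformly in $s$. Its limit is
  -- $\Gamma(s)\Gamma(s+1)/\Gamma(s+\frac12)^2$, and $\Gamma(s+1)=s\Gamma(s)$ yields the decay in
  -- $|s|$.
  have hfac : ∀ j : ℕ, ‖(s + 1 / 2 + j) ^ 2 / ((s + j) * (s + 1 + j))‖
      ≤ Real.exp (9 / 4 * (1 / ((j : ℝ) + 1) ^ 2)) := fun j => by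
    have e : (s + 1 / 2 + j) ^ 2 / ((s + j) * (s + 1 + j))
        = 1 + (1 / 4) / ((s + j) * (s + 1 + j)) := by
      have := h0 j
      have := h1 j
      field_simp
      ring
    rw [e]
    refine (norm_add_le _ _).trans ?_
    rw [norm_one, add_comm, norm_div, norm_mul]
    refine le_trans ?_ (Real.add_one_le_exp _)
    gcongr
    have hj : (0 : ℝ) < (j : ℝ) + 1 := by positivity
    calc ‖(1 / 4 : ℂ)‖ / (‖s + j‖ * ‖s + 1 + j‖)
        ≤ ‖(1 / 4 : ℂ)‖ / (((j : ℝ) + 1) / 3 * (((j : ℝ) + 1) / 3)) := by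
          gcongr
          · exact (hlow j).1
          · exact (hlow j).2
      _ = _ := by norm_num; field_simp; norm_num
  have hprod : ∀ n : ℕ, ‖rise (s + 1 / 2) n ^ 2 / (rise s n * rise (s + 1) n)‖ ≤ Real.exp S := by
    intro n
    have : ‖rise (s + 1 / 2) n ^ 2 / (rise s n * rise (s + 1) n)‖
        ≤ Real.exp (∑ j ∈ Finset.range n, 9 / 4 * (1 / ((j : ℝ) + 1) ^ 2)) := by
      rw [Real.exp_sum, rise_eq_prod, rise_eq_prod, rise_eq_prod, ← Finset.prod_pow,
        ← Finset.prod_mul_distrib, ← Finset.prod_div_distrib, norm_prod]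
      exact Finset.prod_le_prod (fun _ _ => norm_nonneg _) fun j _ => hfac j
    refine this.trans (Real.exp_le_exp.2 ?_)
    exact hsum.sum_le_tsum _ fun _ _ => by positivity
  have t0 := tendsto_rise_div h0
  have t1 := tendsto_rise_div h1
  have t2 := tendsto_rise_div h2
  have t := ((t2.pow 2).div (t0.mul t1) (mul_ne_zero (inv_ne_zero (hG h0))
    (inv_ne_zero (hG h1)))).norm
  have hle : ‖(Complex.Gamma (s + 1 / 2))⁻¹ ^ 2 / ((Complex.Gamma s)⁻¹ * (Complex.Gamma (s + 1))⁻¹)‖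
      ≤ Real.exp S := by
    refine le_of_tendsto t ?_
    filter_upwards [eventually_ge_atTop 1] with n hn
    have hn0 : (n : ℂ) ≠ 0 := by exact_mod_cast (by omega : n ≠ 0)
    have hp : ∀ x : ℂ, (n : ℂ) ^ x ≠ 0 := fun x => by simp [Complex.cpow_eq_zero_iff, hn0]
    have hf : (n.factorial : ℂ) ≠ 0 := by exact_mod_cast n.factorial_ne_zero
    have key : (n : ℂ) ^ s * (n : ℂ) ^ (s + 1) = ((n : ℂ) ^ (s + 1 / 2)) ^ 2 := by
      rw [← Complex.cpow_nat_mul, ← Complex.cpow_add _ _ hn0]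
      congr 1; push_cast; ring
    have p0 := hp (s + 1 / 2)
    refine le_trans (le_of_eq ?_) (hprod (n + 1))
    simp only [Pi.div_apply]
    rw [div_pow, div_mul_div_comm, mul_pow, mul_mul_mul_comm ((n : ℂ) ^ s), key]
    congr 1
    generalize (n : ℂ) ^ (s + 1 / 2) = q at p0 ⊢
    field_simp
  have hs0 : s ≠ 0 := by simpa using h0 0
  have g0 := hG h0
  have g2 := hG h2
  rw [Complex.Gamma_add_one s hs0] at hle
  have e : (Complex.Gamma (s + 1 / 2))⁻¹ ^ 2 / ((Complex.Gamma s)⁻¹ * (s * Complex.Gamma s)⁻¹)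
      = (Complex.Gamma s / Complex.Gamma (s + 1 / 2)) ^ 2 * s := by
    generalize Complex.Gamma (s + 1 / 2) = x at *
    generalize Complex.Gamma s = y at *
    field_simp
  rw [e, norm_mul, norm_pow] at hle
  rwa [le_div_iff₀ (norm_pos_iff.2 hs0)]

/-- The inverse, up to a constant, of the solution `4 ^ a / cos² (π a) · (1_a / (1/2)_a)³` of the
homogeneous recurrence of `gSeries`. -/
def gWeight (a : ℂ) : ℂ := (4 : ℂ) ^ (-a) * Complex.Gamma (a + 1 / 2) *
  (Complex.Gamma (1 / 2 - a))⁻¹ ^ 2 * (Complex.Gamma (a + 1))⁻¹ ^ 3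

lemma gWeight_add_one {a : ℂ} (h1 : a + 1 ≠ 0) (h2 : a + 1 / 2 ≠ 0) :
    gWeight (a + 1) = 1 / 4 * ((a + 1 / 2) / (a + 1)) ^ 3 * gWeight a := by
  have h3 : -1 / 2 - a ≠ 0 := fun h => h2 (by linear_combination -h)
  have e1 : Complex.Gamma (1 / 2 - a) = (-1 / 2 - a) * Complex.Gamma (-1 / 2 - a) := by
    rw [← Complex.Gamma_add_one _ h3]; congr 1; ring
  rw [gWeight, gWeight, show a + 1 + 1 / 2 = a + 1 / 2 + 1 by ring, Complex.Gamma_add_one _ h2,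
    Complex.Gamma_add_one _ h1, e1, show 1 / 2 - (a + 1) = -1 / 2 - a by ring, neg_add,
    Complex.cpow_add _ _ (by norm_num), Complex.cpow_neg_one, mul_inv, mul_inv, mul_pow, mul_pow]
  generalize Complex.Gamma (-1 / 2 - a) = y
  have e2 : a + 1 / 2 = -(-1 / 2 - a) := by ring
  rw [e2]
  generalize Complex.Gamma _ = z
  generalize -1 / 2 - a = x at *
  field_simp

lemma gDefect_mul_gWeight {a : ℂ} (ha : ∀ m : ℕ, a ≠ -((m : ℂ) + 1)) (hre : a.re < -(1 / 2)) :
    gDefect (a + 1) * gWeight (a + 1) = gDefect a * gWeight a := by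
  have h1 : a + 1 ≠ 0 := by simpa using add_one_add_nat_ne_zero ha 0
  have h2 : a + 1 / 2 ≠ 0 := fun h => by
    have := congrArg Complex.re h
    simp at this
    linarith
  rw [gDefect_rec ha hre, gWeight_add_one h1 h2]
  ring

/-- The holomorphic extension of `gDefect * gWeight` across `-1/2`. -/
def gPeriodic (a : ℂ) : ℂ := (4 : ℂ) ^ (-a) * Complex.Gamma (a + 3 / 2) *
  (Complex.Gamma (1 / 2 - a))⁻¹ ^ 2 * (Complex.Gamma (a + 1))⁻¹ ^ 3 * dslope gDefect (-1 / 2) a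

/-- The pole of $\Gamma(a+\frac12)$ and the zero of `gDefect` cancel:
$\Gamma(a+\frac32)=(a+\frac12)\Gamma(a+\frac12)$ and the slope divides by $a+\frac12$. -/
lemma gPeriodic_eq {a : ℂ} (ha : a ≠ -1 / 2) : gPeriodic a = gDefect a * gWeight a := by
  have h : a + 1 / 2 ≠ 0 := fun h => ha (by linear_combination h)
  rw [gPeriodic, gWeight, dslope_of_ne _ ha, slope_def_field, gDefect_neg_half,
    show a + 3 / 2 = a + 1 / 2 + 1 by ring, Complex.Gamma_add_one _ h,
    show a - -1 / 2 = a + 1 / 2 by ring]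
  generalize Complex.Gamma (a + 1 / 2) = x
  generalize Complex.Gamma (1 / 2 - a) = y
  generalize a + 1 / 2 = z at *
  field_simp
  ring

lemma gPeriodic_neg_half : gPeriodic (-1 / 2) = 4 / Complex.Gamma (1 / 2) ^ 3 := by
  have h4 : (4 : ℂ) ^ (-(-1 / 2) : ℂ) = 2 := by
    rw [show (-(-1 / 2) : ℂ) = ((1 / 2 : ℝ) : ℂ) by push_cast; norm_num,
      show (4 : ℂ) = ((4 : ℝ) : ℂ) by norm_num, ← Complex.ofReal_cpow (by norm_num),
      ← Real.sqrt_eq_rpow, show (4 : ℝ) = 2 ^ 2 by norm_num, Real.sqrt_sq (by norm_num)]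
    norm_num
  have h1 : (-1 / 2 + 3 / 2 : ℂ) = 1 := by norm_num
  have h2 : (1 / 2 - -1 / 2 : ℂ) = 1 := by norm_num
  have h3 : (-1 / 2 + 1 : ℂ) = 1 / 2 := by norm_num
  rw [gPeriodic, dslope_same, hasDerivAt_gDefect.deriv, h4, h1, h2, h3, Complex.Gamma_one]
  ring

/-- The strip on which `gPeriodic` is holomorphic. -/
def gStrip : Set ℂ := {a | -1 < a.re ∧ a.re < 1 / 2}

lemma isOpen_gStrip : IsOpen gStrip :=
  (isOpen_lt continuous_const Complex.continuous_re).inter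
    (isOpen_lt Complex.continuous_re continuous_const)

lemma differentiableAt_gPeriodic {a : ℂ} (ha : a ∈ gStrip) : DifferentiableAt ℂ gPeriodic a := by
  have hS : gStrip ∈ 𝓝 (-1 / 2 : ℂ) := isOpen_gStrip.mem_nhds
    ⟨by norm_num, by norm_num⟩
  have h1 : DifferentiableOn ℂ (dslope gDefect (-1 / 2)) gStrip :=
    (Complex.differentiableOn_dslope hS).2 fun z hz =>
      (differentiableAt_gDefect hz.1 hz.2).differentiableWithinAt
  have h2 := h1.differentiableAt (isOpen_gStrip.mem_nhds ha)
  have h3 : DifferentiableAt ℂ (fun a => Complex.Gamma (a + 3 / 2)) a := by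
    have : DifferentiableAt ℂ Complex.Gamma (a + 3 / 2) := by
      refine Complex.differentiableAt_Gamma _ fun m h => ?_
      have := congrArg Complex.re h
      have : (0 : ℝ) ≤ m := m.cast_nonneg
      have := ha.1
      simp at *
      linarith
    exact (this.hasDerivAt.comp_add_const a (3 / 2)).differentiableAt
  have h4 : Differentiable ℂ (fun a => (Complex.Gamma (1 / 2 - a))⁻¹) :=
    Complex.differentiable_one_div_Gamma.comp (by fun_prop : Differentiable ℂ fun a : ℂ => 1 / 2 - a)
  have h5 : Differentiable ℂ (fun a => (Complex.Gamma (a + 1))⁻¹) :=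
    Complex.differentiable_one_div_Gamma.comp (by fun_prop : Differentiable ℂ fun a : ℂ => a + 1)
  have h6 : DifferentiableAt ℂ (fun a : ℂ => (4 : ℂ) ^ (-a)) a :=
    (differentiableAt_id.neg).const_cpow (Or.inl (by norm_num))
  exact (((h6.mul h3).mul (h4.differentiableAt.pow 2)).mul (h5.differentiableAt.pow 3)).mul h2

lemma gPeriodic_add_one {z : ℂ} (h1 : z ∈ gStrip) (h2 : z + 1 ∈ gStrip) :
    gPeriodic (z + 1) = gPeriodic z := by
  have e1 := h1.1
  have e2 : z.re + 1 < 1 / 2 := by simpa using h2.2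
  have n1 : z ≠ -1 / 2 := fun h => by
    rw [h] at e2
    norm_num at e2
  have n2 : z + 1 ≠ -1 / 2 := fun h => by
    have := congrArg Complex.re h
    norm_num at this
    linarith
  rw [gPeriodic_eq n1, gPeriodic_eq n2,
    gDefect_mul_gWeight (ne_neg_of_re e1) (by linarith)]

/-- The strip has width $\frac32$, so two of its points can differ only by $-1$, $0$ or $1$. -/
lemma gPeriodic_add_int {z : ℂ} {n : ℤ} (h1 : z ∈ gStrip) (h2 : z + n ∈ gStrip) :
    gPeriodic (z + n) = gPeriodic z := by
  have a1 := h1.1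
  have a2 := h1.2
  have a3 : -1 < z.re + n := by simpa using h2.1
  have a4 : z.re + n < 1 / 2 := by simpa using h2.2
  have b1 : (n : ℝ) < 2 := by linarith
  have b2 : (-2 : ℝ) < n := by linarith
  have c1 : n < 2 := by exact_mod_cast b1
  have c2 : -2 < n := by exact_mod_cast b2
  obtain rfl | rfl | rfl : n = -1 ∨ n = 0 ∨ n = 1 := by omega
  · have := gPeriodic_add_one (z := z + (-1 : ℤ)) h2 (by simpa using h1)
    simpa using this.symm
  · simp
  · simpa using gPeriodic_add_one h1 (by simpa using h2)

/-- The periodic entire continuation of `gPeriodic`. -/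
def gEntire (z : ℂ) : ℂ := gPeriodic (z - (⌊z.re + 3 / 4⌋ : ℤ))

/-- The representative has real part in $[-\frac34,\frac14)$, well inside the strip. -/
lemma sub_floor_mem_gStrip (z : ℂ) : z - (⌊z.re + 3 / 4⌋ : ℤ) ∈ gStrip := by
  have h1 := Int.floor_le (z.re + 3 / 4)
  have h2 := Int.lt_floor_add_one (z.re + 3 / 4)
  constructor <;> simp <;> linarith

/-- Any translate lying in the strip may be used, so the shift can be frozen near a point and the
jumps of the floor do no harm to holomorphy. -/
lemma gEntire_eq {z : ℂ} {n : ℤ} (h : z + n ∈ gStrip) : gEntire z = gPeriodic (z + n) := by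
  have h1 := sub_floor_mem_gStrip z
  have e : z - (⌊z.re + 3 / 4⌋ : ℤ) + ((⌊z.re + 3 / 4⌋ + n : ℤ) : ℂ) = z + n := by
    push_cast; ring
  rw [gEntire, ← gPeriodic_add_int (n := ⌊z.re + 3 / 4⌋ + n) h1 (by rw [e]; exact h), e]

lemma periodic_gEntire : Function.Periodic gEntire 1 := fun z => by
  have h1 := sub_floor_mem_gStrip z
  rw [gEntire_eq (z := z + 1) (n := -⌊z.re + 3 / 4⌋ - 1), gEntire]
  · congr 1; push_cast; ring
  · rw [show z + 1 + ((-⌊z.re + 3 / 4⌋ - 1 : ℤ) : ℂ) = z - (⌊z.re + 3 / 4⌋ : ℤ) by push_cast; ring]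
    exact h1

lemma differentiable_gEntire : Differentiable ℂ gEntire := fun z => by
  set n : ℤ := -⌊z.re + 3 / 4⌋ with hn
  have h1 : z + n ∈ gStrip := by
    have := sub_floor_mem_gStrip z
    rwa [hn, Int.cast_neg, ← sub_eq_add_neg]
  have h2 : gEntire =ᶠ[𝓝 z] fun w => gPeriodic (w + n) := by
    have hc : ContinuousAt (fun w : ℂ => w + n) z := by fun_prop
    filter_upwards [hc.preimage_mem_nhds (isOpen_gStrip.mem_nhds h1)] with w hw
    exact gEntire_eq hw
  refine DifferentiableAt.congr_of_eventuallyEq ?_ h2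
  exact ((differentiableAt_gPeriodic h1).hasDerivAt.comp_add_const z n).differentiableAt

/-! ### Growth for large imaginary part and the evaluation of g -/

lemma norm_cos_pi_mul_le (a : ℂ) : ‖Complex.cos (Real.pi * a)‖ ≤ Real.exp (Real.pi * |a.im|) := by
  have h : ∀ w : ℂ, ‖Complex.exp w‖ = Real.exp w.re := Complex.norm_exp
  rw [Complex.cos, norm_div]
  have h1 : ‖Complex.exp (Real.pi * a * Complex.I)‖ ≤ Real.exp (Real.pi * |a.im|) := by
    rw [h]
    refine Real.exp_le_exp.2 ?_
    have := neg_abs_le a.im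
    simp
    nlinarith [Real.pi_pos]
  have h2 : ‖Complex.exp (-(Real.pi * a) * Complex.I)‖ ≤ Real.exp (Real.pi * |a.im|) := by
    rw [h]
    refine Real.exp_le_exp.2 ?_
    have := le_abs_self a.im
    simp
    nlinarith [Real.pi_pos]
  have h3 := norm_add_le (Complex.exp (Real.pi * a * Complex.I))
    (Complex.exp (-(Real.pi * a) * Complex.I))
  have h4 : ‖(2 : ℂ)‖ = 2 := by norm_num
  rw [h4]
  linarith

lemma gWeight_eq {a : ℂ} (h : ∀ j : ℕ, a + 1 / 2 + j ≠ 0) : gWeight a =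
    (4 : ℂ) ^ (-a) * (Complex.cos (Real.pi * a) / Real.pi) ^ 2 *
      (Complex.Gamma (a + 1 / 2) / Complex.Gamma (a + 1)) ^ 3 := by
  have hG : Complex.Gamma (a + 1 / 2) ≠ 0 := 
    Complex.Gamma_ne_zero fun m hm => h m (by rw [hm]; ring)
  have hpi : (Real.pi : ℂ) ≠ 0 := by exact_mod_cast Real.pi_ne_zero
  have h1 := congrArg (·⁻¹) (Gamma_half_add_mul_Gamma_half_sub a)
  simp only [mul_inv, inv_div] at h1
  have h2 : (Complex.Gamma (1 / 2 - a))⁻¹ =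
      Complex.Gamma (a + 1 / 2) * (Complex.cos (Real.pi * a) / Real.pi) := by
    rw [← h1, mul_inv_cancel_left₀ hG]
  rw [gWeight, h2]
  ring

lemma exists_norm_gDefect_le : ∃ K > 0, ∀ a : ℂ, -(5 / 4) ≤ a.re → a.re ≤ -(1 / 4) →
    1 ≤ |a.im| → ‖gDefect a‖ ≤ K * (1 + ‖a‖) := by
  -- Since $\operatorname{Re}(\frac32-a)\ge\frac74$, the factorials $(\frac32-a)_n$ dominate
  -- $(\frac74)_n$. The gap to $\frac12$ is $\frac54$, and $\frac98$ lies below it and above 1.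
  obtain ⟨C, hC, H⟩ := exists_norm_rise_le 2 1 (5 / 4) (9 / 8) one_pos (by norm_num)
  set S := ∑' n : ℕ, ((n : ℝ) + 1) ^ (-(9 / 8 : ℝ)) with hS
  set K' := 7 * ∑' n : ℕ, ((n : ℝ) + 1) ^ 2 * (1 / 4 : ℝ) ^ n with hK'
  have hS0 : 0 ≤ S := by positivity
  have hK'0 : 0 ≤ K' := by positivity
  refine ⟨8 * K' + 16 * (2 * C * S) + 1, by positivity, fun a h1 h2 him => ?_⟩
  -- Only the first factor can violate the bound with constant 1, as $a$ may have real part below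
  -- $-\frac34$; $|\operatorname{Im}a|\ge1$ limits the loss to 2.
  have hhalf : ∀ n, ‖rise (a + 1 / 2) n‖ ≤ 2 * ‖rise (a + 1) n‖ := by
    intro n
    cases n with
    | zero => simp [rise_zero]
    | succ n =>
      rw [rise_succ', rise_succ', norm_mul, norm_mul]
      have e1 := norm_rise_half_le (a := a + 1) (by simp; linarith) n
      rw [one_mul, show a + 1 + 1 / 2 = a + 1 / 2 + 1 by ring] at e1
      have e2 : ‖a + 1 / 2‖ ≤ 2 * ‖a + 1‖ := by
        have b1 : 1 ≤ ‖a + 1‖ := by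
          have := Complex.abs_im_le_norm (a + 1)
          simp at this; linarith
        have b2 := norm_sub_le (a + 1) (1 / 2)
        rw [show a + 1 - 1 / 2 = a + 1 / 2 by ring] at b2
        norm_num at b2 ⊢
        linarith
      calc _ ≤ (2 * ‖a + 1‖) * ‖rise (a + 1 + 1) n‖ := by gcongr
        _ = _ := by ring
  have hw : ∀ n, ‖wTerm a n‖ ≤ 2 * C * ((n : ℝ) + 1) ^ (-(9 / 8 : ℝ)) := by
    intro n
    have e : wTerm a n =
        (rise (1 / 2) n / rise (3 / 2 - a) n) * (rise (a + 1 / 2) n / rise (a + 1) n) := by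
      rw [wTerm, div_mul_div_comm, mul_comm (rise (a + 1) n)]
    have b1 : ‖rise (a + 1 / 2) n / rise (a + 1) n‖ ≤ 2 := by
      rw [norm_div]
      exact div_le_of_le_mul₀ (norm_nonneg _) (by norm_num) (hhalf n)
    have b2 : ‖rise (1 / 2) n / rise (3 / 2 - a) n‖ ≤ C * ((n : ℝ) + 1) ^ (-(9 / 8 : ℝ)) := by
      rw [norm_div]
      refine div_le_of_le_mul₀ (norm_nonneg _) (by positivity) ?_
      refine (H (1 / 2) (7 / 4) (by norm_num) (by norm_num) (by norm_num) (fun j => ?_) n).trans ?_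
      · refine le_trans ?_ (Complex.re_le_norm _)
        have : (0 : ℝ) ≤ j := j.cast_nonneg
        norm_num; linarith
      · gcongr
        refine norm_rise_le_norm_rise (fun j => ?_) n
        have q1 : (7 / 4 : ℂ) + j = ((7 / 4 + j : ℝ) : ℂ) := by push_cast; ring
        rw [q1, Complex.norm_real, Real.norm_eq_abs, abs_of_nonneg (by positivity)]
        refine le_trans ?_ (Complex.re_le_norm _)
        norm_num; linarith
    rw [e, norm_mul]
    refine (mul_le_mul b2 b1 (norm_nonneg _) (by positivity)).trans (le_of_eq (by ring))
  have hW : ‖∑' n, wTerm a n‖ ≤ 2 * C * S := by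
    refine (tsum_of_norm_bounded ((summable_nat_add_one_rpow (by norm_num)).mul_left _).hasSum
      hw).trans (le_of_eq ?_)
    rw [tsum_mul_left]
  have h21 : ‖a‖ ≤ ‖2 * a - 1‖ := by
    refine (pow_le_pow_iff_left₀ (norm_nonneg _) (norm_nonneg _) two_ne_zero).1 ?_
    rw [Complex.sq_norm, Complex.sq_norm, Complex.normSq_apply, Complex.normSq_apply]
    simp
    nlinarith
  have ha0 : 0 < ‖a‖ := by
    have := Complex.abs_im_le_norm a
    linarith
  have hq : ‖16 * a ^ 2 / (2 * a - 1)‖ ≤ 16 * ‖a‖ := by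
    rw [norm_div, norm_mul, norm_pow, div_le_iff₀ (lt_of_lt_of_le ha0 h21)]
    norm_num
    rw [pow_two, ← mul_assoc]
    gcongr
  have hg := norm_gSeries_le (by norm_num) hhalf
  rw [← hK'] at hg
  calc ‖gDefect a‖ ≤ ‖gSeries a‖ + ‖16 * a ^ 2 / (2 * a - 1)‖ * ‖∑' n, wTerm a n‖ := by
        rw [gDefect, wSum, ← norm_mul]; exact norm_sub_le _ _
    _ ≤ 2 ^ 3 * K' * (1 + ‖a‖) + 16 * ‖a‖ * (2 * C * S) := by gcongr
    _ ≤ _ := by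
      have : 0 ≤ 16 * (2 * C * S) := by positivity
      nlinarith [norm_nonneg a]

/-- The defect grows at most linearly, while the cube of the Gamma quotient in `gWeight_eq` decays
like $|a|^{-3/2}$. The surplus $|a|^{-1/2}$ turns the big-O of $\cos^2$ into the little-o that
`isConst_of_periodic` needs. Squaring avoids fractional powers. -/
lemma exists_norm_gDefect_mul_gWeight_le : ∃ K > 0, ∀ a : ℂ, -(5 / 4) ≤ a.re → a.re ≤ -(1 / 4) →
    1 ≤ |a.im| → ‖gDefect a * gWeight a‖ ^ 2 ≤ K * (Real.exp (2 * Real.pi * |a.im|)) ^ 2 / |a.im| := by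
  obtain ⟨K, hK, hD⟩ := exists_norm_gDefect_le
  obtain ⟨M, hM, hΓ⟩ := exists_norm_Gamma_ratio_le
  refine ⟨(3 * K * 4 ^ (5 / 4 : ℝ)) ^ 2 * M ^ 3, by positivity, fun a h1 h2 him => ?_⟩
  have h3 := hΓ (a + 1 / 2) (by simpa using him) (by norm_num; linarith)
  rw [show a + 1 / 2 + 1 / 2 = a + 1 by ring] at h3
  have hs : |a.im| ≤ ‖a + 1 / 2‖ := by simpa using Complex.abs_im_le_norm (a + 1 / 2)
  set s := ‖a + 1 / 2‖ with hsdef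
  have hs1 : 1 ≤ s := him.trans hs
  have ha : 1 + ‖a‖ ≤ 3 * s := by
    have := norm_sub_le (a + 1 / 2) (1 / 2)
    rw [add_sub_cancel_right] at this
    norm_num at this
    linarith
  have hcpow : ‖(4 : ℂ) ^ (-a)‖ ≤ 4 ^ (5 / 4 : ℝ) := by
    rw [show (4 : ℂ) = ((4 : ℝ) : ℂ) by norm_num, Complex.norm_cpow_eq_rpow_re_of_pos (by norm_num)]
    refine Real.rpow_le_rpow_of_exponent_le (by norm_num) ?_
    simp; linarith
  have hcos : ‖(Complex.cos (Real.pi * a) / Real.pi) ^ 2‖ ≤ Real.exp (2 * Real.pi * |a.im|) := by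
    have b1 : ‖Complex.cos (Real.pi * a) / Real.pi‖ ≤ Real.exp (Real.pi * |a.im|) := by
      rw [norm_div, Complex.norm_real, Real.norm_eq_abs, abs_of_pos Real.pi_pos]
      exact (div_le_self (norm_nonneg _) (by linarith [Real.pi_gt_three])).trans
        (norm_cos_pi_mul_le a)
    rw [norm_pow]
    calc _ ≤ Real.exp (Real.pi * |a.im|) ^ 2 := by gcongr
      _ = _ := by rw [← Real.exp_nat_mul]; congr 1; push_cast; ring
  rw [gWeight_eq (add_nat_ne_zero_of_im (by simpa using him)), norm_mul, norm_mul, norm_mul,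
    norm_pow (_ / _) 3, mul_pow, mul_pow, mul_pow, ← pow_mul, mul_comm 3 2, pow_mul]
  calc _ ≤ (K * (3 * s)) ^ 2 * ((4 ^ (5 / 4 : ℝ)) ^ 2 * Real.exp (2 * Real.pi * |a.im|) ^ 2
        * (M / s) ^ 3) := by
        gcongr
        exact (hD a h1 h2 him).trans (by gcongr)
    _ = (3 * K * 4 ^ (5 / 4 : ℝ)) ^ 2 * M ^ 3 * Real.exp (2 * Real.pi * |a.im|) ^ 2 / s := by
        have : s ≠ 0 := by positivity
        field_simp
    _ ≤ _ := by gcongr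

lemma gEntire_eq_const (z : ℂ) : gEntire z = 4 / Complex.Gamma (1 / 2) ^ 3 := by
  have h0 : gEntire (-1 / 2) = 4 / Complex.Gamma (1 / 2) ^ 3 := by
    rw [gEntire_eq (n := 0) (by norm_num [gStrip]), Int.cast_zero, add_zero, gPeriodic_neg_half]
  rw [← h0]
  refine isConst_of_periodic differentiable_gEntire periodic_gEntire (fun ε hε => ?_) _ _
  obtain ⟨K, hK, H⟩ := exists_norm_gDefect_mul_gWeight_le
  refine ⟨max 1 (K / ε ^ 2), fun w hw => ?_⟩
  have hw1 : 1 ≤ |w.im| := (le_max_left _ _).trans hw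
  have hw2 : K / ε ^ 2 ≤ |w.im| := (le_max_right _ _).trans hw
  set n : ℤ := -⌊w.re + 5 / 4⌋ with hn
  have f1 := Int.floor_le (w.re + 5 / 4)
  have f2 := Int.lt_floor_add_one (w.re + 5 / 4)
  have him : (w + n).im = w.im := by simp
  have hr : (w + n).re = w.re - ⌊w.re + 5 / 4⌋ := by simp [hn]; ring
  have hne : ∀ {u : ℂ}, 1 ≤ |u.im| → ∀ m : ℕ, u ≠ -((m : ℂ) + 1) := fun {u} hu m h => by
    rw [h] at hu
    simp at hu
    norm_num at hu
  have hne' : ∀ {u : ℂ}, 1 ≤ |u.im| → u ≠ -1 / 2 := fun {u} hu h => by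
    rw [h] at hu
    norm_num at hu
  have e : gEntire w = gDefect (w + n) * gWeight (w + n) := by
    -- The bound lives on real parts in $[-\frac54,-\frac14)$, which sticks out of the strip on the
    -- left; there one further shift and the periodicity of the product are used.
    by_cases hc : -1 < (w + n).re
    · rw [gEntire_eq (n := n) ⟨hc, by rw [hr]; linarith⟩, gPeriodic_eq (hne' (by rwa [him]))]
    · rw [gEntire_eq (n := n + 1) ?_, gPeriodic_eq (hne' (by simpa using hw1)), Int.cast_add,
        Int.cast_one, ← add_assoc, gDefect_mul_gWeight (hne (by rwa [him])) (by linarith)]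
      constructor
      · have : (w + ((n + 1 : ℤ) : ℂ)).re = (w + n).re + 1 := by simp; ring
        rw [this, hr]; linarith
      · have : (w + ((n + 1 : ℤ) : ℂ)).re = (w + n).re + 1 := by simp; ring
        rw [this]; linarith
  have hb := H (w + n) (by rw [hr]; linarith) (by rw [hr]; linarith) (by rwa [him])
  rw [← e, him] at hb
  refine (pow_le_pow_iff_left₀ (norm_nonneg _) (by positivity) two_ne_zero).1 (hb.trans ?_)
  rw [mul_pow, div_le_iff₀ (by linarith)]
  rw [div_le_iff₀ (by positivity)] at hw2
  calc _ ≤ (|w.im| * ε ^ 2) * Real.exp (2 * Real.pi * |w.im|) ^ 2 := by gcongr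
    _ = _ := by ring

/-- In the strip this is the constancy of `gEntire`; farther left, the recurrence moves $a$ to the
right by unit steps until the strip is reached. -/
lemma gDefect_mul_gWeight_eq {a : ℂ} (ha : ∀ m : ℕ, a ≠ -((m : ℂ) + 1))
    (hc : Complex.cos (Real.pi * a) ≠ 0) (hre : a.re < 1 / 2) :
    gDefect a * gWeight a = 4 / Complex.Gamma (1 / 2) ^ 3 := by
  have H : ∀ N : ℕ, ∀ a : ℂ, (∀ m : ℕ, a ≠ -((m : ℂ) + 1)) → Complex.cos (Real.pi * a) ≠ 0 →
      a.re < 1 / 2 → -1 - (N : ℝ) < a.re →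
      gDefect a * gWeight a = 4 / Complex.Gamma (1 / 2) ^ 3 := by
    intro N
    induction N with
    | zero =>
      intro a ha hc h1 h2
      have hne : a ≠ -1 / 2 := fun h => half_add_nat_ne_zero hc 0 (by rw [h]; norm_num)
      have hS : a + (0 : ℤ) ∈ gStrip := ⟨by simpa using h2, by simpa using h1⟩
      rw [← gPeriodic_eq hne, ← gEntire_eq_const a, gEntire_eq hS, Int.cast_zero, add_zero]
    | succ N ih =>
      intro a ha hc h1 h2
      push_cast at h2
      by_cases h3 : -1 - (N : ℝ) < a.re
      · exact ih a ha hc h1 h3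
      · have h4 : a.re ≤ -1 := by
          have : (0 : ℝ) ≤ N := N.cast_nonneg
          linarith
        rw [← gDefect_mul_gWeight ha (by linarith)]
        exact ih _ (ne_neg_add_one ha) (by simpa using cos_pi_mul_add_nat_ne_zero hc 1)
          (by simp; linarith) (by simp; linarith)
  obtain ⟨N, hN⟩ := exists_nat_gt (-1 - a.re)
  exact H N a ha hc hre (by linarith)

lemma gSeries_eq {a : ℂ} (ha : ∀ m : ℕ, a ≠ -((m : ℂ) + 1))
    (hc : Complex.cos (Real.pi * a) ≠ 0) (hre : a.re < 1 / 2) :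
    gSeries a = 4 / Real.pi * ((4 : ℂ) ^ a / Complex.cos (Real.pi * a) ^ 2) *
      (riseC 1 a ^ 3 / riseC (1 / 2) a ^ 3) + 16 * a ^ 2 / (2 * a - 1) * ∑' n, wTerm a n := by
  have h := gDefect_mul_gWeight_eq ha hc hre
  have hpi : (Real.pi : ℂ) ≠ 0 := by exact_mod_cast Real.pi_ne_zero
  have hG1 : Complex.Gamma (a + 1 / 2) ≠ 0 :=
    Complex.Gamma_ne_zero fun m hm => half_add_nat_ne_zero hc m (by rw [hm]; ring)
  have hG2 : Complex.Gamma (a + 1) ≠ 0 :=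
    Complex.Gamma_ne_zero fun m hm => add_one_add_nat_ne_zero ha m (by rw [hm]; ring)
  have hG3 : Complex.Gamma (1 / 2) ≠ 0 := by
    intro h0
    have := Gamma_one_half_sq
    rw [h0] at this
    exact hpi (by rw [← this]; norm_num)
  have h4 : (4 : ℂ) ^ a ≠ 0 := by simp [Complex.cpow_eq_zero_iff]
  rw [gWeight_eq (half_add_nat_ne_zero hc), Complex.cpow_neg] at h
  rw [← sub_eq_iff_eq_add, ← wSum, ← gDefect, riseC, riseC, Complex.Gamma_one, add_comm 1 a,
    add_comm (1 / 2) a]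
  have hp := Gamma_one_half_sq
  generalize Complex.Gamma (1 / 2) = p at *
  generalize Complex.Gamma (a + 1 / 2) = x at *
  generalize Complex.Gamma (a + 1) = y at *
  generalize (4 : ℂ) ^ a = q at *
  generalize Complex.cos (Real.pi * a) = c at *
  rw [← hp] at h hpi ⊢
  field_simp at h ⊢
  linear_combination h

lemma fSeries_eq_add {a : ℂ} (ha : ∀ m : ℕ, a ≠ -((m : ℂ) + 1))
    (hc : Complex.cos (Real.pi * a) ≠ 0) (hre : a.re < 1 / 2) :
    fSeries a =
        8 / (Real.pi : ℂ) ^ 2 * ((4 : ℂ) ^ a / Complex.cos (Real.pi * a) ^ 3)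
            * (riseC 1 a ^ 5 / riseC (1 / 2) a ^ 5)
          + 32 / (Real.pi : ℂ) * (1 / Complex.cos (Real.pi * a))
            * (riseC 1 a ^ 2 / riseC (1 / 2) a ^ 2) * (a ^ 2 / (2 * a - 1))
            * ∑' n : ℕ, wTerm a n
          + 32 * a ^ 3 / (2 * a - 1) * ∑' n : ℕ, vTerm a n := by
  rw [fSeries_eq_gSeries_add ha hc, gSeries_eq ha hc hre, gFactor]
  simp only [← div_pow]
  ring

/-! ### The limit at 0 -/

lemma cos_pi_mul_zero_ne_zero : Complex.cos (Real.pi * 0) ≠ 0 := by simp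

lemma differentiableAt_vTerm {a : ℂ} (ha : ∀ m : ℕ, a ≠ -((m : ℂ) + 1)) (hre : a.re < 3 / 2)
    (n : ℕ) : DifferentiableAt ℂ (fun a => vTerm a n) a := by
  have h1 := rise_ne_zero (add_one_add_nat_ne_zero ha) n
  have h1' := rise_ne_zero (three_half_sub_add_nat_ne_zero_of_re hre) n
  have h2 : DifferentiableAt ℂ (fun a => rise (a + 1) n) a :=
    (differentiable_rise n).differentiableAt.comp a (by fun_prop)
  have h3 : DifferentiableAt ℂ (fun a => rise (a + 1 / 2) n) a :=
    (differentiable_rise n).differentiableAt.comp a (by fun_prop)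
  have h4 : DifferentiableAt ℂ (fun a => rise (3 / 2 - a) n) a :=
    (differentiable_rise n).differentiableAt.comp a (by fun_prop)
  unfold vTerm
  exact (h3.const_mul _).div ((h2.pow 2).mul h4) (mul_ne_zero (pow_ne_zero _ h1) h1')

lemma differentiableOn_tsum_vTerm :
    DifferentiableOn ℂ (fun a => ∑' n, vTerm a n) (Metric.ball 0 (1 / 4)) := by
  obtain ⟨u, hu, H⟩ := exists_norm_wTerm_le_boundedStrip 1 (1 / 8) (by norm_num)
  obtain ⟨C, hC, H'⟩ := exists_norm_rise_le 2 (1 / 8) (1 / 4) 0 (by norm_num) (by norm_num)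
  have hre : ∀ z ∈ Metric.ball (0 : ℂ) (1 / 4), |z.re| < 1 / 4 := fun z hz => by
    rw [mem_ball_zero_iff] at hz
    exact (Complex.abs_re_le_norm z).trans_lt hz
  have hmem : ∀ z ∈ Metric.ball (0 : ℂ) (1 / 4), z ∈ boundedStrip 1 (1 / 8) (1 / 2) := fun z hz => by
    have h1 := abs_lt.1 (hre z hz)
    rw [mem_ball_zero_iff] at hz
    exact ⟨by linarith, by linarith, by linarith⟩
  refine Complex.differentiableOn_tsum_of_summable_norm (F := fun n a => vTerm a n)
    (hu.mul_right C) (fun n z hz => ?_) Metric.isOpen_ball (fun n z hz => ?_)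
  · have h1 := abs_lt.1 (hre z hz)
    exact (differentiableAt_vTerm (ne_neg_of_re (by linarith)) (by linarith)
      n).differentiableWithinAt
  · have h1 := abs_lt.1 (hre z hz)
    have hz' := hz
    rw [mem_ball_zero_iff] at hz'
    have e : vTerm z n = wTerm z n * (rise (1 / 2) n / rise (z + 1) n) := by
      rw [vTerm, wTerm, div_mul_div_comm]
      congr 1 <;> ring
    rw [e, norm_mul]
    refine mul_le_mul (H n z (hmem z hz)) ?_ (norm_nonneg _)
      ((norm_nonneg _).trans (H n z (hmem z hz)))
    rw [norm_div]
    refine div_le_of_le_mul₀ (norm_nonneg _) hC.le ?_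
    have := H' (1 / 2) (z + 1) (by norm_num) ((norm_add_le _ _).trans (by norm_num; linarith))
      (by norm_num; linarith) (le_norm_of_mem_boundedStrip (hmem z hz)) n
    simpa using this

lemma rise_half_eq (n : ℕ) : rise (1 / 2) n = n.centralBinom / 4 ^ n * n.factorial := by
  induction n with
  | zero => simp [rise_zero]
  | succ n ih =>
    have h : ((n : ℂ) + 1) * (n + 1).centralBinom = 2 * (2 * n + 1) * n.centralBinom := by
      exact_mod_cast Nat.succ_mul_centralBinom_succ n
    rw [rise_succ, ih, Nat.factorial_succ, pow_succ]
    push_cast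
    field_simp
    linear_combination -2 * (n.factorial : ℂ) * h

lemma rise_three_half (n : ℕ) : rise (3 / 2) n = rise (1 / 2) n * (2 * n + 1) := by
  have := rise_add_one (x := 1 / 2) (by norm_num) n
  rw [show (1 / 2 : ℂ) + 1 = 3 / 2 by norm_num] at this
  rw [this]; ring

lemma rise_half_ne_zero (n : ℕ) : rise (1 / 2) n ≠ 0 := by
  rw [rise_half_eq]
  have h1 : (n.centralBinom : ℂ) ≠ 0 := by exact_mod_cast n.centralBinom_ne_zero
  have h2 : (n.factorial : ℂ) ≠ 0 := by exact_mod_cast n.factorial_ne_zero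
  exact mul_ne_zero (div_ne_zero h1 (pow_ne_zero _ (by norm_num))) h2

lemma vTerm_zero (n : ℕ) : vTerm 0 n = (cTerm n : ℝ) := by
  have h1 := rise_half_ne_zero n
  have hf : (n.factorial : ℂ) ≠ 0 := by exact_mod_cast n.factorial_ne_zero
  have h2 : (2 * (n : ℂ) + 1) ≠ 0 := by exact_mod_cast (by positivity : 2 * n + 1 ≠ 0)
  rw [vTerm, zero_add, zero_add, sub_zero, rise_one, rise_three_half, cTerm]
  push_cast
  rw [← Nat.centralBinom_eq_two_mul_choose, show (16 : ℂ) = 4 ^ 2 by norm_num, ← pow_mul,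
    mul_comm 2 n, pow_mul]
  have e : rise (1 / 2) n ^ 2 * rise (1 / 2) n / ((n.factorial : ℂ) ^ 2 * (rise (1 / 2) n * (2 * n + 1)))
      = rise (1 / 2) n ^ 2 / ((n.factorial : ℂ) ^ 2 * (2 * n + 1)) := by
    generalize rise (1 / 2) n = s at *
    field_simp
  rw [e, rise_half_eq]
  field_simp

lemma summable_cTerm : Summable cTerm := by
  have h := summable_vTerm (a := 0) (ne_neg_of_re (by simp)) cos_pi_mul_zero_ne_zero
  rw [show vTerm 0 = fun n => ((cTerm n : ℝ) : ℂ) from funext vTerm_zero] at h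
  exact Complex.summable_ofReal.1 h

lemma eventually_cos_pi_mul_ne_zero : ∀ᶠ a : ℂ in 𝓝 0, Complex.cos (Real.pi * a) ≠ 0 := by
  have hc : ContinuousAt (fun a : ℂ => Complex.cos (Real.pi * a)) 0 := by fun_prop
  exact hc.eventually_ne cos_pi_mul_zero_ne_zero

lemma tendsto_fSeries_div_sub :
    Tendsto (fun a : ℂ => fSeries a / a ^ 3 - gFactor a * (gSeries a / a ^ 3)) (𝓝[≠] 0)
      (𝓝 (((-32 * ∑' n : ℕ, cTerm n : ℝ)) : ℂ)) := by
  have hV : ContinuousAt (fun a => ∑' n, vTerm a n) 0 :=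
    (differentiableOn_tsum_vTerm.differentiableAt
      (Metric.ball_mem_nhds 0 (by norm_num))).continuousAt
  have hq : ContinuousAt (fun a : ℂ => 32 / (2 * a - 1)) 0 :=
    ContinuousAt.div (by fun_prop) (by fun_prop) (by norm_num)
  have ht : Tendsto (fun a : ℂ => 32 / (2 * a - 1) * ∑' n, vTerm a n) (𝓝 0)
      (𝓝 (32 / (2 * 0 - 1) * ∑' n, vTerm 0 n)) := hq.tendsto.mul hV.tendsto
  have e : (32 / (2 * 0 - 1) * ∑' n, vTerm 0 n : ℂ) = ((-32 * ∑' n : ℕ, cTerm n : ℝ) : ℂ) := by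
    simp_rw [vTerm_zero]
    rw [← Complex.ofReal_tsum]
    push_cast
    ring
  rw [← e]
  refine (ht.mono_left nhdsWithin_le_nhds).congr' ?_
  filter_upwards [nhdsWithin_le_nhds eventually_cos_pi_mul_ne_zero, self_mem_nhdsWithin,
    nhdsWithin_le_nhds ((isOpen_lt continuous_const Complex.continuous_re).mem_nhds
        (show (-1 : ℝ) < (0 : ℂ).re by simp))] with a hc ha hre
  have ha0 : a ≠ 0 := ha
  rw [fSeries_eq_gSeries_add (ne_neg_of_re hre) hc]
  have := two_mul_sub_one_ne_zero hc
  field_simp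
  ring

/-! ### The central binomial sum and Catalan's constant -/

/-- The terms `C(2n,n) C(2n+1,n+M+1) / (16^n (2n+1))`. -/
def oddTerm (M n : ℕ) : ℝ :=
  n.centralBinom * (2 * n + 1).choose (n + M + 1) / (16 ^ n * (2 * n + 1))

/-- The terms `C(2n,n) C(2n,n+M) / (16^n (2n+1))`. -/
def evenTerm (M n : ℕ) : ℝ :=
  n.centralBinom * (2 * n).choose (n + M) / (16 ^ n * (2 * n + 1))

lemma evenTerm_add (M n : ℕ) : evenTerm M n + evenTerm (M + 1) n = oddTerm M n := by
  rw [evenTerm, evenTerm, oddTerm, Nat.choose_succ_succ, ← add_assoc]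
  push_cast
  ring

lemma evenTerm_zero (n : ℕ) : evenTerm 0 n = cTerm n := by
  rw [evenTerm, cTerm, add_zero, Nat.centralBinom_eq_two_mul_choose, pow_two]

lemma evenTerm_nonneg (M n : ℕ) : 0 ≤ evenTerm M n := by
  rw [evenTerm]; positivity

lemma oddTerm_nonneg (M n : ℕ) : 0 ≤ oddTerm M n := by
  rw [oddTerm]; positivity

lemma choose_add_three (M n : ℕ) :
    ((2 * (n + 1) + 1).choose (n + 1 + M + 1) : ℝ) * ((n + M + 2) * (n + 1 - M))
      = (2 * n + 3) * (2 * n + 2) * (2 * n + 1).choose (n + M + 1) := by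
  have h1 : ((2 * (n + 1) + 1).choose (n + 1 + M + 1) : ℝ) * (n + M + 2)
      = (2 * n + 3) * (2 * n + 2).choose (n + M + 1) := by
    have := Nat.add_one_mul_choose_eq (2 * n + 2) (n + M + 1)
    rw [show 2 * (n + 1) + 1 = 2 * n + 2 + 1 by ring, show n + 1 + M + 1 = n + M + 1 + 1 by ring]
    have h := congrArg (Nat.cast : ℕ → ℝ) this
    push_cast at h
    linear_combination -h
  have h2 : ((2 * n + 1).choose (n + M + 1) : ℝ) * (2 * n + 2)
      = (2 * n + 2).choose (n + M + 1) * (n + 1 - M) := by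
    have := Nat.choose_mul_succ_eq (2 * n + 1) (n + M + 1)
    have h := congrArg (Nat.cast : ℕ → ℝ) this
    rcases le_or_gt M (n + 1) with hM | hM
    · rw [show 2 * n + 1 + 1 - (n + M + 1) = n + 1 - M by omega] at h
      push_cast [Nat.cast_sub hM] at h
      linear_combination h
    · rw [Nat.choose_eq_zero_of_lt (by omega : 2 * n + 1 < n + M + 1),
        Nat.choose_eq_zero_of_lt (by omega : 2 * n + 2 < n + M + 1)]
      simp
  linear_combination (n + 1 - M : ℝ) * h1 - (2 * n + 3 : ℝ) * h2

lemma oddTerm_succ (M n : ℕ) :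
    oddTerm M (n + 1) * ((n + M + 2) * (n + 1 - M)) = oddTerm M n * (n + 1 / 2) ^ 2 := by
  have h1 := choose_add_three M n
  have h2 : ((n : ℝ) + 1) * (n + 1).centralBinom = 2 * (2 * n + 1) * n.centralBinom := by
    exact_mod_cast Nat.succ_mul_centralBinom_succ n
  have h2' : ((n + 1).centralBinom : ℝ) = 2 * (2 * n + 1) * n.centralBinom / (n + 1) := by
    field_simp; linear_combination h2
  rw [oddTerm, oddTerm, div_mul_eq_mul_div, mul_assoc, h1, h2', pow_succ]
  push_cast
  field_simp
  ring

lemma centralBinom_sq_eq (n : ℕ) :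
    (n.centralBinom : ℝ) ^ 2 / 16 ^ n * (2 * n + 1) = (Real.Wallis.W n)⁻¹ := by
  induction n with
  | zero => simp [Real.Wallis.W]
  | succ n ih =>
    have h2 : ((n : ℝ) + 1) * (n + 1).centralBinom = 2 * (2 * n + 1) * n.centralBinom := by
      exact_mod_cast Nat.succ_mul_centralBinom_succ n
    have h2' : ((n + 1).centralBinom : ℝ) = 2 * (2 * n + 1) * n.centralBinom / (n + 1) := by
      field_simp; linear_combination h2
    rw [Real.Wallis.W_succ, mul_inv, ← ih, h2', pow_succ]
    push_cast
    field_simp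
    ring

/-- For $M=0$ this is Wallis' product; raising $M$ multiplies by $(n-M)/(n+M+2)\to1$, so the limit
does not depend on $M$. -/
lemma tendsto_oddTerm (M : ℕ) :
    Tendsto (fun n : ℕ => oddTerm M n * (2 * n + 1) ^ 2) atTop (𝓝 (4 / Real.pi)) := by
  have hi : Tendsto (fun n : ℕ => ((n : ℝ))⁻¹) atTop (𝓝 0) := tendsto_inv_atTop_nhds_zero_nat
  induction M with
  | zero =>
    have h1 := Real.Wallis.tendsto_W_nhds_pi_div_two.inv₀ (by positivity)
    have h2 : Tendsto (fun n : ℕ => (2 + (n : ℝ)⁻¹) / (1 + (n : ℝ)⁻¹)) atTop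
        (𝓝 ((2 + 0) / (1 + 0))) := (hi.const_add 2).div (hi.const_add 1) (by norm_num)
    have h3 := h1.mul h2
    rw [show (Real.pi / 2)⁻¹ * ((2 + 0) / (1 + 0)) = 4 / Real.pi by field_simp; norm_num] at h3
    refine h3.congr' ?_
    filter_upwards [eventually_ge_atTop 1] with n hn
    have hn0 : (n : ℝ) ≠ 0 := by exact_mod_cast (by omega : n ≠ 0)
    have h4 : ((2 * n + 1).choose (n + 1) : ℝ) = (2 * n + 1) * n.centralBinom / (n + 1) := by
      have := Nat.add_one_mul_choose_eq (2 * n) n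
      have h := congrArg (Nat.cast : ℕ → ℝ) this
      rw [Nat.centralBinom_eq_two_mul_choose]
      push_cast at h
      field_simp
      linear_combination -h
    rw [← centralBinom_sq_eq, oddTerm, add_zero, h4]
    have : (1 : ℝ) + (n : ℝ)⁻¹ = (n + 1) / n := by field_simp
    rw [this]
    field_simp
  | succ M ih =>
    have h2 : Tendsto (fun n : ℕ => (1 - M * (n : ℝ)⁻¹) / (1 + (M + 2) * (n : ℝ)⁻¹)) atTop
        (𝓝 ((1 - M * 0) / (1 + (M + 2) * 0))) :=
      ((hi.const_mul _).const_sub 1).div ((hi.const_mul _).const_add 1) (by norm_num)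
    have h3 := ih.mul h2
    rw [show 4 / Real.pi * ((1 - (M : ℝ) * 0) / (1 + (M + 2) * 0)) = 4 / Real.pi by simp] at h3
    refine h3.congr' ?_
    filter_upwards [eventually_ge_atTop (M + 1)] with n hn
    have hn0 : (n : ℝ) ≠ 0 := by exact_mod_cast (by omega : n ≠ 0)
    have h4 : ((2 * n + 1).choose (n + (M + 1) + 1) : ℝ)
        = (2 * n + 1).choose (n + M + 1) * (n - M) / (n + M + 2) := by
      have := Nat.choose_succ_right_eq (2 * n + 1) (n + M + 1)
      have h := congrArg (Nat.cast : ℕ → ℝ) this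
      rw [show 2 * n + 1 - (n + M + 1) = n - M by omega] at h
      push_cast [Nat.cast_sub (by omega : M ≤ n)] at h
      rw [eq_div_iff (by positivity), ← h, show n + (M + 1) + 1 = n + M + 1 + 1 by ring]
      ring
    rw [oddTerm, oddTerm, h4]
    have e1 : (1 : ℝ) + (M + 2) * (n : ℝ)⁻¹ = (n + M + 2) / n := by field_simp; ring
    have e2 : (1 : ℝ) - M * (n : ℝ)⁻¹ = (n - M) / n := by field_simp
    rw [e1, e2]
    field_simp

lemma hasSum_oddTerm (M : ℕ) : HasSum (oddTerm M) (4 / Real.pi * (1 / (2 * (M : ℝ) + 1) ^ 2)) := by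
  -- The telescoping rests on $(n+\frac12)^2-(n-M)(n+M+1)=(M+\frac12)^2$. At $n=0$ it vanishes
  -- through the factor $n-M$ if $M=0$ and through the binomial coefficient otherwise.
  set Z : ℕ → ℝ := fun n => oddTerm M n * ((n - M) * (n + M + 1)) / (M + 1 / 2) ^ 2 with hZ
  have hM : ((M : ℝ) + 1 / 2) ≠ 0 := by positivity
  have hZs : ∀ n, Z (n + 1) = oddTerm M n * (n + 1 / 2) ^ 2 / (M + 1 / 2) ^ 2 := fun n => by
    rw [← oddTerm_succ]; simp only [hZ]; push_cast; ring
  have hstep : ∀ n, oddTerm M n = Z (n + 1) - Z n := fun n => by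
    rw [hZs]; simp only [hZ]; field_simp; ring
  have hZ0 : Z 0 = 0 := by
    rcases Nat.eq_zero_or_pos M with rfl | hM
    · simp [hZ]
    · have : oddTerm M 0 = 0 := by
        rw [oddTerm, Nat.choose_eq_zero_of_lt (by omega)]; simp
      simp only [hZ, this]; simp
  rw [hasSum_iff_tendsto_nat_of_nonneg (oddTerm_nonneg M)]
  have hsum : ∀ n, ∑ i ∈ Finset.range n, oddTerm M i = Z n := fun n => by
    rw [Finset.sum_congr rfl fun i _ => hstep i, Finset.sum_range_sub, hZ0, sub_zero]
  simp_rw [hsum]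
  rw [← tendsto_add_atTop_iff_nat 1]
  simp_rw [hZs]
  have h := (tendsto_oddTerm M).mul_const (1 / (2 * (M : ℝ) + 1) ^ 2)
  refine h.congr fun n => ?_
  have : (2 * (M : ℝ) + 1) ≠ 0 := by positivity
  rw [show (M : ℝ) + 1 / 2 = (2 * M + 1) / 2 by ring]
  field_simp

lemma summable_evenTerm (M : ℕ) : Summable (evenTerm M) :=
  .of_nonneg_of_le (evenTerm_nonneg M) (fun n => by
    rw [← evenTerm_add]; linarith [evenTerm_nonneg (M + 1) n]) (hasSum_oddTerm M).summable

/-- By Pascal's rule the sums $Y_M$ of `evenTerm` satisfy $Y_M+Y_{M+1}=\frac4\pi(2M+1)^{-2}$.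
Alternating in $M$ produces Catalan's series, and the remainder $\pm Y_N$ tends to $0$ because
nonnegativity bounds $Y_N$ by the same right-hand side. -/
lemma tsum_cTerm : ∑' n, cTerm n = 4 * (catalanConst / Real.pi) := by
  set Y : ℕ → ℝ := fun M => ∑' n, evenTerm M n with hY
  have hY0 : Y 0 = ∑' n, cTerm n := tsum_congr evenTerm_zero
  have hYs : ∀ M, Y M + Y (M + 1) = 4 / Real.pi * (1 / (2 * (M : ℝ) + 1) ^ 2) := fun M => by
    rw [hY, ← (summable_evenTerm M).tsum_add (summable_evenTerm (M + 1)),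
      ← (hasSum_oddTerm M).tsum_eq]
    exact tsum_congr (evenTerm_add M)
  have hYnn : ∀ M, 0 ≤ Y M := fun M => tsum_nonneg (evenTerm_nonneg M)
  have hpart : ∀ N, Y 0 = 4 / Real.pi * ∑ M ∈ Finset.range N, (-1 : ℝ) ^ M / (2 * (M : ℝ) + 1) ^ 2
      + (-1) ^ N * Y N := by
    intro N
    induction N with
    | zero => simp
    | succ N ih =>
      rw [Finset.sum_range_succ, ih, pow_succ]
      have := hYs N
      linear_combination (-1 : ℝ) ^ N * this
  have hle : ∀ M : ℕ, 1 / (2 * (M : ℝ) + 1) ^ 2 ≤ 1 / ((M : ℝ) + 1) ^ 2 := fun M => by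
    have : (0 : ℝ) ≤ M := M.cast_nonneg
    gcongr; linarith
  have hs1 : Summable fun n : ℕ => 1 / ((n : ℝ) + 1) ^ 2 := by
    have := (summable_nat_add_iff 1).2 (Real.summable_one_div_nat_pow (p := 2).2 (by norm_num))
    simpa using this
  have hYt : Tendsto (fun N => (-1 : ℝ) ^ N * Y N) atTop (𝓝 0) := by
    refine squeeze_zero_norm (a := fun N : ℕ => 4 / Real.pi * (1 / ((N : ℝ) + 1) ^ 2)) (fun N => ?_) ?_
    · rw [norm_mul, norm_pow, norm_neg, norm_one, one_pow, one_mul, Real.norm_eq_abs,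
        abs_of_nonneg (hYnn N)]
      have h1 := hYs N
      have h2 := hYnn (N + 1)
      have h3 := hle N
      have h4 : 0 < 4 / Real.pi := by positivity
      nlinarith
    · simpa using hs1.tendsto_atTop_zero.const_mul (4 / Real.pi)
  have hs2 : Summable fun n : ℕ => (-1 : ℝ) ^ n / (2 * (n : ℝ) + 1) ^ 2 :=
    .of_norm_bounded hs1 fun n => by
      rw [norm_div, norm_pow, norm_neg, norm_one, one_pow, Real.norm_eq_abs,
        abs_of_pos (by positivity)]
      exact hle n
  have ht := (hs2.hasSum.tendsto_sum_nat.const_mul (4 / Real.pi)).add hYt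
  simp_rw [← hpart] at ht
  have := tendsto_nhds_unique tendsto_const_nhds ht
  rw [← hY0, this, ← catalanConst]
  ring

/-! ### The value of the series of `wTerm` at 0 -/

/-- The terms `(1/2)_n^2 / (n! (c)_n)` of the hypergeometric series `F(1/2, 1/2; c; 1)`. -/
def gaussTerm (c : ℝ) (n : ℕ) : ℝ :=
  ∏ i ∈ Finset.range n, ((i : ℝ) + 1 / 2) ^ 2 / ((i + 1) * (c + i))

lemma gaussTerm_zero (c : ℝ) : gaussTerm c 0 = 1 := by simp [gaussTerm]

lemma gaussTerm_succ (c : ℝ) (n : ℕ) :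
    gaussTerm c (n + 1) = gaussTerm c n * (((n : ℝ) + 1 / 2) ^ 2 / ((n + 1) * (c + n))) := by
  rw [gaussTerm, Finset.prod_range_succ, gaussTerm]

lemma gaussTerm_pos {c : ℝ} (hc : 0 < c) (n : ℕ) : 0 < gaussTerm c n :=
  Finset.prod_pos fun i _ => by positivity

lemma wTerm_zero (n : ℕ) : wTerm 0 n = (gaussTerm (3 / 2) n : ℝ) := by
  have key : ∀ n, rise (1 / 2) n * rise (1 / 2) n
      = (gaussTerm (3 / 2) n : ℝ) * (rise 1 n * rise (3 / 2) n) := fun n => by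
    induction n with
    | zero => simp [rise_zero, gaussTerm_zero]
    | succ n ih =>
      rw [gaussTerm_succ, rise_succ, rise_succ, rise_succ]
      have h1 : ((n : ℂ) + 1) ≠ 0 := by exact_mod_cast n.succ_ne_zero
      have h2 : ((3 : ℂ) / 2 + n) ≠ 0 := by
        simpa using three_half_sub_add_nat_ne_zero_of_re (a := 0) (by simp) n
      push_cast
      generalize rise (1 / 2) n = x at *
      generalize rise (3 / 2) n = y at *
      generalize rise 1 n = z at *
      have e : ((n : ℂ) + 1 / 2) ^ 2 / ((n + 1) * (3 / 2 + n)) * ((1 + n) * (3 / 2 + n))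
          = (1 / 2 + n) ^ 2 := by
        rw [add_comm 1 (n : ℂ), div_mul_cancel₀ _ (mul_ne_zero h1 h2)]; ring
      linear_combination (1 / 2 + (n : ℂ)) ^ 2 * ih - (gaussTerm (3 / 2) n : ℝ) * (z * y) * e
  rw [wTerm, zero_add, zero_add, sub_zero, key, mul_div_cancel_right₀]
  refine mul_ne_zero ?_ ?_
  · rw [rise_one]; exact_mod_cast n.factorial_ne_zero
  · refine rise_ne_zero (fun j => ?_) n
    simpa using three_half_sub_add_nat_ne_zero_of_re (a := 0) (by simp) j

lemma gaussTerm_le {c : ℝ} (hc : 3 / 2 ≤ c) (n : ℕ) : gaussTerm c n ≤ gaussTerm (3 / 2) n :=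
  Finset.prod_le_prod (fun i _ => by have : 0 < c := by linarith
                                     positivity) fun i _ => by gcongr

/-- The factor of index 0 alone yields $\frac32/c$, so everything after the leading term is
$O(1/c)$. -/
lemma gaussTerm_succ_le {c : ℝ} (hc : 3 / 2 ≤ c) (n : ℕ) :
    gaussTerm c (n + 1) ≤ 3 / 2 / c * gaussTerm (3 / 2) (n + 1) := by
  have hc0 : 0 < c := by linarith
  induction n with
  | zero =>
    simp only [gaussTerm_succ, gaussTerm_zero]
    apply le_of_eq
    field_simp
    norm_num
  | succ n ih =>
    rw [gaussTerm_succ c, gaussTerm_succ (3 / 2) (n + 1), ← mul_assoc]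
    exact mul_le_mul ih (by gcongr) (by positivity)
      (mul_nonneg (by positivity) (gaussTerm_pos (by norm_num) _).le)

lemma gaussTerm_add_one {c : ℝ} (hc : 0 < c) (n : ℕ) :
    gaussTerm (c + 1) n = gaussTerm c n * (c / (c + n)) := by
  induction n with
  | zero => simp [gaussTerm_zero, hc.ne']
  | succ n ih =>
    rw [gaussTerm_succ, gaussTerm_succ, ih]
    have h1 : c + 1 + n ≠ 0 := by positivity
    have h2 : c + (n + 1) ≠ 0 := by positivity
    push_cast
    rw [show c + 1 + (n : ℝ) = c + (n + 1) by ring]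
    field_simp

lemma summable_gaussTerm {c : ℝ} (hc : 3 / 2 ≤ c) : Summable (gaussTerm c) := by
  have h := summable_wTerm (a := 0) (ne_neg_of_re (by simp)) (by simp)
  rw [show wTerm 0 = fun n => ((gaussTerm (3 / 2) n : ℝ) : ℂ) from funext wTerm_zero] at h
  exact .of_nonneg_of_le (fun n => (gaussTerm_pos (by linarith) n).le) (gaussTerm_le hc)
    (Complex.summable_ofReal.1 h)

lemma gaussTerm_three_half (n : ℕ) :
    gaussTerm (3 / 2) n = n.centralBinom / 4 ^ n / (2 * n + 1) := by
  induction n with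
  | zero => simp [gaussTerm_zero]
  | succ n ih =>
    have h2 : ((n : ℝ) + 1) * (n + 1).centralBinom = 2 * (2 * n + 1) * n.centralBinom := by
      exact_mod_cast Nat.succ_mul_centralBinom_succ n
    have h2' : ((n + 1).centralBinom : ℝ) = 2 * (2 * n + 1) * n.centralBinom / (n + 1) := by
      field_simp; linear_combination h2
    rw [gaussTerm_succ, ih, h2', pow_succ]
    push_cast
    field_simp
    ring

lemma tendsto_nat_mul_gaussTerm {c : ℝ} (hc : 3 / 2 ≤ c) :
    Tendsto (fun n : ℕ => (n : ℝ) * gaussTerm c n) atTop (𝓝 0) := by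
  have hpos := fun n => gaussTerm_pos (c := c) (by linarith) n
  have h1 : Tendsto (fun n : ℕ => 2 / ((n : ℝ) + 1)) atTop (𝓝 0) :=
    tendsto_const_div_atTop_nhds_zero_nat 2 |>.comp (tendsto_add_atTop_nat 1) |>.congr fun n => by
      simp
  have h2 : Tendsto (fun n : ℕ => √(2 / ((n : ℝ) + 1))) atTop (𝓝 0) := by
    simpa using h1.sqrt
  refine squeeze_zero (fun n => mul_nonneg n.cast_nonneg (hpos n).le) (fun n => ?_) h2
  have hW : 1 / 2 ≤ Real.Wallis.W n := by
    refine le_trans ?_ (Real.Wallis.le_W n)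
    have : (1 : ℝ) / 2 ≤ (2 * n + 1) / (2 * n + 2) := by
      rw [div_le_div_iff₀ (by norm_num) (by positivity)]
      have : (0 : ℝ) ≤ n := n.cast_nonneg
      linarith
    have := Real.pi_gt_three
    nlinarith
  have hb : ((n.centralBinom : ℝ) / 4 ^ n) ^ 2 * (2 * n + 1) ≤ 2 := by
    rw [div_pow, ← pow_mul, mul_comm n 2, pow_mul, show (4 : ℝ) ^ 2 = 16 by norm_num,
      centralBinom_sq_eq]
    exact (inv_anti₀ (by norm_num) hW).trans (by norm_num)
  have hle : (n : ℝ) * gaussTerm c n ≤ n.centralBinom / 4 ^ n := by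
    refine (mul_le_mul_of_nonneg_left (gaussTerm_le hc n) n.cast_nonneg).trans ?_
    rw [gaussTerm_three_half, mul_div_assoc', div_le_iff₀ (by positivity), mul_comm]
    gcongr
    have : (0 : ℝ) ≤ n := n.cast_nonneg
    linarith
  refine hle.trans (Real.le_sqrt_of_sq_le ?_)
  rw [le_div_iff₀ (by positivity)]
  refine le_trans ?_ hb
  gcongr
  have : (0 : ℝ) ≤ n := n.cast_nonneg
  linarith

/-- Gauss's contiguous relation in $c$; the combination of terms telescopes with $-c\,n$ times the
$n$-th term, which vanishes at both ends. -/
lemma tsum_gaussTerm_eq {c : ℝ} (hc : 3 / 2 ≤ c) :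
    c * (c - 1) * ∑' n, gaussTerm c n = (c - 1 / 2) ^ 2 * ∑' n, gaussTerm (c + 1) n := by
  have hc0 : 0 < c := by linarith
  have hs := ((summable_gaussTerm hc).hasSum.mul_left (c * (c - 1))).sub
    ((summable_gaussTerm (c := c + 1) (by linarith)).hasSum.mul_left ((c - 1 / 2) ^ 2))
  have hstep : ∀ n, c * (c - 1) * gaussTerm c n - (c - 1 / 2) ^ 2 * gaussTerm (c + 1) n
      = -c * (((n + 1 : ℕ) : ℝ) * gaussTerm c (n + 1)) - -c * (n * gaussTerm c n) := fun n => by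
    rw [gaussTerm_add_one hc0, gaussTerm_succ]
    push_cast
    field_simp
    ring
  have ht := (tendsto_nat_mul_gaussTerm hc).const_mul (-c)
  have hp := hs.tendsto_sum_nat
  simp_rw [hstep, Finset.sum_range_sub (fun n : ℕ => -c * (n * gaussTerm c n))] at hp
  have := tendsto_nhds_unique hp (by simpa using ht)
  linarith

/-- For $c=\frac32+N$ the contiguity factor is $(N+1)^2/((N+\frac32)(N+\frac12))$, exactly one
factor of Wallis' product. As $N\to\infty$ the remaining series tends to 1, which gives $\frac\pi2$.
-/
lemma tsum_gaussTerm_eq_wallis (N : ℕ) :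
    ∑' n, gaussTerm (3 / 2) n = Real.Wallis.W N * ∑' n, gaussTerm (3 / 2 + N) n := by
  induction N with
  | zero => simp [Real.Wallis.W]
  | succ N ih =>
    have hN : (0 : ℝ) ≤ N := N.cast_nonneg
    have h := tsum_gaussTerm_eq (c := 3 / 2 + N) (by linarith)
    rw [ih, Real.Wallis.W_succ]
    push_cast
    rw [← add_assoc]
    generalize ∑' n, gaussTerm (3 / 2 + N) n = x at *
    generalize ∑' n, gaussTerm (3 / 2 + N + 1) n = y at *
    have e : x = ((N : ℝ) + 1) ^ 2 / ((3 / 2 + N) * (N + 1 / 2)) * y := by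
      rw [div_mul_eq_mul_div, eq_div_iff (by positivity)]
      linear_combination h
    rw [e]
    field_simp
    ring

lemma tendsto_tsum_gaussTerm :
    Tendsto (fun N : ℕ => ∑' n, gaussTerm (3 / 2 + N) n) atTop (𝓝 1) := by
  have hs : ∀ N : ℕ, Summable (gaussTerm (3 / 2 + N)) := fun N =>
    summable_gaussTerm (by have : (0 : ℝ) ≤ N := N.cast_nonneg
                           linarith)
  have hs0 : Summable fun n => gaussTerm (3 / 2) (n + 1) :=
    (summable_nat_add_iff 1).2 (summable_gaussTerm le_rfl)
  have e : ∀ N : ℕ, ∑' n, gaussTerm (3 / 2 + N) n = 1 + ∑' n, gaussTerm (3 / 2 + N) (n + 1) :=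
    fun N => by rw [(hs N).tsum_eq_zero_add, gaussTerm_zero]
  have ht : Tendsto (fun N : ℕ => 3 / 2 / (3 / 2 + (N : ℝ))) atTop (𝓝 0) :=
    tendsto_const_nhds.div_atTop (tendsto_atTop_add_const_left _ _ tendsto_natCast_atTop_atTop)
  have ht2 := ht.mul_const (∑' n, gaussTerm (3 / 2) (n + 1))
  rw [zero_mul] at ht2
  have h0 : Tendsto (fun N : ℕ => ∑' n, gaussTerm (3 / 2 + N) (n + 1)) atTop (𝓝 0) := by
    refine squeeze_zero (fun N => tsum_nonneg fun n => (gaussTerm_pos (by positivity) _).le)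
      (fun N => ?_) ht2
    rw [← tsum_mul_left]
    exact ((summable_nat_add_iff 1).2 (hs N)).tsum_le_tsum (fun n => gaussTerm_succ_le (by
      have : (0 : ℝ) ≤ N := N.cast_nonneg
      linarith) n) (hs0.mul_left _)
  simp_rw [e]
  simpa using h0.const_add 1

lemma tsum_wTerm_zero : ∑' n, wTerm 0 n = Real.pi / 2 := by
  have h := Real.Wallis.tendsto_W_nhds_pi_div_two.mul tendsto_tsum_gaussTerm
  simp_rw [← tsum_gaussTerm_eq_wallis] at h
  have h' := tendsto_nhds_unique tendsto_const_nhds h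
  simp_rw [wTerm_zero]
  rw [← Complex.ofReal_tsum, h']
  push_cast
  ring

/-! ### Second-order Taylor arithmetic at 0 -/

/-- `f` is analytic at `0`, and `c₀`, `c₁`, `c₂` are its value and its first two derivatives. -/
structure HasJet (f : ℂ → ℂ) (c₀ c₁ c₂ : ℂ) : Prop where
  analyticAt : AnalyticAt ℂ f 0
  eq_zero : f 0 = c₀
  deriv_eq : deriv f 0 = c₁
  deriv_deriv_eq : deriv (deriv f) 0 = c₂

namespace HasJet

variable {f g : ℂ → ℂ} {c₀ c₁ c₂ d₀ d₁ d₂ : ℂ}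

lemma of_analyticAt (h : AnalyticAt ℂ f 0) : HasJet f (f 0) (deriv f 0) (deriv (deriv f) 0) :=
  ⟨h, rfl, rfl, rfl⟩

lemma congr (h : HasJet f c₀ c₁ c₂) (e : f =ᶠ[𝓝 0] g) : HasJet g c₀ c₁ c₂ :=
  ⟨h.1.congr e, e.eq_of_nhds ▸ h.2, e.deriv_eq ▸ h.3, e.deriv.deriv_eq ▸ h.4⟩

lemma const (c : ℂ) : HasJet (fun _ => c) c 0 0 := by
  refine ⟨analyticAt_const, rfl, by simp, by simp⟩

lemma id : HasJet (fun z => z) 0 1 0 := by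
  refine ⟨analyticAt_id, rfl, by simp, by simp⟩

lemma add (hf : HasJet f c₀ c₁ c₂) (hg : HasJet g d₀ d₁ d₂) :
    HasJet (fun z => f z + g z) (c₀ + d₀) (c₁ + d₁) (c₂ + d₂) := by
  have e : deriv (fun z => f z + g z) =ᶠ[𝓝 0] fun z => deriv f z + deriv g z := by
    filter_upwards [hf.1.eventually_analyticAt, hg.1.eventually_analyticAt] with z h1 h2
    exact deriv_fun_add h1.differentiableAt h2.differentiableAt
  refine ⟨hf.1.add hg.1, by rw [hf.2, hg.2], by rw [e.eq_of_nhds, hf.3, hg.3], ?_⟩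
  rw [e.deriv_eq, deriv_fun_add hf.1.deriv.differentiableAt hg.1.deriv.differentiableAt, hf.4, hg.4]

lemma mul (hf : HasJet f c₀ c₁ c₂) (hg : HasJet g d₀ d₁ d₂) :
    HasJet (fun z => f z * g z) (c₀ * d₀) (c₁ * d₀ + c₀ * d₁)
      (c₂ * d₀ + 2 * c₁ * d₁ + c₀ * d₂) := by
  have e : deriv (fun z => f z * g z) =ᶠ[𝓝 0] fun z => deriv f z * g z + f z * deriv g z := by
    filter_upwards [hf.1.eventually_analyticAt, hg.1.eventually_analyticAt] with z h1 h2
    exact deriv_fun_mul h1.differentiableAt h2.differentiableAt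
  have f0 := hf.1.differentiableAt
  have g0 := hg.1.differentiableAt
  have f1 := hf.1.deriv.differentiableAt
  have g1 := hg.1.deriv.differentiableAt
  refine ⟨hf.1.mul hg.1, by rw [hf.2, hg.2], by rw [e.eq_of_nhds, hf.2, hg.2, hf.3, hg.3], ?_⟩
  rw [e.deriv_eq, deriv_fun_add (f1.fun_mul g0) (f0.fun_mul g1), deriv_fun_mul f1 g0, deriv_fun_mul f0 g1,
    hf.2, hg.2, hf.3, hg.3, hf.4, hg.4]
  ring

lemma comp_mul_left (hf : HasJet f c₀ c₁ c₂) (c : ℂ) :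
    HasJet (fun z => f (c * z)) c₀ (c * c₁) (c ^ 2 * c₂) := by
  have e : deriv (fun z => f (c * z)) = fun z => c * deriv f (c * z) :=
    funext fun z => by rw [deriv_comp_mul_left, smul_eq_mul]
  refine ⟨?_, by simp [hf.2], by rw [e]; simp [hf.3], ?_⟩
  · exact AnalyticAt.fun_comp (by simpa using hf.1) (by fun_prop)
  · have h := hf.1.deriv.differentiableAt
    have h' : DifferentiableAt ℂ (fun z => deriv f (c * z)) 0 :=
      (AnalyticAt.fun_comp (g := deriv f) (f := fun z => c * z) (by simpa using hf.1.deriv)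
        (by fun_prop)).differentiableAt
    rw [e, deriv_const_mul _ h', deriv_comp_mul_left, smul_eq_mul, mul_zero, hf.4]
    ring

/-- Two computations of the same jet turn a functional equation into equations for unknown
derivatives. -/
lemma unique (hf : HasJet f c₀ c₁ c₂) (hg : HasJet f d₀ d₁ d₂) : c₀ = d₀ ∧ c₁ = d₁ ∧ c₂ = d₂ :=
  ⟨hf.2.symm.trans hg.2, hf.3.symm.trans hg.3, hf.4.symm.trans hg.4⟩

end HasJet

lemma hasJet_four_cpow :
    HasJet (fun z : ℂ => (4 : ℂ) ^ z) 1 (Complex.log 4) (Complex.log 4 ^ 2) := by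
  have hd : ∀ z : ℂ, HasDerivAt (fun z => (4 : ℂ) ^ z) (Complex.log 4 * (4 : ℂ) ^ z) z := fun z => by
    simpa [mul_comm] using (hasDerivAt_id z).const_cpow (c := 4) (Or.inl (by norm_num))
  have e : deriv (fun z : ℂ => (4 : ℂ) ^ z) = fun z => Complex.log 4 * (4 : ℂ) ^ z :=
    funext fun z => (hd z).deriv
  have hD : Differentiable ℂ fun z : ℂ => (4 : ℂ) ^ z := fun z => (hd z).differentiableAt
  refine ⟨hD.analyticAt 0, by simp, by simp [e], ?_⟩
  rw [e, ((hd 0).const_mul _).deriv]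
  simp [pow_two]

lemma hasJet_cos : HasJet (fun z => Complex.cos (Real.pi * z)) 1 0 (-(Real.pi : ℂ) ^ 2) := by
  have h : HasJet Complex.cos 1 0 (-1) := by
    refine ⟨Complex.differentiable_cos.analyticAt 0, by simp, by simp, ?_⟩
    rw [Complex.deriv_cos', deriv.fun_neg, Complex.deriv_sin]
    simp
  simpa using h.comp_mul_left Real.pi

lemma riseC_zero {c : ℂ} (hc : 0 < c.re) : riseC c 0 = 1 := by
  rw [riseC, add_zero, div_self (Complex.Gamma_ne_zero_of_re_pos hc)]

lemma riseC_half_ne_zero {z : ℂ} (hz : |z.re| < 1 / 4) : riseC (1 / 2) z ≠ 0 := by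
  have h := abs_lt.1 hz
  refine div_ne_zero (Complex.Gamma_ne_zero_of_re_pos ?_) (Complex.Gamma_ne_zero_of_re_pos ?_) <;>
    norm_num
  linarith

lemma eventually_abs_re_lt : ∀ᶠ z : ℂ in 𝓝 0, |z.re| < 1 / 4 := by
  have h : ContinuousAt (fun z : ℂ => |z.re|) 0 := by fun_prop
  exact h.eventually_lt continuousAt_const (by simp)

lemma analyticAt_riseC {c : ℂ} (hc : 0 < c.re) : AnalyticAt ℂ (riseC c) 0 := by
  rw [Complex.analyticAt_iff_eventually_differentiableAt]
  have h : ContinuousAt (fun z : ℂ => (c + z).re) 0 := by fun_prop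
  filter_upwards [h.eventually (lt_mem_nhds (by simpa using hc))] with z hz
  have h1 : DifferentiableAt ℂ Complex.Gamma (c + z) := by
    refine Complex.differentiableAt_Gamma _ fun m e => ?_
    rw [e] at hz
    have : (0 : ℝ) ≤ m := m.cast_nonneg
    simp at hz
    linarith
  exact (h1.comp z (by fun_prop : DifferentiableAt ℂ (fun z => c + z) z)).div_const _

lemma hasJet_riseC {c : ℂ} (hc : 0 < c.re) :
    HasJet (riseC c) 1 (deriv (riseC c) 0) (deriv (deriv (riseC c)) 0) := by
  simpa only [riseC_zero hc] using HasJet.of_analyticAt (analyticAt_riseC hc)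

lemma four_cpow_mul_riseC (z : ℂ) : (4 : ℂ) ^ z * (riseC (1 / 2) z * riseC 1 z) = riseC 1 (2 * z) := by
  have h := Complex.Gamma_mul_Gamma_add_half (1 / 2 + z)
  have h0 := Complex.Gamma_mul_Gamma_add_half (1 / 2)
  have hne : Complex.Gamma (1 / 2) ≠ 0 := Complex.Gamma_ne_zero_of_re_pos (by norm_num)
  rw [show (1 / 2 : ℂ) + 1 / 2 = 1 by norm_num, show (2 : ℂ) * (1 / 2) = 1 by norm_num, sub_self,
    Complex.cpow_zero, Complex.Gamma_one, mul_one, one_mul, one_mul] at h0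
  rw [show (1 / 2 : ℂ) + z + 1 / 2 = 1 + z by ring, show 2 * (1 / 2 + z) = 1 + 2 * z by ring,
    show 1 - (1 + 2 * z) = -((2 : ℕ) * z) by push_cast; ring, Complex.cpow_neg, ← h0] at h
  have e : (2 : ℂ) ^ (((2 : ℕ) : ℂ) * z) = (4 : ℂ) ^ z := by
    rw [show (4 : ℂ) = ((2 : ℝ) : ℂ) * ((2 : ℝ) : ℂ) by norm_num,
      Complex.mul_cpow_ofReal_nonneg (by norm_num) (by norm_num), ← Complex.cpow_add _ _ (by norm_num)]
    push_cast
    ring_nf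
  have h4 : (4 : ℂ) ^ z ≠ 0 := by simp [Complex.cpow_eq_zero_iff]
  rw [e] at h
  rw [riseC, riseC, riseC, Complex.Gamma_one, div_one, div_one, div_mul_eq_mul_div, h]
  field_simp

lemma riseC_half_mul_riseC_half_neg (z : ℂ) :
    riseC (1 / 2) z * riseC (1 / 2) (-1 * z) = (Complex.cos (Real.pi * z))⁻¹ := by
  have h := Gamma_half_add_mul_Gamma_half_sub z
  have hp := Gamma_one_half_sq
  have hpi : (Real.pi : ℂ) ≠ 0 := by exact_mod_cast Real.pi_ne_zero
  rw [riseC, riseC, div_mul_div_comm, ← pow_two, hp, neg_one_mul, ← sub_eq_add_neg,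
    add_comm (1 / 2) z, h]
  field_simp

lemma hasJet_inv_cos :
    HasJet (fun z => (Complex.cos (Real.pi * z))⁻¹) 1 0 ((Real.pi : ℂ) ^ 2) := by
  have h0 : HasJet (fun z => (Complex.cos (Real.pi * z))⁻¹) _ _ _ :=
    .of_analyticAt (hasJet_cos.1.inv cos_pi_mul_zero_ne_zero)
  obtain ⟨h1, h2, h3⟩ := (h0.mul hasJet_cos).unique ((HasJet.const 1).congr (by
    filter_upwards [eventually_cos_pi_mul_ne_zero] with z hz
    rw [inv_mul_cancel₀ hz]))
  convert h0 using 1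
  · linear_combination -h1
  · linear_combination -h2
  · linear_combination -h3 - (Real.pi : ℂ) ^ 2 * h1

/-- With $A=(\frac12)_z$ and $B=(1)_z$, duplication says $4^zA(z)B(z)=B(2z)$ and reflection says
$A(z)A(-z)=1/\cos\pi z$. These do not determine $A$ and $B$ to second order, but they determine
$B/A$; the unknown derivatives cancel. -/
lemma hasJet_riseC_div :
    HasJet (fun z => riseC 1 z / riseC (1 / 2) z) 1 (Complex.log 4)
      (Complex.log 4 ^ 2 - (Real.pi : ℂ) ^ 2 / 3) := by
  have hA : HasJet (riseC (1 / 2)) _ _ _ := hasJet_riseC (by norm_num)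
  have hB : HasJet (riseC 1) _ _ _ := hasJet_riseC (by norm_num)
  have hne : riseC (1 / 2) 0 ≠ 0 := riseC_half_ne_zero (by norm_num)
  have hQ : HasJet (fun z => riseC 1 z / riseC (1 / 2) z) _ _ _ :=
    .of_analyticAt (hB.1.fun_div hA.1 hne)
  have hAB := (hasJet_four_cpow.mul (hA.mul hB)).unique
    ((hB.comp_mul_left 2).congr (.of_forall fun z => (four_cpow_mul_riseC z).symm))
  have hAA := (hA.mul (hA.comp_mul_left (-1))).unique
    (hasJet_inv_cos.congr (.of_forall fun z => (riseC_half_mul_riseC_half_neg z).symm))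
  have hQA := (hQ.mul hA).unique (hB.congr (by
    filter_upwards [eventually_abs_re_lt] with z hz
    rw [div_mul_cancel₀ _ (riseC_half_ne_zero hz)]))
  generalize deriv (riseC (1 / 2)) 0 = A₁ at *
  generalize deriv (deriv (riseC (1 / 2))) 0 = A₂ at *
  generalize deriv (riseC 1) 0 = B₁ at *
  generalize deriv (deriv (riseC 1)) 0 = B₂ at *
  generalize riseC 1 0 / riseC (1 / 2) 0 = Q₀ at *
  generalize deriv (fun z => riseC 1 z / riseC (1 / 2) z) 0 = Q₁ at *
  generalize deriv (deriv fun z => riseC 1 z / riseC (1 / 2) z) 0 = Q₂ at *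
  generalize Complex.log 4 = l at *
  obtain ⟨-, h1, h2⟩ := hAB
  obtain ⟨-, -, h3⟩ := hAA
  obtain ⟨h4, h5, h6⟩ := hQA
  have e0 : Q₀ = 1 := by linear_combination h4
  subst e0
  have e1 : B₁ = A₁ + l := by linear_combination -h1
  subst e1
  have e2 : Q₁ = l := by linear_combination h5
  subst e2
  convert hQ using 1
  linear_combination -h6 + h2 / 3 + h3 / 3

/-- With $l=\ln4$, the logarithm of $4^a\cos^{-3}(\pi a)(B/A)^5$ has first derivative $l+5l$ and
second derivative $3\pi^2-\frac53\pi^2$ at $0$. -/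
lemma hasJet_fSeries_main :
    HasJet (fun a => 8 / (Real.pi : ℂ) ^ 2 * ((4 : ℂ) ^ a / Complex.cos (Real.pi * a) ^ 3)
            * (riseC 1 a ^ 5 / riseC (1 / 2) a ^ 5))
      (8 / (Real.pi : ℂ) ^ 2) (8 / (Real.pi : ℂ) ^ 2 * (6 * Complex.log 4))
      (8 / (Real.pi : ℂ) ^ 2 * (36 * Complex.log 4 ^ 2 + 4 / 3 * (Real.pi : ℂ) ^ 2)) := by
  have hQ := hasJet_riseC_div
  have hD := hasJet_inv_cos
  have hQ2 := hQ.mul hQ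
  have h := (HasJet.const (8 / (Real.pi : ℂ) ^ 2)).mul
    ((hasJet_four_cpow.mul (hD.mul (hD.mul hD))).mul (hQ.mul (hQ2.mul hQ2)))
  convert h.congr (.of_forall fun a => ?_) using 1
  · ring
  · ring
  · ring
  · simp only [div_eq_mul_inv, ← inv_pow]
    ring

lemma analyticAt_tsum_wTerm : AnalyticAt ℂ (fun a => ∑' n, wTerm a n) 0 := by
  rw [Complex.analyticAt_iff_eventually_differentiableAt]
  filter_upwards [eventually_abs_re_lt] with z hz
  have h := abs_lt.1 hz
  exact differentiableAt_tsum_wTerm (by linarith) (by linarith)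

lemma analyticAt_tsum_vTerm : AnalyticAt ℂ (fun a => ∑' n, vTerm a n) 0 :=
  differentiableOn_tsum_vTerm.analyticAt (Metric.ball_mem_nhds 0 (by norm_num))

/-- Beyond the main term, the `wTerm` series carries a factor $a^2$ and adds
$\frac{32}\pi\cdot2\cdot(-\frac\pi2)=-32$ to the second derivative only. The `vTerm` series carries
$a^3$ and adds nothing, so its jet can stay unspecified. -/
lemma hasJet_fSeries :
    HasJet fSeries (8 / (Real.pi : ℂ) ^ 2) (96 / (Real.pi : ℂ) ^ 2 * (Real.log 2 : ℂ))
      (64 / (3 * (Real.pi : ℂ) ^ 2) * (54 * (Real.log 2 : ℂ) ^ 2 - (Real.pi : ℂ) ^ 2)) := by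
  have hpi : (Real.pi : ℂ) ≠ 0 := by exact_mod_cast Real.pi_ne_zero
  have hl : Complex.log 4 = 2 * (Real.log 2 : ℂ) := by
    rw [show (4 : ℂ) = ((4 : ℝ) : ℂ) by norm_num, ← Complex.ofReal_log (by norm_num),
      show (4 : ℝ) = 2 ^ 2 by norm_num, Real.log_pow]
    push_cast
    ring
  have hr : AnalyticAt ℂ (fun a : ℂ => (2 * a - 1)⁻¹) 0 :=
    AnalyticAt.fun_inv (by fun_prop) (by norm_num)
  have hK : HasJet (fun a => (2 * a - 1)⁻¹ * ∑' n, wTerm a n) _ _ _ :=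
    .of_analyticAt (hr.fun_mul analyticAt_tsum_wTerm)
  have hM : HasJet (fun a => (2 * a - 1)⁻¹ * ∑' n, vTerm a n) _ _ _ :=
    .of_analyticAt (hr.fun_mul analyticAt_tsum_vTerm)
  have hQ := hasJet_riseC_div
  have hz2 := HasJet.id.mul HasJet.id
  have h := (hasJet_fSeries_main.add ((HasJet.const (32 / (Real.pi : ℂ))).mul
    ((hz2.mul hasJet_inv_cos).mul ((hQ.mul hQ).mul hK)))).add
    ((HasJet.const 32).mul ((hz2.mul HasJet.id).mul hM))
  have h0 : (2 * (0 : ℂ) - 1)⁻¹ * ∑' n, wTerm 0 n = -(Real.pi / 2) := by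
    rw [tsum_wTerm_zero]; norm_num
  convert h.congr ?_ using 1
  · ring
  · rw [hl]; ring
  · rw [hl, h0]
    field_simp
    ring
  · filter_upwards [eventually_cos_pi_mul_ne_zero, eventually_abs_re_lt] with a hc ha
    have ha' := abs_lt.1 ha
    rw [fSeries_eq_add (ne_neg_of_re (by linarith)) hc (by linarith)]
    simp only [← div_pow]
    ring

end

theorem mainTheorem8 :
    -- the series defining `f` and `g` converge
    (∀ a : ℂ, (∀ m : ℕ, a ≠ -((m : ℂ) + 1)) →
      Summable (fTerm a) ∧ Summable (gTerm a)) ∧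
    -- first identity
    (∀ a : ℂ, 0 < a.re →
      Summable (uTerm a) ∧ fSeries a = 8 * a * ∑' n : ℕ, uTerm a n) ∧
    -- second identity
    (∀ a : ℂ, (∀ m : ℕ, a ≠ -((m : ℂ) + 1)) → Complex.cos (Real.pi * a) ≠ 0 →
      Summable (vTerm a) ∧
      fSeries a = gFactor a * gSeries a + 32 * a ^ 3 / (2 * a - 1) * ∑' n : ℕ, vTerm a n) ∧
    -- third identity
    (∀ a : ℂ, (∀ m : ℕ, a ≠ -((m : ℂ) + 1)) → Complex.cos (Real.pi * a) ≠ 0 →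
      a.re < 1 / 2 →
      Summable (wTerm a) ∧ Summable (vTerm a) ∧
      fSeries a =
        8 / (Real.pi : ℂ) ^ 2 * ((4 : ℂ) ^ a / Complex.cos (Real.pi * a) ^ 3)
            * (riseC 1 a ^ 5 / riseC (1 / 2) a ^ 5)
          + 32 / (Real.pi : ℂ) * (1 / Complex.cos (Real.pi * a))
            * (riseC 1 a ^ 2 / riseC (1 / 2) a ^ 2) * (a ^ 2 / (2 * a - 1))
            * ∑' n : ℕ, wTerm a n
          + 32 * a ^ 3 / (2 * a - 1) * ∑' n : ℕ, vTerm a n) ∧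
    -- consequence of the first identity
    fSeries (1 / 2) = 7 * riemannZeta 3 ∧
    -- consequence of the second identity
    (Tendsto (fun a : ℂ => fSeries a / a ^ 3 - gFactor a * (gSeries a / a ^ 3)) (𝓝[≠] 0)
        (𝓝 (((-32 * ∑' n : ℕ, cTerm n : ℝ)) : ℂ)) ∧
      Summable cTerm ∧
      -32 * ∑' n : ℕ, cTerm n = -128 * (catalanConst / Real.pi)) ∧
    -- consequences of the third identity
    (fSeries 0 = 8 / (Real.pi : ℂ) ^ 2 ∧
      AnalyticAt ℂ fSeries 0 ∧
      HasDerivAt fSeries (96 / (Real.pi : ℂ) ^ 2 * (Real.log 2 : ℂ)) 0 ∧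
      HasDerivAt (deriv fSeries)
        (64 / (3 * (Real.pi : ℂ) ^ 2) * (54 * (Real.log 2 : ℂ) ^ 2 - (Real.pi : ℂ) ^ 2)) 0) := by
  refine ⟨fun a ha => ⟨summable_fTerm ha, summable_gTerm ha⟩,
    fun a ha => ⟨summable_uTerm ha, fSeries_eq_tsum_uTerm ha⟩,
    fun a ha hc => ⟨summable_vTerm ha hc, fSeries_eq_gSeries_add ha hc⟩,
    fun a ha hc hre => ⟨summable_wTerm ha hre, summable_vTerm ha hc, fSeries_eq_add ha hc hre⟩,
    fSeries_half,
    ⟨tendsto_fSeries_div_sub, summable_cTerm, by rw [tsum_cTerm]; ring⟩, ?_⟩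
  have h := hasJet_fSeries
  exact ⟨h.2, h.1, h.3 ▸ h.1.differentiableAt.hasDerivAt,
    h.4 ▸ h.1.deriv.differentiableAt.hasDerivAt⟩
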